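/- Let $S^2\subset\mathbb R^3$ be the unit sphere with its area measure $\omega$ (total mass $4\pi$). Let $C^\infty(S^2)$ be the real-valued smooth functions, let $C^\infty_{\rm odd}(S^2)=\{h\in C^\infty(S^2): h(-u)=-h(u)\}$, and let $C^\infty_{{\rm even}\,*}(S^2)=\{h\in C^\infty(S^2): h(-u)=h(u),\ \int_{S^2}h\,\omega=0\}$. For $t\in\mathbb R$, $y\in S^2$ put $$Qh(t,y)=\frac1{2\pi}\int_{\{u\in S^2:\,u\cdot y>\tanh t\}}h(u)\,\omega,$$ and let $Rh(t,y)$ be the mean of $h$ over the circle $\{u\in S^2: u\cdot y=\tanh t\}$. Let $\mathcal Q h(y)=Qh(0,y)$ and $\mathcal R h(y)=Rh(0,y)$ be the restrictions to the neck sphere $t=0$; thus $\mathcal Qh(y)=\frac1{2\pi}\int_{u\cdot y>0}h\,\omega$, and $\mathcal Rh(y)$ is the mean of $h$ over the great circle orthogonal to $y$. Let $\mathcal H^k\subset L^2(S^2)$ be the space of restrictions to $S^2$ of real homogeneous harmonic polynomials of degree $k$ on $\mathbb R^3$. For $s\in\mathbb R$ and $h\in L^2(S^2)$ with orthogonal projections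 $h_k\in\mathcal H^k$, put $$|h|_s=\Big(\sum_{k\ge0}\max(1,k)^{2s}\|h_k\|_{L^2}^2\Big)^{1/2}\in[0,\infty],$$ $H^s=\{h\in L^2(S^2):|h|_s<\infty\}$ and $H^s_{\rm odd}=H^s\cap L^2_{\rm odd}(S^2)$, where $L^2_{\rm odd}(S^2)$ is the space of odd functions in $L^2(S^2)$. **Theorem.** 1. $\mathcal Q: C^\infty_{\rm odd}(S^2)\to C^\infty_{\rm odd}(S^2)$ and $\mathcal R: C^\infty_{{\rm even}\,*}(S^2)\to C^\infty_{{\rm even}\,*}(S^2)$ are well defined and bijective. On $C^\infty(S^2)$ one has $\ker\mathcal Q=C^\infty_{{\rm even}\,*}(S^2)$ and $\ker\mathcal R=C^\infty_{\rm odd}(S^2)$. 2. For every $h\in\mathcal H^k$ one has $\mathcal Qh=c(k)\,h$, where $c(0)=1$, $c(2m)=0$ for $m\ge1$, and $$c(2m+1)=(-1)^m\,\frac{1}{2m+1}\cdot\frac{(2m+1)!!}{(2m+2)!!}\qquad(m\ge0).$$ 3. There is a constant $c>1$ such that for all $s\in\mathbb R$ and all $h\in L^2_{\rm odd}(S^2)$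 (in particular for all $h\in H^s_{\rm odd}$) $$\frac1c\,|h|_s\le|\mathcal Qh|_{s+3/2}\le c\,|h|_s .$$ For every real $s\ge0$, the linear operator $\mathcal Q$ on $L^2(S^2)$ maps $H^s_{\rm odd}$ bijectively onto $H^{s+3/2}_{\rm odd}$. -/

import Mathlib

open MeasureTheory Set
open scoped Manifold ContDiff Nat

noncomputable section

namespace NeckTransform

/-! ### The sphere, its area measure, and spaces of smooth functions -/

/-- The unit sphere in Euclidean 3-space. -/
abbrev S2 : Type := Metric.sphere (0 : EuclideanSpace ℝ (Fin 3)) 1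

instance : Fact (Module.finrank ℝ (EuclideanSpace ℝ (Fin 3)) = 2 + 1) := ⟨by simp⟩

/-- The area measure of the unit sphere (of total mass `4 * π`). -/
abbrev area : Measure S2 := (volume : Measure (EuclideanSpace ℝ (Fin 3))).toSphere

/-- `C^∞(S²)`: real-valued smooth functions. -/
def smoothFun : Set (S2 → ℝ) := {h | ContMDiff (𝓡 2) 𝓘(ℝ, ℝ) ∞ h}

/-- `C^∞_odd(S²)`. -/
def smoothOdd : Set (S2 → ℝ) := {h | h ∈ smoothFun ∧ ∀ u, h (-u) = -h u}

/-- `C^∞_{even *}(S²)`: even smooth functions with vanishing integral. -/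
def smoothEvenZeroMean : Set (S2 → ℝ) :=
  {h | h ∈ smoothFun ∧ (∀ u, h (-u) = h u) ∧ ∫ u, h u ∂area = 0}

/-! ### The integral transforms, with de Sitter space identified with `ℝ × S²` -/

/-- The open cap `Ω_(t,y) = {u | u · y > tanh t}`. -/
def cap (t : ℝ) (y : S2) : Set S2 :=
  {u | inner ℝ (u : EuclideanSpace ℝ (Fin 3)) (y : EuclideanSpace ℝ (Fin 3)) > Real.tanh t}

/-- The transform `Q h (t, y) = (1 / 2π) ∫_{Ω_(t,y)} h`. -/
def capTransform (h : S2 → ℝ) (t : ℝ) (y : S2) : ℝ :=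
  1 / (2 * Real.pi) * ∫ u in cap t y, h u ∂area

/-- The restriction of `Q` to the neck sphere `t = 0`. -/
def neckQ (h : S2 → ℝ) (y : S2) : ℝ := capTransform h 0 y

/-- An orthonormal basis of the plane orthogonal to `y`. -/
def perpBasis (y : S2) :
    OrthonormalBasis (Fin 2) ℝ (Submodule.span ℝ {(y : EuclideanSpace ℝ (Fin 3))})ᗮ :=
  OrthonormalBasis.fromOrthogonalSpanSingleton (𝕜 := ℝ) 2 (ne_zero_of_mem_unit_sphere y)

/-- The ambient formula for the parametrization of the small circle bounding `cap t y`. -/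
def circleVec (t : ℝ) (y : S2) (θ : ℝ) : EuclideanSpace ℝ (Fin 3) :=
  (Real.cos θ / Real.cosh t) • (perpBasis y 0 : EuclideanSpace ℝ (Fin 3))
    + (Real.sin θ / Real.cosh t) • (perpBasis y 1 : EuclideanSpace ℝ (Fin 3))
    + Real.tanh t • (y : EuclideanSpace ℝ (Fin 3))

theorem circleVec_mem (t : ℝ) (y : S2) (θ : ℝ) :
    circleVec t y θ ∈ Metric.sphere (0 : EuclideanSpace ℝ (Fin 3)) 1 := by
  have h0 : ‖(perpBasis y 0 : EuclideanSpace ℝ (Fin 3))‖ = 1 := (perpBasis y).orthonormal.1 0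
  have h1 : ‖(perpBasis y 1 : EuclideanSpace ℝ (Fin 3))‖ = 1 := (perpBasis y).orthonormal.1 1
  have h01 : inner ℝ (perpBasis y 0 : EuclideanSpace ℝ (Fin 3))
      (perpBasis y 1 : EuclideanSpace ℝ (Fin 3)) = 0 :=
    (perpBasis y).orthonormal.2 (i := 0) (j := 1) (by decide)
  have hy : ‖(y : EuclideanSpace ℝ (Fin 3))‖ = 1 := by simp
  have hp : ∀ i, inner ℝ (perpBasis y i : EuclideanSpace ℝ (Fin 3))
      (y : EuclideanSpace ℝ (Fin 3)) = 0 := fun i => by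
    rw [real_inner_comm]
    exact Submodule.mem_orthogonal_singleton_iff_inner_right.1 (perpBasis y i).2
  have hc : Real.cosh t ≠ 0 := (Real.cosh_pos t).ne'
  have key : ‖circleVec t y θ‖ ^ 2 = 1 := by
    rw [circleVec, norm_add_sq_real, norm_add_sq_real]
    simp only [inner_add_left, inner_smul_left, inner_smul_right, hp, h01, norm_smul, h0, h1, hy,
      mul_one, mul_zero, add_zero, Real.norm_eq_abs, sq_abs, Real.tanh_eq_sinh_div_cosh]
    field_simp
    rw [Real.cos_sq_add_sin_sq]
    linarith [Real.cosh_sq t]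
  rw [mem_sphere_zero_iff_norm]
  exact (pow_eq_one_iff_of_nonneg (norm_nonneg _) two_ne_zero).1 key

/-- The parametrization of the small circle bounding `cap t y`. -/
def circleParam (t : ℝ) (y : S2) (θ : ℝ) : S2 := ⟨circleVec t y θ, circleVec_mem t y θ⟩

/-- The transform `R h (t, y)`: the average of `h` over the small circle bounding `cap t y`.
The value does not depend on the chosen orthonormal basis of the plane orthogonal to `y`. -/
def circleTransform (h : S2 → ℝ) (t : ℝ) (y : S2) : ℝ :=
  1 / (2 * Real.pi) * ∫ θ in (0 : ℝ)..(2 * Real.pi), h (circleParam t y θ)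

/-- The restriction of `R` to the neck sphere: the Funk transform. -/
def neckR (h : S2 → ℝ) (y : S2) : ℝ := circleTransform h 0 y

/-! ### Spherical harmonics -/

/-- The Laplacian on polynomials in three variables. -/
def polyLaplacian : MvPolynomial (Fin 3) ℝ →ₗ[ℝ] MvPolynomial (Fin 3) ℝ :=
  ∑ i : Fin 3, (MvPolynomial.pderiv i).toLinearMap ∘ₗ (MvPolynomial.pderiv i).toLinearMap

/-- Homogeneous harmonic polynomials of degree `k` on `ℝ³`. -/
def harmonicPoly (k : ℕ) : Submodule ℝ (MvPolynomial (Fin 3) ℝ) :=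
  MvPolynomial.homogeneousSubmodule (Fin 3) ℝ k ⊓ LinearMap.ker polyLaplacian

/-- The restriction of a polynomial to the sphere. -/
def polyRestrict : MvPolynomial (Fin 3) ℝ →ₐ[ℝ] C(S2, ℝ) :=
  MvPolynomial.aeval fun i =>
    (⟨fun u => (u : EuclideanSpace ℝ (Fin 3)) i, by fun_prop⟩ : C(S2, ℝ))

/-- Real `L²(S²)`. -/
abbrev L2 : Type := Lp ℝ 2 area

/-- Spherical harmonics of degree `k`, as a subspace of `L²(S²)`. -/
def harmonics (k : ℕ) : Submodule ℝ L2 :=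
  (harmonicPoly k).map
    ((ContinuousMap.toLp (E := ℝ) 2 area ℝ).toLinearMap ∘ₗ polyRestrict.toLinearMap)

instance (k : ℕ) : FiniteDimensional ℝ (harmonics k) := by
  have h1 : FiniteDimensional ℝ (MvPolynomial.homogeneousSubmodule (Fin 3) ℝ k) :=
    Module.Finite.iff_fg.2 (MvPolynomial.homogeneousSubmodule_fg (σ := Fin 3) (R := ℝ) k)
  have h2 : FiniteDimensional ℝ (harmonicPoly k) :=
    Submodule.finiteDimensional_of_le
      (inf_le_left : harmonicPoly k ≤ MvPolynomial.homogeneousSubmodule (Fin 3) ℝ k)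
  unfold harmonics
  infer_instance

/-! ### Sobolev spaces on the sphere -/

/-- The squared Sobolev norm `∑ₖ k^(2s) ‖hₖ‖²` of `h = ∑ₖ hₖ`, where `hₖ` is the orthogonal
projection of `h` to the spherical harmonics of degree `k`. In degree `0` the weight is `1`. -/
def sobolevEnergy (s : ℝ) (h : L2) : ENNReal :=
  ∑' k : ℕ, ENNReal.ofReal ((max 1 (k : ℝ)) ^ (2 * s)) * ‖(harmonics k).starProjection h‖ₑ ^ 2

/-- The Sobolev norm of order `s`, with value `∞` off the Sobolev space. -/
def sobolevNorm (s : ℝ) (h : L2) : ENNReal := sobolevEnergy s h ^ (1 / 2 : ℝ)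

theorem sobolevNorm_lt_top_iff (s : ℝ) (h : L2) :
    sobolevNorm s h < ⊤ ↔ sobolevEnergy s h < ⊤ :=
  ENNReal.rpow_lt_top_iff_of_pos (by norm_num)

/-- The Sobolev space `H^s(S²)` inside `L²(S²)` (for `s ≥ 0` this is all of `H^s(S²)`). -/
def sobolev (s : ℝ) : Submodule ℝ L2 where
  carrier := {h | sobolevNorm s h < ⊤}
  zero_mem' := by
    simp [sobolevNorm_lt_top_iff, sobolevEnergy]
  add_mem' := by
    intro f g hf hg
    simp only [mem_ofPred_eq, sobolevNorm_lt_top_iff] at hf hg ⊢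
    have hle : sobolevEnergy s (f + g) ≤ 2 * sobolevEnergy s f + 2 * sobolevEnergy s g := by
      unfold sobolevEnergy
      rw [← ENNReal.tsum_mul_left, ← ENNReal.tsum_mul_left, ← ENNReal.tsum_add]
      refine ENNReal.tsum_le_tsum fun k => ?_
      have h1 : ‖(harmonics k).starProjection (f + g)‖ₑ ^ 2 ≤
          2 * (‖(harmonics k).starProjection f‖ₑ ^ 2 + ‖(harmonics k).starProjection g‖ₑ ^ 2) := by
        rw [map_add]
        refine (pow_le_pow_left' (enorm_add_le _ _) 2).trans ?_
        have h2 : (2 : ENNReal) ^ (2 - 1 : ℝ) = 2 := by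
          rw [show (2 - 1 : ℝ) = 1 by norm_num, ENNReal.rpow_one]
        simpa [h2] using ENNReal.rpow_add_le_mul_rpow_add_rpow
          ‖(harmonics k).starProjection f‖ₑ ‖(harmonics k).starProjection g‖ₑ
          (p := 2) (by norm_num)
      refine (mul_le_mul_right h1 _).trans (le_of_eq ?_)
      ring
    exact hle.trans_lt (ENNReal.add_lt_top.2
      ⟨ENNReal.mul_lt_top (by simp) hf, ENNReal.mul_lt_top (by simp) hg⟩)
  smul_mem' := by
    intro c f hf
    simp only [mem_ofPred_eq, sobolevNorm_lt_top_iff] at hf ⊢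
    have he : sobolevEnergy s (c • f) = ‖c‖ₑ ^ 2 * sobolevEnergy s f := by
      unfold sobolevEnergy
      rw [← ENNReal.tsum_mul_left]
      refine tsum_congr fun k => ?_
      rw [map_smul, enorm_smul]
      ring
    rw [he]
    exact ENNReal.mul_lt_top (by simp) hf

/-- `L²_odd(S²)`: the classes of odd functions. -/
def oddL2 : Submodule ℝ L2 where
  carrier := {h | ∃ f : S2 → ℝ, (∀ u, f (-u) = -f u) ∧ h =ᵐ[area] f}
  zero_mem' := ⟨0, by simp, Lp.coeFn_zero _ _ _⟩
  add_mem' := by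
    rintro a b ⟨f, hf, haf⟩ ⟨g, hg, hbg⟩
    exact ⟨f + g, fun u => by simp [hf u, hg u, add_comm],
      (Lp.coeFn_add a b).trans (haf.add hbg)⟩
  smul_mem' := by
    rintro c a ⟨f, hf, haf⟩
    exact ⟨c • f, fun u => by simp [hf u], (Lp.coeFn_smul c a).trans (haf.const_smul c)⟩

/-- `H^s_odd = H^s ∩ L²_odd`. -/
def sobolevOdd (s : ℝ) : Submodule ℝ L2 := sobolev s ⊓ oddL2

/-! ### The neck transform on `L²(S²)` -/

theorem L2.integrable (h : L2) : Integrable h area :=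
  (Lp.memLp h).integrable (by norm_num)

theorem neckQ_congr {f g : S2 → ℝ} (hfg : f =ᵐ[area] g) : neckQ f = neckQ g := by
  funext y
  simp only [neckQ, capTransform]
  rw [integral_congr_ae (ae_restrict_of_ae hfg)]

theorem measurableSet_cap (t : ℝ) (y : S2) : MeasurableSet (cap t y) := by
  have hc : Continuous fun u : S2 =>
      inner ℝ (u : EuclideanSpace ℝ (Fin 3)) (y : EuclideanSpace ℝ (Fin 3)) := by fun_prop
  exact measurableSet_lt measurable_const hc.measurable

theorem neckQ_memLp (h : L2) : MemLp (neckQ h) 2 area := by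
  have hS : MeasurableSet {p : S2 × S2 | p.2 ∈ cap 0 p.1} := by
    have hc : Continuous fun p : S2 × S2 => inner ℝ (p.2 : EuclideanSpace ℝ (Fin 3))
        (p.1 : EuclideanSpace ℝ (Fin 3)) := by fun_prop
    exact measurableSet_lt measurable_const hc.measurable
  have hm : StronglyMeasurable (neckQ h) := by
    have : neckQ h = fun y => 1 / (2 * Real.pi) *
        ∫ u, ({p : S2 × S2 | p.2 ∈ cap 0 p.1}.indicator (fun p => h p.2)) (y, u) ∂area := by
      funext y
      simp only [neckQ, capTransform]
      rw [← integral_indicator (measurableSet_cap 0 y)]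
      rfl
    rw [this]
    refine StronglyMeasurable.const_mul ?_ _
    exact (((Lp.stronglyMeasurable h).comp_measurable measurable_snd).indicator
      hS).integral_prod_right'
  refine MemLp.of_bound hm.aestronglyMeasurable
    (1 / (2 * Real.pi) * ∫ u, ‖h u‖ ∂area) (Filter.Eventually.of_forall fun y => ?_)
  rw [neckQ, capTransform, norm_mul, Real.norm_of_nonneg (by positivity)]
  refine mul_le_mul_of_nonneg_left ?_ (by positivity)
  exact (norm_integral_le_integral_norm _).trans
    (setIntegral_le_integral h.integrable.norm (Filter.Eventually.of_forall fun _ => norm_nonneg _))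

/-- The neck transform as a linear operator on `L²(S²)`. -/
def neckQL2 : L2 →ₗ[ℝ] L2 where
  toFun h := (neckQ_memLp h).toLp (neckQ h)
  map_add' f g := by
    rw [← MemLp.toLp_add]
    refine (MemLp.toLp_eq_toLp_iff _ _).2 (Filter.Eventually.of_forall fun y => ?_)
    rw [neckQ_congr (Lp.coeFn_add f g)]
    simp only [neckQ, capTransform, Pi.add_apply]
    rw [integral_add f.integrable.integrableOn g.integrable.integrableOn, mul_add]
  map_smul' c f := by
    rw [RingHom.id_apply, ← MemLp.toLp_const_smul]
    refine (MemLp.toLp_eq_toLp_iff _ _).2 (Filter.Eventually.of_forall fun y => ?_)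
    rw [neckQ_congr (Lp.coeFn_smul c f)]
    simp only [neckQ, capTransform, Pi.smul_apply, smul_eq_mul]
    rw [integral_const_mul]
    ring

end NeckTransform

end

open MeasureTheory Set
open scoped Manifold ContDiff Nat

noncomputable section

namespace NeckTransform

/-! ### Polynomial algebra in three variables -/

/-! Both transforms commute with rotations, so they act on each space of spherical harmonics of
degree `k` by a scalar, `eigenQ k` or `eigenR k`. Once these scalars are known, with two-sided
bounds, every claim concerns multipliers on expansions in spherical harmonics.

The scalars. A rotation moves `y` to the pole `e₂`. Write a harmonic `P` of degree `k` as `∑ x₂ʲ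
pⱼ(x₀, x₁)`; harmonicity says `Δpⱼ = -(j+2)(j+1) pⱼ₊₂`. If a functional `M` on plane polynomials
satisfies `M(Δp) = κ(n) M(p)` for `p` homogeneous of degree `n`, then `M(p₀)` is tied step by step
to `p_k`, which is the constant `P(e₂)` (`prod_mul_sliceMoment_zero`). The mean over the unit circle
is such an `M` with `κ(n) = n²`, which settles the Funk transform. For the hemisphere, polar
coordinates replace the integral by a Gaussian integral over the half space, and the divergence
theorem turns `k` times that into a Gaussian integral of `∂₂P` over the plane
(`halfSpaceMoment_euler`), where `κ(n) = n`.

The expansion. The rotation fields are skew on `L²` and the sum of their squares is `-k(k+1)` in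
degree `k`. This gives orthogonality; the decomposition `P = H + r²K` and Stone–Weierstrass give
completeness. A function is smooth exactly when it is the sum of a series of harmonics with rapidly
decreasing `L²` norms (`exists_isRapid_of_mem_smoothFun`, `IsRapid.series_mem_smoothFun`). One
direction pairs powers of `1 - Δ` with harmonics. The other differentiates termwise, using a sup
bound for harmonics (`abs_evalPoly_le`) that is itself read off from the nonzero eigenvalues of
`neckQ`.

Conclusion. Odd functions and even functions of mean zero are those with spectrum in the odd, resp.
positive even degrees. There the relevant eigenvalue is nonzero with inverse of polynomial growth
(`IsMultiplier.bijOn`), and the kernels are the zero sets of the eigenvalues (`IsMultiplier.ker`).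
The sharper fact that `k³ c(k)²` lies between `1/4` and `3/2` for odd `k` is the gain of `3/2`
derivatives. -/

open MvPolynomial in
theorem pderiv_comm (i j : Fin 3) (P : MvPolynomial (Fin 3) ℝ) :
    pderiv i (pderiv j P) = pderiv j (pderiv i P) := by
  ext m
  simp only [coeff_pderiv]
  by_cases h : i = j
  · subst h; rfl
  · rw [add_right_comm]
    simp [Finsupp.add_apply, h, Ne.symm h]
    ring

theorem polyLaplacian_apply (P : MvPolynomial (Fin 3) ℝ) :
    polyLaplacian P = ∑ i, MvPolynomial.pderiv i (MvPolynomial.pderiv i P) := by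
  simp [polyLaplacian, LinearMap.sum_apply]

/-- The Euler operator. -/
def euler : Derivation ℝ (MvPolynomial (Fin 3) ℝ) (MvPolynomial (Fin 3) ℝ) :=
  ∑ i : Fin 3, (MvPolynomial.X i : MvPolynomial (Fin 3) ℝ) • MvPolynomial.pderiv i

theorem euler_apply (P : MvPolynomial (Fin 3) ℝ) :
    euler P = ∑ i, MvPolynomial.X i * MvPolynomial.pderiv i P := by
  simp [euler, Fin.sum_univ_three]

theorem euler_of_isHomogeneous {P : MvPolynomial (Fin 3) ℝ} {k : ℕ} (hP : P.IsHomogeneous k) :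
    euler P = (k : ℝ) • P := by
  rw [euler_apply, hP.sum_X_mul_pderiv, Nat.cast_smul_eq_nsmul]

/-- The infinitesimal rotation about the `i`-th coordinate axis. -/
def angMom (i : Fin 3) : Derivation ℝ (MvPolynomial (Fin 3) ℝ) (MvPolynomial (Fin 3) ℝ) :=
  (MvPolynomial.X (i + 1) : MvPolynomial (Fin 3) ℝ) • MvPolynomial.pderiv (i + 2) -
    (MvPolynomial.X (i + 2) : MvPolynomial (Fin 3) ℝ) • MvPolynomial.pderiv (i + 1)

theorem angMom_apply (i : Fin 3) (P : MvPolynomial (Fin 3) ℝ) :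
    angMom i P = MvPolynomial.X (i + 1) * MvPolynomial.pderiv (i + 2) P -
      MvPolynomial.X (i + 2) * MvPolynomial.pderiv (i + 1) P := by
  simp [angMom]

/-- The polynomial `x₀² + x₁² + x₂²`. -/
def normSqPoly : MvPolynomial (Fin 3) ℝ := ∑ i, MvPolynomial.X i ^ 2

theorem normSqPoly_isHomogeneous : normSqPoly.IsHomogeneous 2 :=
  MvPolynomial.IsHomogeneous.sum _ _ _ fun i _ => by
    simpa using (MvPolynomial.isHomogeneous_X ℝ i).pow 2

theorem X_mul_pderiv_isHomogeneous {P : MvPolynomial (Fin 3) ℝ} {k : ℕ}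
    (hP : P.IsHomogeneous k) (i j : Fin 3) :
    (MvPolynomial.X i * MvPolynomial.pderiv j P).IsHomogeneous k := by
  rcases k with _ | k
  · have : MvPolynomial.pderiv j P = 0 := by
      have h := (MvPolynomial.totalDegree_zero_iff_isHomogeneous _).2 hP
      rw [MvPolynomial.totalDegree_eq_zero_iff_eq_C] at h
      rw [h, MvPolynomial.pderiv_C]
    rw [this, mul_zero]
    exact MvPolynomial.isHomogeneous_zero _ _ _
  · have := (MvPolynomial.isHomogeneous_X ℝ i).mul (hP.pderiv (i := j))
    rwa [Nat.add_sub_cancel, add_comm] at this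

theorem angMom_isHomogeneous {P : MvPolynomial (Fin 3) ℝ} {k : ℕ}
    (hP : P.IsHomogeneous k) (i : Fin 3) : (angMom i P).IsHomogeneous k := by
  rw [angMom_apply]
  exact (X_mul_pderiv_isHomogeneous hP _ _).sub (X_mul_pderiv_isHomogeneous hP _ _)

theorem polyLaplacian_isHomogeneous {P : MvPolynomial (Fin 3) ℝ} {k : ℕ}
    (hP : P.IsHomogeneous k) : (polyLaplacian P).IsHomogeneous (k - 2) := by
  rw [polyLaplacian_apply]
  exact MvPolynomial.IsHomogeneous.sum _ _ _ fun i _ => hP.pderiv.pderiv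

theorem polyLaplacian_angMom (i : Fin 3) (P : MvPolynomial (Fin 3) ℝ) :
    polyLaplacian (angMom i P) = angMom i (polyLaplacian P) := by
  simp only [polyLaplacian_apply, angMom_apply, Fin.sum_univ_three, map_add, map_sub,
    Derivation.leibniz, MvPolynomial.pderiv_X, smul_eq_mul]
  fin_cases i <;> simp <;>
    simp only [pderiv_comm 1 0, pderiv_comm 2 0, pderiv_comm 2 1] <;> ring

theorem polyLaplacian_pderiv (i : Fin 3) (P : MvPolynomial (Fin 3) ℝ) :
    polyLaplacian (MvPolynomial.pderiv i P) = MvPolynomial.pderiv i (polyLaplacian P) := by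
  simp only [polyLaplacian_apply, map_sum]
  refine Finset.sum_congr rfl fun j _ => ?_
  rw [pderiv_comm j i, pderiv_comm j i]

/-- The Casimir identity `|x × ∇|² = r²Δ - E² - E`. For harmonic `P` of degree `k` it yields the
eigenvalue `-k(k+1)` of the spherical Laplacian without leaving polynomials. -/
theorem sum_angMom_sq (P : MvPolynomial (Fin 3) ℝ) :
    ∑ i, angMom i (angMom i P) = normSqPoly * polyLaplacian P - euler (euler P) - euler P := by
  simp only [polyLaplacian_apply, angMom_apply, euler_apply, normSqPoly, Fin.sum_univ_three,
    map_add, map_sub, Derivation.leibniz, MvPolynomial.pderiv_X, smul_eq_mul]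
  simp
  simp only [pderiv_comm 1 0, pderiv_comm 2 0, pderiv_comm 2 1]
  ring

theorem polyLaplacian_normSqPoly_mul {P : MvPolynomial (Fin 3) ℝ} {k : ℕ}
    (hP : P.IsHomogeneous k) :
    polyLaplacian (normSqPoly * P) = normSqPoly * polyLaplacian P + (4 * k + 6 : ℝ) • P := by
  have h : polyLaplacian (normSqPoly * P) =
      normSqPoly * polyLaplacian P + (4 : ℝ) • euler P + (6 : ℝ) • P := by
    simp only [polyLaplacian_apply, euler_apply, normSqPoly, Fin.sum_univ_three,
      map_add, Derivation.leibniz, MvPolynomial.pderiv_X, smul_eq_mul, pow_two]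
    simp [MvPolynomial.smul_eq_C_mul]
    rw [map_ofNat MvPolynomial.C 4, map_ofNat MvPolynomial.C 6]
    ring
  rw [h, euler_of_isHomogeneous hP, smul_smul, add_assoc, ← add_smul]

theorem polyLaplacian_eq_zero_of_lt_two {k : ℕ} (hk : k < 2) {P : MvPolynomial (Fin 3) ℝ}
    (hP : P.IsHomogeneous k) : polyLaplacian P = 0 := by
  rw [polyLaplacian_apply]
  refine Finset.sum_eq_zero fun i _ => ?_
  have h1 : (MvPolynomial.pderiv i P).IsHomogeneous 0 := by
    have := hP.pderiv (i := i)
    rwa [show k - 1 = 0 by omega] at this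
  have h := (MvPolynomial.totalDegree_zero_iff_isHomogeneous _).2 h1
  rw [MvPolynomial.totalDegree_eq_zero_iff_eq_C] at h
  rw [h, MvPolynomial.pderiv_C]

/-- Surjectivity of `r²Δ + c` in each degree. The ansatz `G = c⁻¹(F - r²K)` reduces it to the
equation `r²ΔK + (c + 4d + 6)K = ΔF` two degrees lower. The constant grows along the way, which is
why the induction runs over all `c > 0`. -/
theorem exists_normSqPoly_mul_polyLaplacian_add_smul (k : ℕ) :
    ∀ c : ℝ, 0 < c → ∀ F : MvPolynomial (Fin 3) ℝ, F.IsHomogeneous k →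
      ∃ G : MvPolynomial (Fin 3) ℝ, G.IsHomogeneous k ∧
        normSqPoly * polyLaplacian G + c • G = F := by
  induction k using Nat.strong_induction_on with
  | _ k ih =>
  intro c hc F hF
  rcases lt_or_ge k 2 with hk | hk
  · refine ⟨c⁻¹ • F, (MvPolynomial.homogeneousSubmodule (Fin 3) ℝ k).smul_mem _ hF, ?_⟩
    have h0 : polyLaplacian F = 0 := polyLaplacian_eq_zero_of_lt_two hk hF
    rw [map_smul, h0, smul_zero, mul_zero, zero_add, smul_inv_smul₀ hc.ne']
  · obtain ⟨d, rfl⟩ := Nat.exists_eq_add_of_le' hk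
    have hd : (polyLaplacian F).IsHomogeneous d := polyLaplacian_isHomogeneous hF
    obtain ⟨K, hK, hKe⟩ := ih d (by omega) (c + (4 * d + 6)) (by positivity) _ hd
    refine ⟨c⁻¹ • (F - normSqPoly * K),
      (MvPolynomial.homogeneousSubmodule (Fin 3) ℝ (d + 2)).smul_mem _ (hF.sub ?_), ?_⟩
    · rw [add_comm d]; exact normSqPoly_isHomogeneous.mul hK
    · rw [smul_inv_smul₀ hc.ne', map_smul, map_sub, polyLaplacian_normSqPoly_mul hK, ← hKe]
      rw [show normSqPoly * polyLaplacian K + (c + (4 * d + 6)) • K -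
          (normSqPoly * polyLaplacian K + (4 * d + 6 : ℝ) • K) = c • K by
        rw [add_smul]; ring, inv_smul_smul₀ hc.ne']
      ring

theorem mem_harmonicPoly {k : ℕ} {P : MvPolynomial (Fin 3) ℝ} :
    P ∈ harmonicPoly k ↔ P.IsHomogeneous k ∧ polyLaplacian P = 0 := by
  simp [harmonicPoly]

/-- Harmonicity of `P - r²K` means `r²ΔK + (4k+6)K = ΔP`, an instance of the preceding surjectivity.
-/
theorem exists_harmonic_add_normSqPoly_mul {k : ℕ} {P : MvPolynomial (Fin 3) ℝ}
    (hP : P.IsHomogeneous (k + 2)) :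
    ∃ H ∈ harmonicPoly (k + 2), ∃ K : MvPolynomial (Fin 3) ℝ, K.IsHomogeneous k ∧
      P = H + normSqPoly * K := by
  obtain ⟨K, hK, hKe⟩ := exists_normSqPoly_mul_polyLaplacian_add_smul k (4 * k + 6)
    (by positivity) _ (polyLaplacian_isHomogeneous hP)
  refine ⟨P - normSqPoly * K, mem_harmonicPoly.2 ⟨hP.sub ?_, ?_⟩, K, hK, by ring⟩
  · rw [add_comm k]; exact normSqPoly_isHomogeneous.mul hK
  · rw [map_sub, polyLaplacian_normSqPoly_mul hK, hKe, sub_self]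

theorem mem_harmonicPoly_of_lt_two {k : ℕ} (hk : k < 2) {P : MvPolynomial (Fin 3) ℝ}
    (hP : P.IsHomogeneous k) : P ∈ harmonicPoly k :=
  mem_harmonicPoly.2 ⟨hP, polyLaplacian_eq_zero_of_lt_two hk hP⟩

theorem angMom_mem_harmonicPoly {k : ℕ} {P : MvPolynomial (Fin 3) ℝ} (hP : P ∈ harmonicPoly k)
    (i : Fin 3) : angMom i P ∈ harmonicPoly k := by
  rw [mem_harmonicPoly] at hP ⊢
  exact ⟨angMom_isHomogeneous hP.1 i, by rw [polyLaplacian_angMom, hP.2, map_zero]⟩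

theorem pderiv_mem_harmonicPoly {k : ℕ} {P : MvPolynomial (Fin 3) ℝ} (hP : P ∈ harmonicPoly k)
    (i : Fin 3) : MvPolynomial.pderiv i P ∈ harmonicPoly (k - 1) := by
  rw [mem_harmonicPoly] at hP ⊢
  exact ⟨hP.1.pderiv, by rw [polyLaplacian_pderiv, hP.2, map_zero]⟩

theorem sum_angMom_sq_of_harmonic {k : ℕ} {P : MvPolynomial (Fin 3) ℝ} (hP : P ∈ harmonicPoly k) :
    ∑ i, angMom i (angMom i P) = -(k * (k + 1) : ℝ) • P := by
  rw [mem_harmonicPoly] at hP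
  rw [sum_angMom_sq, hP.2, euler_of_isHomogeneous hP.1, Derivation.map_smul,
    euler_of_isHomogeneous hP.1]
  simp only [MvPolynomial.smul_eq_C_mul, map_neg, map_mul, map_add, map_one]
  ring

/-! ### The area measure -/

/-- Euclidean 3-space. -/
abbrev E3 : Type := EuclideanSpace ℝ (Fin 3)

/-- The radial projection to the sphere, with a junk value at the origin. -/
def sphereProj (x : E3) : S2 :=
  if h : x = 0 then ⟨EuclideanSpace.single 2 1, by simp⟩
  else ⟨‖x‖⁻¹ • x, by simp [norm_smul, norm_ne_zero_iff.2 h]⟩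

theorem coe_sphereProj {x : E3} (hx : x ≠ 0) : (sphereProj x : E3) = ‖x‖⁻¹ • x := by
  simp [sphereProj, hx]

theorem coe_ne_zero (u : S2) : (u : E3) ≠ 0 := ne_zero_of_mem_unit_sphere u

theorem sphereProj_coe (u : S2) : sphereProj u = u :=
  Subtype.ext (by rw [coe_sphereProj (coe_ne_zero u)]; simp)

theorem integral_mul_norm_eq (f : S2 → ℝ) (g : ℝ → ℝ) :
    ∫ x : E3, f (sphereProj x) * g ‖x‖ =
      (∫ u, f u ∂area) * ∫ r in Ioi (0 : ℝ), r ^ 2 * g r := by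
  have h1 : ∫ x : E3, f (sphereProj x) * g ‖x‖ =
      ∫ x : ({(0)}ᶜ : Set E3), f (sphereProj x.1) * g ‖x.1‖ ∂(volume.comap Subtype.val) := by
    rw [integral_subtype_comap (measurableSet_singleton _).compl
      fun x : E3 => f (sphereProj x) * g ‖x‖, restrict_compl_singleton]
  have h2 := (volume : Measure E3).measurePreserving_homeomorphUnitSphereProd.integral_comp
    (Homeomorph.measurableEmbedding _) (fun p => f p.1 * g p.2)
  have h3 : ∀ x : ({(0)}ᶜ : Set E3), (homeomorphUnitSphereProd E3 x).1 = sphereProj x.1 := by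
    intro x
    refine Subtype.ext ?_
    rw [coe_sphereProj x.2]
    simp
  simp only [h3, homeomorphUnitSphereProd_apply_snd_coe] at h2
  rw [h1, h2, integral_prod_mul f fun r : Ioi (0 : ℝ) => g r]
  congr 1
  simp only [Measure.volumeIoiPow, ENNReal.ofReal, finrank_euclideanSpace, Fintype.card_fin,
    Nat.add_one_sub_one]
  rw [integral_withDensity_eq_integral_smul,
    integral_subtype_comap measurableSet_Ioi fun a => Real.toNNReal (a ^ 2) • g a,
    setIntegral_congr_fun measurableSet_Ioi fun x hx => ?_]
  · rw [NNReal.smul_def, Real.coe_toNNReal _ (sq_nonneg x), smul_eq_mul]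
  · exact (measurable_subtype_coe.pow_const _).real_toNNReal

theorem area_real_univ : area.real univ = 4 * Real.pi := by
  rw [Measure.toSphere_real_apply_univ]
  simp only [finrank_euclideanSpace, Fintype.card_fin, Measure.real]
  rw [EuclideanSpace.volume_ball_fin_three]
  rw [ENNReal.ofReal_one, one_pow, one_mul, ENNReal.toReal_ofReal (by positivity)]
  push_cast
  ring

/-- The homeomorphism of the sphere induced by a linear isometry. -/
def sphereIsom (A : E3 ≃ₗᵢ[ℝ] E3) : S2 ≃ₜ S2 where
  toFun u := ⟨A u, by simp⟩
  invFun u := ⟨A.symm u, by simp⟩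
  left_inv u := by simp
  right_inv u := by simp
  continuous_toFun := by fun_prop
  continuous_invFun := by fun_prop

@[simp] theorem coe_sphereIsom (A : E3 ≃ₗᵢ[ℝ] E3) (u : S2) : (sphereIsom A u : E3) = A u := rfl

open scoped Pointwise in
-- `toSphere` measures a set through the volume of the cone `(0,1) • s`, and a linear isometry
-- carries cones to cones while preserving volume.
theorem measurePreserving_sphereIsom (A : E3 ≃ₗᵢ[ℝ] E3) :
    MeasurePreserving (sphereIsom A) area area := by
  refine ⟨(sphereIsom A).continuous.measurable, ?_⟩
  ext s hs
  rw [Measure.map_apply (sphereIsom A).continuous.measurable hs, Measure.toSphere_apply' _ hs,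
    Measure.toSphere_apply' _ ((sphereIsom A).continuous.measurable hs)]
  congr 1
  have hA := A.measurePreserving.measure_preimage_equiv (f := A.toMeasurableEquiv)
    (Ioo (0 : ℝ) 1 • ((↑) '' s : Set E3))
  rw [← hA]
  congr 1
  ext x
  simp only [mem_smul, mem_image, mem_preimage, Subtype.exists, exists_and_right, exists_eq_right]
  constructor
  · rintro ⟨r, hr, y, ⟨hy, hys⟩, rfl⟩
    exact ⟨r, hr, A y, ⟨by simpa using hy, hys⟩, by simp⟩
  · rintro ⟨r, hr, y, ⟨hy, hys⟩, hxy⟩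
    refine ⟨r, hr, A.symm y, ⟨by simpa using hy, ?_⟩, ?_⟩
    · have : sphereIsom A ⟨A.symm y, by simpa using hy⟩ = ⟨y, hy⟩ := Subtype.ext (by simp)
      rwa [this]
    · apply A.injective
      simpa using hxy

theorem integral_comp_sphereIsom (A : E3 ≃ₗᵢ[ℝ] E3) (f : S2 → ℝ) :
    ∫ u, f (sphereIsom A u) ∂area = ∫ u, f u ∂area :=
  (measurePreserving_sphereIsom A).integral_comp (sphereIsom A).measurableEmbedding f

theorem sphereIsom_neg (u : S2) : sphereIsom (LinearIsometryEquiv.neg ℝ) u = -u :=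
  Subtype.ext (by simp)

theorem integral_comp_neg (f : S2 → ℝ) : ∫ u, f (-u) ∂area = ∫ u, f u ∂area := by
  simpa only [sphereIsom_neg] using integral_comp_sphereIsom (LinearIsometryEquiv.neg ℝ) f

/-! ### Rotations about the coordinate axes -/

/-- The vector field generating the rotations about the `i`-th coordinate axis. -/
def rotField (i : Fin 3) (x : E3) : E3 :=
  x (i + 1) • EuclideanSpace.single (i + 2) (1 : ℝ) -
    x (i + 2) • EuclideanSpace.single (i + 1) (1 : ℝ)

theorem continuous_rotField (i : Fin 3) : Continuous (rotField i) := by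
  unfold rotField; fun_prop

/-- The rotation about the `i`-th coordinate axis, as a linear map. -/
def rotLin (i : Fin 3) (θ : ℝ) : E3 →ₗ[ℝ] E3 where
  toFun x := x + (Real.cos θ - 1) • (x (i + 1) • EuclideanSpace.single (i + 1) (1 : ℝ) +
    x (i + 2) • EuclideanSpace.single (i + 2) (1 : ℝ)) + Real.sin θ • rotField i x
  map_add' x y := by simp only [rotField, PiLp.add_apply]; module
  map_smul' c x := by
    simp only [rotField, PiLp.smul_apply, smul_eq_mul, RingHom.id_apply]; module

/-- The rotation about the `i`-th coordinate axis. -/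
def rotIsom (i : Fin 3) (θ : ℝ) : E3 ≃ₗᵢ[ℝ] E3 :=
  LinearIsometry.toLinearIsometryEquiv
    ⟨rotLin i θ, fun x => by
      rw [EuclideanSpace.norm_eq, EuclideanSpace.norm_eq]
      congr 1
      have h := Real.sin_sq_add_cos_sq θ
      simp only [rotLin, rotField, LinearMap.coe_mk, AddHom.coe_mk, Fin.sum_univ_three,
        Real.norm_eq_abs, sq_abs]
      fin_cases i <;> simp
      · linear_combination (x 1 ^ 2 + x 2 ^ 2) * h
      · linear_combination (x 0 ^ 2 + x 2 ^ 2) * h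
      · linear_combination (x 0 ^ 2 + x 1 ^ 2) * h⟩ rfl

theorem hasDerivAt_rotIsom (i : Fin 3) (x : E3) (θ : ℝ) :
    HasDerivAt (fun θ => rotIsom i θ x) (rotField i (rotIsom i θ x)) θ := by
  have h : HasDerivAt (fun θ => rotIsom i θ x)
      (0 + (-Real.sin θ) • (x (i + 1) • EuclideanSpace.single (i + 1) (1 : ℝ) +
    x (i + 2) • EuclideanSpace.single (i + 2) (1 : ℝ)) + Real.cos θ • rotField i x) θ :=
    ((hasDerivAt_const θ x).add (((Real.hasDerivAt_cos θ).sub_const 1).smul_const _)).add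
      ((Real.hasDerivAt_sin θ).smul_const _)
  convert h using 1
  ext j
  simp only [rotIsom, rotLin, rotField, LinearIsometry.coe_toLinearIsometryEquiv,
    LinearIsometry.coe_mk, LinearMap.coe_mk, AddHom.coe_mk]
  fin_cases i <;> fin_cases j <;> simp <;> ring

theorem rotIsom_zero (i : Fin 3) (x : E3) : rotIsom i 0 x = x := by
  simp [rotIsom, rotLin]

/-- By rotation invariance the integral of `F` composed with the rotation by `θ` does not depend on
`θ`. Differentiating under the integral sign at `θ = 0` gives the claim. -/
theorem integral_fderiv_rotField {F : E3 → ℝ} (hF : ContDiffOn ℝ 1 F {0}ᶜ) (i : Fin 3) :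
    ∫ u : S2, fderiv ℝ F u (rotField i u) ∂area = 0 := by
  have ho : IsOpen ({0}ᶜ : Set E3) := isOpen_compl_singleton
  have hd : ∀ u : S2, DifferentiableAt ℝ F u := fun u =>
    (hF.differentiableOn one_ne_zero).differentiableAt (ho.mem_nhds (coe_ne_zero u))
  have hc : Continuous fun u : S2 => fderiv ℝ F u (rotField i u) := by
    have h1 : Continuous fun u : S2 => fderiv ℝ F u :=
      (hF.continuousOn_fderiv_of_isOpen ho le_rfl).comp_continuous continuous_subtype_val
        fun u => coe_ne_zero u
    exact h1.clm_apply ((continuous_rotField i).comp continuous_subtype_val)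
  have hFc : Continuous fun u : S2 => F u :=
    hF.continuousOn.comp_continuous continuous_subtype_val fun u => coe_ne_zero u
  obtain ⟨C, hC⟩ := (isCompact_range hc).isBounded.exists_norm_le
  have key := hasDerivAt_integral_of_dominated_loc_of_deriv_le (μ := area) (x₀ := (0 : ℝ))
    (F := fun θ u => F (sphereIsom (rotIsom i θ) u))
    (F' := fun θ u => fderiv ℝ F (sphereIsom (rotIsom i θ) u)
      (rotField i (sphereIsom (rotIsom i θ) u))) (bound := fun _ => C) (s := univ)
    Filter.univ_mem
    (Filter.Eventually.of_forall fun θ =>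
      (hFc.comp (sphereIsom (rotIsom i θ)).continuous).aestronglyMeasurable)
    ((hFc.comp (sphereIsom (rotIsom i 0)).continuous).integrable_of_hasCompactSupport
      (HasCompactSupport.of_compactSpace _))
    (hc.comp (sphereIsom (rotIsom i 0)).continuous).aestronglyMeasurable
    (Filter.Eventually.of_forall fun u θ _ => hC _ ⟨sphereIsom (rotIsom i θ) u, rfl⟩)
    (integrable_const C)
    (Filter.Eventually.of_forall fun u θ _ =>
      (hd (sphereIsom (rotIsom i θ) u)).hasFDerivAt.comp_hasDerivAt θ
        (hasDerivAt_rotIsom i u θ))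
  have h2 := key.2
  simp only [integral_comp_sphereIsom (rotIsom i _) (fun u : S2 => F u)] at h2
  have h3 := h2.unique (hasDerivAt_const _ _)
  simpa only [coe_sphereIsom, rotIsom_zero] using h3

/-! ### Polynomials as functions -/

/-- The value of a polynomial at a point of Euclidean space. -/
def evalPoly (P : MvPolynomial (Fin 3) ℝ) (x : E3) : ℝ := MvPolynomial.eval (fun i => x i) P

theorem polyRestrict_apply (P : MvPolynomial (Fin 3) ℝ) (u : S2) :
    polyRestrict P u = evalPoly P u := by
  induction P using MvPolynomial.induction_on with
  | C a => simp [polyRestrict, evalPoly]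
  | add P Q hP hQ => rw [map_add, ContinuousMap.add_apply, hP, hQ]; simp [evalPoly]
  | mul_X P i hP =>
    rw [map_mul, ContinuousMap.mul_apply, hP]
    simp [evalPoly, polyRestrict]

theorem evalPoly_smul_of_isHomogeneous {P : MvPolynomial (Fin 3) ℝ} {k : ℕ}
    (hP : P.IsHomogeneous k) (c : ℝ) (x : E3) : evalPoly P (c • x) = c ^ k * evalPoly P x := by
  simp only [evalPoly, MvPolynomial.eval_eq, Finset.mul_sum]
  refine Finset.sum_congr rfl fun d hd => ?_
  have h : d.degree = k := by
    rw [Finsupp.degree_eq_weight_one (R := ℕ)]; exact hP (MvPolynomial.mem_support_iff.1 hd)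
  have h2 : ∏ i ∈ d.support, (c • x) i ^ d i = c ^ k * ∏ i ∈ d.support, x i ^ d i := by
    rw [← h, Finsupp.degree_apply, ← Finset.prod_pow_eq_pow_sum, ← Finset.prod_mul_distrib]
    exact Finset.prod_congr rfl fun i _ => by simp [mul_pow]
  rw [h2]; ring

theorem hasFDerivAt_evalPoly (P : MvPolynomial (Fin 3) ℝ) (x : E3) :
    HasFDerivAt (evalPoly P) (∑ i, evalPoly (MvPolynomial.pderiv i P) x •
      (EuclideanSpace.proj i : E3 →L[ℝ] ℝ)) x := by
  induction P using MvPolynomial.induction_on with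
  | C a =>
    have : evalPoly (MvPolynomial.C a) = fun _ => a := by ext; simp [evalPoly]
    rw [this]
    exact (hasFDerivAt_const a x).congr_fderiv (by simp [evalPoly])
  | add P Q hP hQ =>
    have : evalPoly (P + Q) = fun x => evalPoly P x + evalPoly Q x := by ext; simp [evalPoly]
    rw [this]
    exact (hP.fun_add hQ).congr_fderiv (by simp [evalPoly, add_smul, Finset.sum_add_distrib])
  | mul_X P i hP =>
    have : evalPoly (P * MvPolynomial.X i) =
        fun x => evalPoly P x * (EuclideanSpace.proj i : E3 →L[ℝ] ℝ) x := by
      ext; simp [evalPoly]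
    rw [this]
    refine (hP.fun_mul (EuclideanSpace.proj i : E3 →L[ℝ] ℝ).hasFDerivAt).congr_fderiv ?_
    ext v
    simp only [evalPoly, Derivation.leibniz, smul_eq_mul, map_add, map_mul, MvPolynomial.eval_X,
      Fin.sum_univ_three, MvPolynomial.pderiv_X]
    fin_cases i <;> simp <;> ring

theorem contDiff_evalPoly (P : MvPolynomial (Fin 3) ℝ) {n : ℕ∞ω} : ContDiff ℝ n (evalPoly P) := by
  induction P using MvPolynomial.induction_on with
  | C a =>
    have : evalPoly (MvPolynomial.C a) = fun _ => a := by ext; simp [evalPoly]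
    rw [this]
    exact contDiff_const
  | add P Q hP hQ =>
    have : evalPoly (P + Q) = fun x => evalPoly P x + evalPoly Q x := by ext; simp [evalPoly]
    rw [this]
    exact hP.add hQ
  | mul_X P i hP =>
    have : evalPoly (P * MvPolynomial.X i) =
        fun x => evalPoly P x * (EuclideanSpace.proj i : E3 →L[ℝ] ℝ) x := by
      ext; simp [evalPoly]
    rw [this]
    exact hP.mul (EuclideanSpace.proj i : E3 →L[ℝ] ℝ).contDiff

theorem continuous_evalPoly (P : MvPolynomial (Fin 3) ℝ) : Continuous (evalPoly P) :=
  (contDiff_evalPoly P (n := 0)).continuous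

theorem fderiv_evalPoly_rotField (P : MvPolynomial (Fin 3) ℝ) (i : Fin 3) (x : E3) :
    fderiv ℝ (evalPoly P) x (rotField i x) = evalPoly (angMom i P) x := by
  rw [(hasFDerivAt_evalPoly P x).fderiv, angMom_apply]
  fin_cases i <;> simp [Fin.sum_univ_three, rotField, evalPoly] <;> ring

theorem evalPoly_normSqPoly (u : S2) : evalPoly normSqPoly u = 1 := by
  have h : ‖(u : E3)‖ = 1 := by simp
  rw [EuclideanSpace.norm_eq, Real.sqrt_eq_one] at h
  simpa [evalPoly, normSqPoly] using h

/-- Integration by parts on the sphere: the product rule in the vanishing integral of the rotational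
derivative of `F * P`. -/
theorem integral_fderiv_rotField_mul {F : E3 → ℝ} (hF : ContDiffOn ℝ 1 F {0}ᶜ) (i : Fin 3)
    (P : MvPolynomial (Fin 3) ℝ) :
    ∫ u : S2, fderiv ℝ F u (rotField i u) * evalPoly P u ∂area =
      -∫ u : S2, F u * evalPoly (angMom i P) u ∂area := by
  have ho : IsOpen ({0}ᶜ : Set E3) := isOpen_compl_singleton
  have h := integral_fderiv_rotField (hF.mul (contDiff_evalPoly P).contDiffOn) i
  have hd : ∀ u : S2, fderiv ℝ (fun x => F x * evalPoly P x) u (rotField i u) =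
      fderiv ℝ F u (rotField i u) * evalPoly P u + F u * evalPoly (angMom i P) u := by
    intro u
    rw [((hF.differentiableOn one_ne_zero).differentiableAt
      (ho.mem_nhds (coe_ne_zero u))).hasFDerivAt.fun_mul
      ((contDiff_evalPoly P (n := 1)).differentiable one_ne_zero u).hasFDerivAt |>.fderiv]
    simp [fderiv_evalPoly_rotField]
    ring
  have hc1 : Continuous fun u : S2 => fderiv ℝ F u (rotField i u) := by
    have h1 : Continuous fun u : S2 => fderiv ℝ F u :=
      (hF.continuousOn_fderiv_of_isOpen ho le_rfl).comp_continuous continuous_subtype_val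
        fun u => coe_ne_zero u
    exact h1.clm_apply ((continuous_rotField i).comp continuous_subtype_val)
  have hc2 : Continuous fun u : S2 => F u :=
    hF.continuousOn.comp_continuous continuous_subtype_val fun u => coe_ne_zero u
  have hp : ∀ Q, Continuous fun u : S2 => evalPoly Q u := fun Q =>
    (continuous_evalPoly Q).comp continuous_subtype_val
  simp only [hd] at h
  rw [integral_add] at h
  · linarith
  · exact (hc1.mul (hp P)).integrable_of_hasCompactSupport (HasCompactSupport.of_compactSpace _)
  · exact (hc2.mul (hp _)).integrable_of_hasCompactSupport (HasCompactSupport.of_compactSpace _)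

/-! ### Spherical harmonics in `L²` -/

/-- The class in `L²` of the restriction of a polynomial to the sphere. -/
def polyL2 : MvPolynomial (Fin 3) ℝ →ₗ[ℝ] L2 :=
  (ContinuousMap.toLp (E := ℝ) 2 area ℝ).toLinearMap ∘ₗ polyRestrict.toLinearMap

theorem polyL2_apply (P : MvPolynomial (Fin 3) ℝ) :
    polyL2 P = ContinuousMap.toLp (E := ℝ) 2 area ℝ (polyRestrict P) := rfl

theorem coeFn_polyL2 (P : MvPolynomial (Fin 3) ℝ) :
    polyL2 P =ᵐ[area] fun u => evalPoly P u := by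
  rw [polyL2_apply]
  filter_upwards [ContinuousMap.coeFn_toLp (p := 2) area (𝕜 := ℝ) (polyRestrict P)] with u hu
  rw [hu, polyRestrict_apply]

theorem inner_polyL2_left (P : MvPolynomial (Fin 3) ℝ) (h : L2) :
    inner ℝ (polyL2 P) h = ∫ u, h u * evalPoly P u ∂area := by
  rw [MeasureTheory.L2.inner_def]
  refine integral_congr_ae ?_
  filter_upwards [coeFn_polyL2 P] with u hu
  simp [hu]

theorem inner_polyL2_polyL2 (P Q : MvPolynomial (Fin 3) ℝ) :
    inner ℝ (polyL2 P) (polyL2 Q) = ∫ u : S2, evalPoly Q u * evalPoly P u ∂area := by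
  rw [inner_polyL2_left]
  refine integral_congr_ae ?_
  filter_upwards [coeFn_polyL2 Q] with u hu
  rw [hu]

theorem inner_polyL2_angMom (P Q : MvPolynomial (Fin 3) ℝ) (i : Fin 3) :
    inner ℝ (polyL2 P) (polyL2 (angMom i Q)) = -inner ℝ (polyL2 (angMom i P)) (polyL2 Q) := by
  rw [inner_polyL2_polyL2, inner_polyL2_polyL2]
  simpa only [fderiv_evalPoly_rotField] using
    integral_fderiv_rotField_mul (contDiff_evalPoly Q (n := 1)).contDiffOn i P

theorem mem_harmonics {k : ℕ} {h : L2} :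
    h ∈ harmonics k ↔ ∃ P ∈ harmonicPoly k, polyL2 P = h := Submodule.mem_map

theorem polyL2_mem_harmonics {k : ℕ} {P : MvPolynomial (Fin 3) ℝ} (hP : P ∈ harmonicPoly k) :
    polyL2 P ∈ harmonics k := mem_harmonics.2 ⟨P, hP, rfl⟩

theorem sum_inner_angMom (P : MvPolynomial (Fin 3) ℝ) {k : ℕ} {Q : MvPolynomial (Fin 3) ℝ}
    (hQ : Q ∈ harmonicPoly k) :
    ∑ i, inner ℝ (polyL2 (angMom i P)) (polyL2 (angMom i Q)) =
      (k * (k + 1) : ℝ) * inner ℝ (polyL2 P) (polyL2 Q) := by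
  have h : ∑ i, inner ℝ (polyL2 P) (polyL2 (angMom i (angMom i Q))) =
      -((k * (k + 1) : ℝ) * inner ℝ (polyL2 P) (polyL2 Q)) := by
    rw [← inner_sum, ← map_sum, sum_angMom_sq_of_harmonic hQ, map_smul, inner_smul_right, neg_mul]
  simp only [inner_polyL2_angMom P, Finset.sum_neg_distrib] at h
  linarith

/-- Skewness of the rotation fields lets the Casimir act on either factor, so `j(j+1)` and `k(k+1)`
multiply the inner product to the same value. -/
theorem orthogonalFamily_harmonics :
    OrthogonalFamily ℝ (fun k => harmonics k) fun k => (harmonics k).subtypeₗᵢ := by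
  rintro j k hjk ⟨v, hv⟩ ⟨w, hw⟩
  obtain ⟨P, hP, rfl⟩ := mem_harmonics.1 hv
  obtain ⟨Q, hQ, rfl⟩ := mem_harmonics.1 hw
  change inner ℝ (polyL2 P) (polyL2 Q) = 0
  have h1 := sum_inner_angMom P hQ
  have h2 := sum_inner_angMom Q hP
  simp only [real_inner_comm (polyL2 P) (polyL2 Q),
    fun i => real_inner_comm (polyL2 (angMom i P)) (polyL2 (angMom i Q))] at h2
  rw [h1] at h2
  have h3 : ((k : ℝ) - j) * (k + j + 1) * inner ℝ (polyL2 P) (polyL2 Q) = 0 := by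
    linear_combination h2
  have h4 : (k : ℝ) - j ≠ 0 := sub_ne_zero.2 (by exact_mod_cast hjk.symm)
  have h5 : (k + j + 1 : ℝ) ≠ 0 := by positivity
  simpa [h4, h5] using h3

/-- On the sphere `r² = 1`, so in `P = H + r²K` the second term restricts to `K`, of degree lower by
two. -/
theorem polyL2_mem_iSup_harmonics_of_isHomogeneous (k : ℕ) :
    ∀ P : MvPolynomial (Fin 3) ℝ, P.IsHomogeneous k → polyL2 P ∈ ⨆ j, harmonics j := by
  induction k using Nat.strong_induction_on with
  | _ k ih =>
  intro P hP
  rcases lt_or_ge k 2 with hk | hk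
  · exact Submodule.mem_iSup_of_mem k (polyL2_mem_harmonics (mem_harmonicPoly_of_lt_two hk hP))
  · obtain ⟨d, rfl⟩ := Nat.exists_eq_add_of_le' hk
    obtain ⟨H, hH, K, hK, rfl⟩ := exists_harmonic_add_normSqPoly_mul hP
    have h : polyL2 (normSqPoly * K) = polyL2 K := by
      rw [polyL2_apply, polyL2_apply]
      congr 1
      ext u
      rw [map_mul, ContinuousMap.mul_apply, polyRestrict_apply, evalPoly_normSqPoly, one_mul]
    rw [map_add, h]
    exact Submodule.add_mem _ (Submodule.mem_iSup_of_mem _ (polyL2_mem_harmonics hH))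
      (ih d (by omega) K hK)

theorem polyL2_mem_iSup_harmonics (P : MvPolynomial (Fin 3) ℝ) :
    polyL2 P ∈ ⨆ j, harmonics j := by
  rw [← MvPolynomial.sum_homogeneousComponent P, map_sum]
  exact Submodule.sum_mem _ fun k _ => polyL2_mem_iSup_harmonics_of_isHomogeneous k _
    (MvPolynomial.homogeneousComponent_isHomogeneous k P)

/-- The coordinates separate points, so polynomials are dense in `C(S²)` by Stone–Weierstrass, and
continuous functions are dense in `L²`. -/
theorem topologicalClosure_iSup_harmonics : (⨆ k, harmonics k).topologicalClosure = ⊤ := by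
  have hsep : (polyRestrict.range).SeparatesPoints := by
    intro u v huv
    by_contra! h
    apply huv
    ext i
    simpa [polyRestrict_apply, evalPoly] using
      h (polyRestrict (MvPolynomial.X i)) ⟨_, ⟨_, rfl⟩, rfl⟩
  have hd := ContinuousMap.subalgebra_topologicalClosure_eq_top_of_separatesPoints _ hsep
  rw [eq_top_iff]
  rintro h -
  have hr := ContinuousMap.toLp_denseRange (α := S2) (E := ℝ) (p := 2) (μ := area) (𝕜 := ℝ)
    (by simp) h
  refine closure_minimal ?_ (Submodule.isClosed_topologicalClosure _) hr
  rintro _ ⟨f, rfl⟩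
  have hf : f ∈ closure (polyRestrict.range : Set C(S2, ℝ)) := by
    rw [← Subalgebra.topologicalClosure_coe, hd]; trivial
  refine map_mem_closure (ContinuousMap.toLp (E := ℝ) 2 area ℝ).continuous hf ?_
  rintro _ ⟨P, rfl⟩
  exact polyL2_mem_iSup_harmonics P

theorem isHilbertSum_harmonics :
    IsHilbertSum ℝ (fun k => harmonics k) fun k => (harmonics k).subtypeₗᵢ :=
  .mkInternal _ orthogonalFamily_harmonics topologicalClosure_iSup_harmonics.ge

theorem inner_eq_zero_of_mem_harmonics {j k : ℕ} (hjk : j ≠ k) {v w : L2}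
    (hv : v ∈ harmonics j) (hw : w ∈ harmonics k) : inner ℝ v w = 0 :=
  orthogonalFamily_harmonics hjk ⟨v, hv⟩ ⟨w, hw⟩

theorem starProjection_of_hasSum {w : ℕ → L2} {h : L2} (hw : ∀ k, w k ∈ harmonics k)
    (hs : HasSum w h) (k : ℕ) : (harmonics k).starProjection h = w k := by
  refine Submodule.eq_starProjection_of_mem_of_inner_eq_zero (hw k) fun v hv => ?_
  have h1 : HasSum (fun j => inner ℝ (w j) v) (inner ℝ h v) :=
    hs.mapL ((innerSL ℝ).flip v)
  have h2 : HasSum (fun j => inner ℝ (w j) v) (inner ℝ (w k) v) :=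
    hasSum_single k fun j hj => inner_eq_zero_of_mem_harmonics hj (hw j) hv
  rw [inner_sub_left, h1.unique h2, sub_self]

theorem hasSum_starProjection (h : L2) :
    HasSum (fun k => (harmonics k).starProjection h) h := by
  have h1 := isHilbertSum_harmonics.hasSum_linearIsometryEquiv_symm
    (isHilbertSum_harmonics.linearIsometryEquiv h)
  rw [LinearIsometryEquiv.symm_apply_apply] at h1
  have h2 := fun k => starProjection_of_hasSum (fun k => (Subtype.coe_prop _)) h1 k
  exact h1.congr_fun fun k => h2 k

theorem ext_starProjection {f g : L2}
    (hfg : ∀ k, (harmonics k).starProjection f = (harmonics k).starProjection g) : f = g := by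
  have h := hasSum_starProjection f
  simp only [hfg] at h
  exact h.unique (hasSum_starProjection g)

theorem exists_hasSum_of_summable_sq {w : ℕ → L2} (hw : ∀ k, w k ∈ harmonics k)
    (hs : Summable fun k => ‖w k‖ ^ 2) :
    ∃ h : L2, HasSum w h ∧ ∀ k, (harmonics k).starProjection h = w k := by
  obtain ⟨h, hh⟩ := (orthogonalFamily_harmonics.summable_iff_norm_sq_summable
    fun k => ⟨w k, hw k⟩).2 hs
  exact ⟨h, hh, starProjection_of_hasSum hw hh⟩

/-! ### Moment functionals on polynomials -/

/-- The linear functional on polynomials with prescribed values on the monomials. -/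
def moment (Λ : ℕ → ℕ → ℕ → ℝ) : MvPolynomial (Fin 3) ℝ →ₗ[ℝ] ℝ :=
  (MvPolynomial.basisMonomials (Fin 3) ℝ).constr ℝ fun d => Λ (d 0) (d 1) (d 2)

theorem moment_monomial (Λ : ℕ → ℕ → ℕ → ℝ) (d : Fin 3 →₀ ℕ) (c : ℝ) :
    moment Λ (MvPolynomial.monomial d c) = c * Λ (d 0) (d 1) (d 2) := by
  have h : MvPolynomial.monomial d c = c • MvPolynomial.basisMonomials (Fin 3) ℝ d := by
    simp [MvPolynomial.smul_monomial]
  rw [h, map_smul, moment, Module.Basis.constr_basis, smul_eq_mul]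

theorem linearMap_eq_of_monomial {f g : MvPolynomial (Fin 3) ℝ →ₗ[ℝ] ℝ}
    (h : ∀ d : Fin 3 →₀ ℕ, f (MvPolynomial.monomial d 1) = g (MvPolynomial.monomial d 1)) :
    f = g :=
  (MvPolynomial.basisMonomials (Fin 3) ℝ).ext fun d => by simpa using h d

theorem linearMap_eq_of_monomial_of_isHomogeneous {f g : MvPolynomial (Fin 3) ℝ →ₗ[ℝ] ℝ} {k : ℕ}
    (h : ∀ d : Fin 3 →₀ ℕ, d 0 + d 1 + d 2 = k →
      f (MvPolynomial.monomial d 1) = g (MvPolynomial.monomial d 1))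
    {P : MvPolynomial (Fin 3) ℝ} (hP : P.IsHomogeneous k) : f P = g P := by
  rw [← MvPolynomial.support_sum_monomial_coeff P, map_sum, map_sum]
  refine Finset.sum_congr rfl fun d hd => ?_
  have hdk : d.degree = k := by
    rw [Finsupp.degree_eq_weight_one (R := ℕ)]; exact hP (MvPolynomial.mem_support_iff.1 hd)
  rw [Finsupp.degree_eq_sum, Fin.sum_univ_three] at hdk
  have h1 : MvPolynomial.monomial d (MvPolynomial.coeff d P) =
      MvPolynomial.coeff d P • MvPolynomial.monomial d (1 : ℝ) := by
    simp [MvPolynomial.smul_monomial]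
  rw [h1, map_smul, map_smul, h d hdk]

/-- The functional which integrates the coefficient of `x₂ ^ j` with the moments `μ`. -/
def sliceMoment (μ : ℕ → ℕ → ℝ) (j : ℕ) : MvPolynomial (Fin 3) ℝ →ₗ[ℝ] ℝ :=
  moment fun a b c => if c = j then μ a b else 0

theorem sliceMoment_pderiv_two (μ : ℕ → ℕ → ℝ) (j : ℕ) (P : MvPolynomial (Fin 3) ℝ) :
    sliceMoment μ j (MvPolynomial.pderiv 2 (MvPolynomial.pderiv 2 P)) =
      (j + 2) * (j + 1) * sliceMoment μ (j + 2) P := by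
  suffices h : sliceMoment μ j ∘ₗ (MvPolynomial.pderiv 2).toLinearMap ∘ₗ
      (MvPolynomial.pderiv 2).toLinearMap = ((j + 2) * (j + 1) : ℝ) • sliceMoment μ (j + 2) from
    LinearMap.congr_fun h P
  refine linearMap_eq_of_monomial fun d => ?_
  simp only [LinearMap.comp_apply, Derivation.coeFn_coe, MvPolynomial.pderiv_monomial,
    sliceMoment, moment_monomial, LinearMap.smul_apply]
  simp only [Finsupp.coe_tsub, Pi.sub_apply, Finsupp.single_apply]
  rcases hd : d 2 with _ | _ | c
  · simp
  · simp
  · by_cases hc : c = j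
    · subst hc
      simp only [if_true]
      push_cast
      simp
      ring_nf
      simp
    · simp [hc]

/-- The assumption on `μ` is `M(Δp) = κ(deg p) M(p)` tested on plane monomials; the truncated `a -
2` is harmless since `a(a-1)` vanishes for `a < 2`. The coefficient of `x₂ʲ` in `P` is homogeneous
of degree `k - j`, and for `j > k` it is zero. -/
theorem sliceMoment_pderiv_zero_one {μ : ℕ → ℕ → ℝ} {κ : ℕ → ℝ}
    (hμ : ∀ a b : ℕ, (a * (a - 1) : ℝ) * μ (a - 2) b + (b * (b - 1) : ℝ) * μ a (b - 2) =
      κ (a + b) * μ a b) (j : ℕ) {k : ℕ} {P : MvPolynomial (Fin 3) ℝ} (hP : P.IsHomogeneous k) :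
    sliceMoment μ j (MvPolynomial.pderiv 0 (MvPolynomial.pderiv 0 P)) +
      sliceMoment μ j (MvPolynomial.pderiv 1 (MvPolynomial.pderiv 1 P)) =
      κ (k - j) * sliceMoment μ j P := by
  suffices h : (sliceMoment μ j ∘ₗ (MvPolynomial.pderiv 0).toLinearMap ∘ₗ
      (MvPolynomial.pderiv 0).toLinearMap + sliceMoment μ j ∘ₗ
      (MvPolynomial.pderiv 1).toLinearMap ∘ₗ (MvPolynomial.pderiv 1).toLinearMap) P =
      (κ (k - j) • sliceMoment μ j) P from h
  refine linearMap_eq_of_monomial_of_isHomogeneous (fun d hd => ?_) hP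
  simp only [LinearMap.comp_apply, Derivation.coeFn_coe, MvPolynomial.pderiv_monomial,
    sliceMoment, moment_monomial, LinearMap.smul_apply, LinearMap.add_apply]
  simp only [Finsupp.coe_tsub, Pi.sub_apply, Finsupp.single_apply]
  by_cases hj : d 2 = j
  · have hk : k - j = d 0 + d 1 := by omega
    have hsub : ∀ n : ℕ, (n : ℝ) * ((n - 1 : ℕ) : ℝ) = n * (n - 1) := by
      rintro (_ | n) <;> simp
    have h2 : ∀ n : ℕ, n - 1 - 1 = n - 2 := fun n => by omega
    simpa [hj, hk, hsub, h2] using hμ (d 0) (d 1)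
  · simp [hj]

theorem sliceMoment_of_harmonic {μ : ℕ → ℕ → ℝ} {κ : ℕ → ℝ}
    (hμ : ∀ a b : ℕ, (a * (a - 1) : ℝ) * μ (a - 2) b + (b * (b - 1) : ℝ) * μ a (b - 2) =
      κ (a + b) * μ a b) (j : ℕ) {k : ℕ} {P : MvPolynomial (Fin 3) ℝ} (hP : P ∈ harmonicPoly k) :
    κ (k - j) * sliceMoment μ j P = -((j + 2) * (j + 1) * sliceMoment μ (j + 2) P) := by
  rw [mem_harmonicPoly] at hP
  have h := congrArg (sliceMoment μ j) hP.2
  rw [polyLaplacian_apply, Fin.sum_univ_three, map_add, map_add,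
    sliceMoment_pderiv_zero_one hμ j hP.1, sliceMoment_pderiv_two, map_zero] at h
  linarith

theorem sliceMoment_degree (μ : ℕ → ℕ → ℝ) {k : ℕ} {P : MvPolynomial (Fin 3) ℝ}
    (hP : P.IsHomogeneous k) :
    sliceMoment μ k P = μ 0 0 * evalPoly P (EuclideanSpace.single 2 1) := by
  suffices h : sliceMoment μ k P =
      (μ 0 0 • (MvPolynomial.aeval (R := ℝ)
        (fun i => EuclideanSpace.single (2 : Fin 3) (1 : ℝ) i)).toLinearMap) P by
    rw [h]; simp [evalPoly, MvPolynomial.aeval_eq_eval]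
  refine linearMap_eq_of_monomial_of_isHomogeneous (fun d hd => ?_) hP
  simp only [sliceMoment, moment_monomial, LinearMap.smul_apply, AlgHom.toLinearMap_apply,
    MvPolynomial.aeval_monomial, Finsupp.prod_fintype _ _ (fun i => pow_zero _),
    Fin.prod_univ_three]
  by_cases h : d 2 = k
  · have h0 : d 0 = 0 := by omega
    have h1 : d 1 = 0 := by omega
    simp [h, h0, h1]
  · have h0 : d 0 ≠ 0 ∨ d 1 ≠ 0 := by omega
    rcases h0 with h0 | h0 <;> simp [h, h0]

/-- Climbing from the coefficient of `x₂⁰` to that of `x₂^(2m)` in steps of two: each step costs a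
factor `κ` on the left and `-(j+2)(j+1)` on the right, and the latter accumulate to `(-1)^m (2m)!`.
-/
theorem prod_mul_sliceMoment_zero {μ : ℕ → ℕ → ℝ} {κ : ℕ → ℝ}
    (hμ : ∀ a b : ℕ, (a * (a - 1) : ℝ) * μ (a - 2) b + (b * (b - 1) : ℝ) * μ a (b - 2) =
      κ (a + b) * μ a b) {m : ℕ} {P : MvPolynomial (Fin 3) ℝ} (hP : P ∈ harmonicPoly (2 * m)) :
    (∏ l ∈ Finset.range m, κ (2 * (l + 1))) * sliceMoment μ 0 P =
      (-1) ^ m * (2 * m)! * (μ 0 0 * evalPoly P (EuclideanSpace.single 2 1)) := by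
  have h : ∀ i : ℕ, (∏ l ∈ Finset.range i, κ (2 * m - 2 * l)) * sliceMoment μ 0 P =
      (-1) ^ i * (2 * i)! * sliceMoment μ (2 * i) P := by
    intro i
    induction i with
    | zero => simp
    | succ i ih =>
      rw [Finset.prod_range_succ, mul_right_comm, ih, mul_assoc, mul_comm (sliceMoment μ (2 * i) P),
        sliceMoment_of_harmonic hμ _ hP, show 2 * (i + 1) = 2 * i + 1 + 1 by ring,
        Nat.factorial_succ, Nat.factorial_succ]
      push_cast
      ring
  have h1 := h m
  rw [sliceMoment_degree μ (mem_harmonicPoly.1 hP).1] at h1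
  -- The climb meets `κ(2m), κ(2m-2), …, κ(2)`; reflecting the product lists the arguments in
  -- increasing order.
  rw [← h1, ← Finset.prod_range_reflect]
  congr 1
  refine Finset.prod_congr rfl fun l hl => ?_
  rw [Finset.mem_range] at hl
  congr 1
  omega

theorem sliceMoment_eq_zero_of_odd {μ : ℕ → ℕ → ℝ} (hμ : ∀ a b, Odd (a + b) → μ a b = 0)
    {k : ℕ} (hk : Odd k) {P : MvPolynomial (Fin 3) ℝ} (hP : P.IsHomogeneous k) :
    sliceMoment μ 0 P = 0 := by
  refine linearMap_eq_of_monomial_of_isHomogeneous (g := 0) (fun d hd => ?_) hP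
  rw [sliceMoment, moment_monomial, one_mul, LinearMap.zero_apply]
  split_ifs with h
  · exact hμ _ _ (by rwa [show d 0 + d 1 = k by omega])
  · rfl

/-! ### Circle moments -/

/-- The moments of the uniform probability measure on the unit circle. -/
def circleMoment (a b : ℕ) : ℝ :=
  1 / (2 * Real.pi) * ∫ θ in (0 : ℝ)..(2 * Real.pi), Real.cos θ ^ a * Real.sin θ ^ b

theorem integral_cos_pow_mul_sin_pow (a b : ℕ) :
    (b + 1 : ℝ) * circleMoment (a + 2) b = (a + 1) * circleMoment a (b + 2) := by
  have hd : ∀ θ ∈ uIcc (0 : ℝ) (2 * Real.pi),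
      HasDerivAt (fun θ => Real.cos θ ^ (a + 1) * Real.sin θ ^ (b + 1))
      ((b + 1) * (Real.cos θ ^ (a + 2) * Real.sin θ ^ b) -
        (a + 1) * (Real.cos θ ^ a * Real.sin θ ^ (b + 2))) θ := by
    intro θ _
    refine (((Real.hasDerivAt_cos θ).fun_pow (a + 1)).fun_mul
      ((Real.hasDerivAt_sin θ).fun_pow (b + 1))).congr_deriv ?_
    simp only [Nat.add_sub_cancel]
    push_cast
    ring
  have h := intervalIntegral.integral_eq_sub_of_hasDerivAt hd
    (Continuous.intervalIntegrable (by fun_prop) _ _)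
  rw [intervalIntegral.integral_sub (Continuous.intervalIntegrable (by fun_prop) _ _)
    (Continuous.intervalIntegrable (by fun_prop) _ _), intervalIntegral.integral_const_mul,
    intervalIntegral.integral_const_mul] at h
  simp only [Real.sin_two_pi, Real.sin_zero, ne_eq, Nat.add_eq_zero_iff, one_ne_zero, and_false,
    not_false_eq_true, zero_pow, mul_zero, sub_zero] at h
  rw [circleMoment, circleMoment]
  linear_combination (1 / (2 * Real.pi)) * h

theorem circleMoment_add (a b : ℕ) :
    circleMoment (a + 2) b + circleMoment a (b + 2) = circleMoment a b := by
  simp only [circleMoment]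
  rw [← mul_add, ← intervalIntegral.integral_add (Continuous.intervalIntegrable (by fun_prop) _ _)
    (Continuous.intervalIntegrable (by fun_prop) _ _)]
  congr 1
  refine intervalIntegral.integral_congr fun θ _ => ?_
  have h := Real.sin_sq_add_cos_sq θ
  linear_combination (Real.cos θ ^ a * Real.sin θ ^ b) * h

theorem circleMoment_one (b : ℕ) : circleMoment 1 b = 0 := by
  have hd : ∀ θ ∈ uIcc (0 : ℝ) (2 * Real.pi), HasDerivAt (fun θ => Real.sin θ ^ (b + 1))
      ((b + 1) * (Real.cos θ ^ 1 * Real.sin θ ^ b)) θ := by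
    intro θ _
    refine ((Real.hasDerivAt_sin θ).fun_pow (b + 1)).congr_deriv ?_
    simp only [Nat.add_sub_cancel]
    push_cast
    ring
  have h := intervalIntegral.integral_eq_sub_of_hasDerivAt hd
    (Continuous.intervalIntegrable (by fun_prop) _ _)
  rw [intervalIntegral.integral_const_mul] at h
  simp only [Real.sin_two_pi, Real.sin_zero, sub_self] at h
  have hb : (b + 1 : ℝ) ≠ 0 := by positivity
  rw [circleMoment, (mul_eq_zero_iff_left hb).1 h, mul_zero]

theorem circleMoment_one_right (a : ℕ) : circleMoment a 1 = 0 := by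
  have hd : ∀ θ ∈ uIcc (0 : ℝ) (2 * Real.pi), HasDerivAt (fun θ => Real.cos θ ^ (a + 1))
      (-(a + 1) * (Real.cos θ ^ a * Real.sin θ ^ 1)) θ := by
    intro θ _
    refine ((Real.hasDerivAt_cos θ).fun_pow (a + 1)).congr_deriv ?_
    simp only [Nat.add_sub_cancel]
    push_cast
    ring
  have h := intervalIntegral.integral_eq_sub_of_hasDerivAt hd
    (Continuous.intervalIntegrable (by fun_prop) _ _)
  rw [intervalIntegral.integral_const_mul] at h
  simp only [Real.cos_two_pi, Real.cos_zero, sub_self] at h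
  have hb : (-(a + 1) : ℝ) ≠ 0 := neg_ne_zero.2 (by positivity)
  rw [circleMoment, (mul_eq_zero_iff_left hb).1 h, mul_zero]

/-- On the unit circle `Δp = n²p + ∂²p/∂θ²` for `p` homogeneous of degree `n`, and the last term has
mean zero. On a monomial the two second derivatives contribute `a(a+b)` and `b(a+b)`. -/
theorem circleMoment_rec (a b : ℕ) :
    (a * (a - 1) : ℝ) * circleMoment (a - 2) b + (b * (b - 1) : ℝ) * circleMoment a (b - 2) =
      ((a + b : ℕ) : ℝ) ^ 2 * circleMoment a b := by
  have h1 : ∀ a b : ℕ, (a * (a - 1) : ℝ) * circleMoment (a - 2) b =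
      a * (a + b) * circleMoment a b := by
    rintro (_ | _ | a) b
    · simp
    · simp [circleMoment_one]
    · have h1 := integral_cos_pow_mul_sin_pow a b
      have h2 := circleMoment_add a b
      rw [show a + 1 + 1 - 2 = a from rfl]
      push_cast
      linear_combination (-(a + 2) * (a + 1) : ℝ) * h2 - (a + 2 : ℝ) * h1
  have h2 : ∀ a b : ℕ, (b * (b - 1) : ℝ) * circleMoment a (b - 2) =
      b * (a + b) * circleMoment a b := by
    rintro a (_ | _ | b)
    · simp
    · simp [circleMoment_one_right]
    · have h1 := integral_cos_pow_mul_sin_pow a b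
      have h2 := circleMoment_add a b
      rw [show b + 1 + 1 - 2 = b from rfl]
      push_cast
      linear_combination (-(b + 2) * (b + 1) : ℝ) * h2 + (b + 2 : ℝ) * h1
  rw [h1, h2]
  push_cast
  ring

theorem circleMoment_eq_zero_of_odd : ∀ a b : ℕ, Odd (a + b) → circleMoment a b = 0 := by
  have key : ∀ n a b : ℕ, a + b = n → Odd n → circleMoment a b = 0 := by
    intro n
    induction n using Nat.strong_induction_on with
    | _ n ih =>
    intro a b hn ho
    have h := circleMoment_rec a b
    have h1 : (a * (a - 1) : ℝ) * circleMoment (a - 2) b = 0 := by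
      rcases a with _ | _ | a
      · simp
      · simp
      · rw [show a + 1 + 1 - 2 = a from rfl, ih (n - 2) (by omega) a b (by omega), mul_zero]
        rcases ho with ⟨c, hc⟩
        exact ⟨c - 1, by omega⟩
    have h2 : (b * (b - 1) : ℝ) * circleMoment a (b - 2) = 0 := by
      rcases b with _ | _ | b
      · simp
      · simp
      · rw [show b + 1 + 1 - 2 = b from rfl, ih (n - 2) (by omega) a b (by omega), mul_zero]
        rcases ho with ⟨c, hc⟩
        exact ⟨c - 1, by omega⟩
    rw [h1, h2, add_zero, hn] at h
    have hn0 : (n : ℝ) ^ 2 ≠ 0 := by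
      have := ho.pos
      positivity
    exact (mul_eq_zero_iff_left hn0).1 h.symm
  exact fun a b => key _ a b rfl

theorem circleMoment_zero_zero : circleMoment 0 0 = 1 := by
  have := Real.pi_pos
  simp [circleMoment]
  field_simp

theorem circle_average_eq_sliceMoment (P : MvPolynomial (Fin 3) ℝ) :
    1 / (2 * Real.pi) * ∫ θ in (0 : ℝ)..(2 * Real.pi),
      evalPoly P (Real.cos θ • EuclideanSpace.single 0 1 + Real.sin θ • EuclideanSpace.single 1 1) =
      sliceMoment circleMoment 0 P := by
  have hc : ∀ P, Continuous fun θ : ℝ => evalPoly P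
      (Real.cos θ • EuclideanSpace.single 0 1 + Real.sin θ • EuclideanSpace.single 1 1) :=
    fun P => (continuous_evalPoly P).comp (by fun_prop)
  induction P using MvPolynomial.induction_on' with
  | monomial d c =>
    rw [sliceMoment, moment_monomial]
    simp only [evalPoly, MvPolynomial.eval_monomial, Finsupp.prod_fintype _ _ (fun i => pow_zero _),
      Fin.prod_univ_three]
    by_cases h : d 2 = 0
    · simp [h, circleMoment]
      ring
    · simp [h]
  | add P Q hP hQ =>
    rw [map_add, ← hP, ← hQ, ← mul_add, ← intervalIntegral.integral_add
      ((hc P).intervalIntegrable _ _) ((hc Q).intervalIntegrable _ _)]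
    simp [evalPoly]

theorem prod_range_two_mul (m : ℕ) :
    ∏ l ∈ Finset.range m, (((2 * (l + 1) : ℕ)) : ℝ) = ((2 * m)‼ : ℝ) := by
  rw [Nat.doubleFactorial_eq_prod_even]
  push_cast
  rfl

theorem circle_average_of_harmonic {m : ℕ} {P : MvPolynomial (Fin 3) ℝ}
    (hP : P ∈ harmonicPoly (2 * m)) :
    1 / (2 * Real.pi) * ∫ θ in (0 : ℝ)..(2 * Real.pi),
      evalPoly P (Real.cos θ • EuclideanSpace.single 0 1 + Real.sin θ • EuclideanSpace.single 1 1) =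
      (-1) ^ m * ((2 * m)! / ((2 * m)‼ : ℝ) ^ 2) * evalPoly P (EuclideanSpace.single 2 1) := by
  have h := prod_mul_sliceMoment_zero (κ := fun n => (n : ℝ) ^ 2) circleMoment_rec hP
  rw [Finset.prod_pow, prod_range_two_mul, circleMoment_zero_zero] at h
  rw [circle_average_eq_sliceMoment]
  have h0 : ((2 * m)‼ : ℝ) ≠ 0 := by exact_mod_cast (Nat.doubleFactorial_pos _).ne'
  field_simp
  linear_combination h

theorem circle_average_of_odd {k : ℕ} (hk : Odd k) {P : MvPolynomial (Fin 3) ℝ}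
    (hP : P ∈ harmonicPoly k) :
    1 / (2 * Real.pi) * ∫ θ in (0 : ℝ)..(2 * Real.pi),
      evalPoly P (Real.cos θ • EuclideanSpace.single 0 1 + Real.sin θ • EuclideanSpace.single 1 1) =
      0 := by
  rw [circle_average_eq_sliceMoment]
  exact sliceMoment_eq_zero_of_odd circleMoment_eq_zero_of_odd hk (mem_harmonicPoly.1 hP).1

/-! ### Gaussian moments and the integral over a hemisphere -/

/-- The (unnormalized) Gaussian moments. -/
def gaussMoment (a : ℕ) : ℝ := ∫ x : ℝ, x ^ a * Real.exp (-(1 / 2) * x ^ 2)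

/-- The (unnormalized) Gaussian moments of the half line. -/
def halfGaussMoment (a : ℕ) : ℝ := ∫ x in Ioi (0 : ℝ), x ^ a * Real.exp (-(1 / 2) * x ^ 2)

theorem integrable_pow_mul_gauss (a : ℕ) :
    Integrable fun x : ℝ => x ^ a * Real.exp (-(1 / 2) * x ^ 2) := by
  simpa only [Real.rpow_natCast] using integrable_rpow_mul_exp_neg_mul_sq (b := 1 / 2)
    (by norm_num) (s := a) (by have : (0 : ℝ) ≤ a := by positivity
                               linarith)

theorem hasDerivAt_gauss (x : ℝ) : HasDerivAt (fun x : ℝ => Real.exp (-(1 / 2) * x ^ 2))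
    (-(x ^ 1 * Real.exp (-(1 / 2) * x ^ 2))) x := by
  have h : HasDerivAt (fun x : ℝ => -(1 / 2) * x ^ 2) (-x) x :=
    ((hasDerivAt_pow 2 x).const_mul (-(1 / 2) : ℝ)).congr_deriv (by simp)
  exact h.exp.congr_deriv (by ring)

theorem hasDerivAt_pow_mul_gauss (a : ℕ) (x : ℝ) :
    HasDerivAt (fun x : ℝ => x ^ (a + 1) * Real.exp (-(1 / 2) * x ^ 2))
    ((a + 1) * (x ^ a * Real.exp (-(1 / 2) * x ^ 2)) -
      x ^ (a + 2) * Real.exp (-(1 / 2) * x ^ 2)) x := by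
  refine ((hasDerivAt_pow (a + 1) x).fun_mul (hasDerivAt_gauss x)).congr_deriv ?_
  simp only [Nat.add_sub_cancel]
  push_cast
  ring

theorem gaussMoment_add_two (a : ℕ) : gaussMoment (a + 2) = (a + 1) * gaussMoment a := by
  have h := integral_eq_zero_of_hasDerivAt_of_integrable (hasDerivAt_pow_mul_gauss a)
    (((integrable_pow_mul_gauss a).const_mul _).sub (integrable_pow_mul_gauss (a + 2)))
    (integrable_pow_mul_gauss (a + 1))
  rw [integral_sub ((integrable_pow_mul_gauss a).const_mul _) (integrable_pow_mul_gauss (a + 2)),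
    integral_const_mul] at h
  exact (sub_eq_zero.1 h).symm

theorem gaussMoment_one : gaussMoment 1 = 0 := by
  have h := integral_eq_zero_of_hasDerivAt_of_integrable hasDerivAt_gauss
    (integrable_pow_mul_gauss 1).neg (by simpa using integrable_pow_mul_gauss 0)
  rw [integral_neg] at h
  exact neg_eq_zero.1 h

theorem gaussMoment_odd : ∀ a : ℕ, Odd a → gaussMoment a = 0 := by
  have h : ∀ n : ℕ, gaussMoment (2 * n + 1) = 0 := by
    intro n
    induction n with
    | zero => exact gaussMoment_one
    | succ n ih => rw [show 2 * (n + 1) + 1 = 2 * n + 1 + 2 by ring, gaussMoment_add_two, ih,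
        mul_zero]
  rintro a ⟨n, rfl⟩
  exact h n

theorem gaussMoment_zero_sq : gaussMoment 0 * gaussMoment 0 = 2 * Real.pi := by
  have h : gaussMoment 0 = √(Real.pi / (1 / 2)) := by
    rw [← integral_gaussian]; simp [gaussMoment]
  rw [h, Real.mul_self_sqrt (by positivity)]
  ring

theorem halfGaussMoment_add_two (a : ℕ) :
    halfGaussMoment (a + 2) = (a + 1) * halfGaussMoment a := by
  have hi : IntegrableOn (fun x : ℝ => (a + 1) * (x ^ a * Real.exp (-(1 / 2) * x ^ 2)) -
      x ^ (a + 2) * Real.exp (-(1 / 2) * x ^ 2)) (Ioi 0) :=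
    (((integrable_pow_mul_gauss a).const_mul _).sub (integrable_pow_mul_gauss (a + 2))).integrableOn
  have h := integral_Ioi_of_hasDerivAt_of_tendsto' (a := 0)
    (fun x _ => hasDerivAt_pow_mul_gauss a x) hi
    (tendsto_zero_of_hasDerivAt_of_integrableOn_Ioi (fun x _ => hasDerivAt_pow_mul_gauss a x) hi
      (integrable_pow_mul_gauss (a + 1)).integrableOn)
  rw [integral_sub ((integrable_pow_mul_gauss a).const_mul _).integrableOn
    (integrable_pow_mul_gauss (a + 2)).integrableOn, integral_const_mul] at h
  simp only [ne_eq, Nat.add_eq_zero_iff, one_ne_zero, and_false, not_false_eq_true, zero_pow,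
    zero_mul, sub_zero] at h
  exact (sub_eq_zero.1 h).symm

theorem halfGaussMoment_one : halfGaussMoment 1 = 1 := by
  have hi : IntegrableOn (fun x : ℝ => -(x ^ 1 * Real.exp (-(1 / 2) * x ^ 2))) (Ioi 0) :=
    (integrable_pow_mul_gauss 1).neg.integrableOn
  have h := integral_Ioi_of_hasDerivAt_of_tendsto' (a := 0)
    (fun x _ => hasDerivAt_gauss x) hi
    (tendsto_zero_of_hasDerivAt_of_integrableOn_Ioi (fun x _ => hasDerivAt_gauss x) hi
      (by simpa using (integrable_pow_mul_gauss 0).integrableOn))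
  rw [integral_neg] at h
  simp only [ne_eq, OfNat.ofNat_ne_zero, not_false_eq_true, zero_pow, mul_zero, Real.exp_zero,
    zero_sub, neg_inj] at h
  exact h

theorem halfGaussMoment_two_mul_add_one (n : ℕ) :
    halfGaussMoment (2 * n + 1) = ((2 * n)‼ : ℝ) := by
  induction n with
  | zero => simpa using halfGaussMoment_one
  | succ n ih =>
    rw [show 2 * (n + 1) + 1 = 2 * n + 1 + 2 by ring, halfGaussMoment_add_two, ih,
      show 2 * (n + 1) = 2 * n + 2 by ring, Nat.doubleFactorial_add_two]
    push_cast
    ring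

theorem halfGaussMoment_pos (n : ℕ) : 0 < halfGaussMoment n := by
  rw [halfGaussMoment, setIntegral_pos_iff_support_of_nonneg_ae]
  · have h : Ioi (0 : ℝ) ⊆
        (Function.support fun x : ℝ => x ^ n * Real.exp (-(1 / 2) * x ^ 2)) ∩ Ioi 0 := by
      intro x hx
      refine ⟨?_, hx⟩
      have : 0 < x := hx
      simp only [Function.mem_support]
      positivity
    refine lt_of_lt_of_le ?_ (measure_mono h)
    simp
  · refine (ae_restrict_mem measurableSet_Ioi).mono fun x hx => ?_
    have : 0 < x := hx
    simp only [Pi.zero_apply]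
    positivity
  · exact (integrable_pow_mul_gauss n).integrableOn

/-- The upper half space integral of a polynomial against the Gaussian weight. -/
def halfSpaceMoment : MvPolynomial (Fin 3) ℝ →ₗ[ℝ] ℝ :=
  moment fun a b c => gaussMoment a * gaussMoment b * halfGaussMoment c

/-- The divergence theorem for `∇P · exp(-r²/2)` on `x₂ > 0`: its divergence is `(ΔP - EP)
exp(-r²/2)`, and the flux through the plane gives the slice term. On monomials this is
one-dimensional Gaussian integration by parts. -/
theorem halfSpaceMoment_euler (P : MvPolynomial (Fin 3) ℝ) :
    halfSpaceMoment (euler P) = halfSpaceMoment (polyLaplacian P) +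
      sliceMoment (fun a b => gaussMoment a * gaussMoment b) 0 (MvPolynomial.pderiv 2 P) := by
  suffices h : halfSpaceMoment ∘ₗ euler.toLinearMap = halfSpaceMoment ∘ₗ polyLaplacian +
      sliceMoment (fun a b => gaussMoment a * gaussMoment b) 0 ∘ₗ
        (MvPolynomial.pderiv 2).toLinearMap from LinearMap.congr_fun h P
  refine linearMap_eq_of_monomial fun d => ?_
  simp only [LinearMap.comp_apply, Derivation.coeFn_coe, LinearMap.add_apply, euler_apply,
    polyLaplacian_apply, Fin.sum_univ_three, MvPolynomial.X_mul_pderiv_monomial, map_add, map_nsmul]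
  simp only [MvPolynomial.pderiv_monomial, halfSpaceMoment, sliceMoment, moment_monomial]
  simp only [Finsupp.coe_tsub, Pi.sub_apply, Finsupp.single_apply, nsmul_eq_mul, one_mul,
    Fin.reduceEq, if_true, if_false, tsub_zero]
  have hg : ∀ n : ℕ, (n : ℝ) * gaussMoment n = n * ((n - 1 : ℕ) : ℝ) * gaussMoment (n - 1 - 1) := by
    rintro (_ | _ | n)
    · simp
    · simp [gaussMoment_one]
    · rw [show n + 1 + 1 - 1 - 1 = n from rfl, show n + 1 + 1 - 1 = n + 1 from rfl,
        gaussMoment_add_two]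
      push_cast
      ring
  -- The last summand is the boundary value at `0`, present only for `n = 1`: at `n = 0` the test `n
  -- - 1 = 0` also succeeds, but the factor `n` removes it.
  have hh : ∀ n : ℕ, (n : ℝ) * halfGaussMoment n =
      n * ((n - 1 : ℕ) : ℝ) * halfGaussMoment (n - 1 - 1) + n * (if n - 1 = 0 then 1 else 0) := by
    rintro (_ | _ | n)
    · simp
    · simp [halfGaussMoment_one]
    · rw [show n + 1 + 1 - 1 - 1 = n from rfl, show n + 1 + 1 - 1 = n + 1 from rfl,
        halfGaussMoment_add_two]
      push_cast
      simp
      ring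
  have h0 := hg (d 0)
  have h1 := hg (d 1)
  have h2 := hh (d 2)
  by_cases h : d 2 - 1 = 0
  · simp only [h, if_true] at h2 ⊢
    linear_combination gaussMoment (d 1) * halfGaussMoment (d 2) * h0 +
      gaussMoment (d 0) * halfGaussMoment (d 2) * h1 + gaussMoment (d 0) * gaussMoment (d 1) * h2
  · simp only [h, if_false] at h2 ⊢
    linear_combination gaussMoment (d 1) * halfGaussMoment (d 2) * h0 +
      gaussMoment (d 0) * halfGaussMoment (d 2) * h1 + gaussMoment (d 0) * gaussMoment (d 1) * h2

theorem halfSpaceMoment_of_harmonic {k : ℕ} {P : MvPolynomial (Fin 3) ℝ}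
    (hP : P ∈ harmonicPoly k) : k * halfSpaceMoment P =
      sliceMoment (fun a b => gaussMoment a * gaussMoment b) 0 (MvPolynomial.pderiv 2 P) := by
  rw [mem_harmonicPoly] at hP
  have h := halfSpaceMoment_euler P
  rwa [euler_of_isHomogeneous hP.1, hP.2, map_smul, map_zero, zero_add, smul_eq_mul] at h

/-- Gaussian integration by parts gives `M(Δp) = M(Ep)`, hence `κ(n) = n`. -/
theorem gaussMoment_rec (a b : ℕ) :
    (a * (a - 1) : ℝ) * (gaussMoment (a - 2) * gaussMoment b) +
      (b * (b - 1) : ℝ) * (gaussMoment a * gaussMoment (b - 2)) =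
      ((a + b : ℕ) : ℝ) * (gaussMoment a * gaussMoment b) := by
  have hg : ∀ n : ℕ, (n * (n - 1) : ℝ) * gaussMoment (n - 2) = n * gaussMoment n := by
    rintro (_ | _ | n)
    · simp
    · simp [gaussMoment_one]
    · rw [show n + 1 + 1 - 2 = n from rfl, gaussMoment_add_two]
      push_cast
      ring
  have h0 := hg a
  have h1 := hg b
  push_cast
  linear_combination gaussMoment b * h0 + gaussMoment a * h1

/-! ### From Gaussian half-space integrals to hemisphere integrals -/

theorem integrable_and_integral_halfSpace (P : MvPolynomial (Fin 3) ℝ) :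
    Integrable (fun x : Fin 3 → ℝ => if 0 < x 2 then
      MvPolynomial.eval x P * Real.exp (-(1 / 2) * ∑ i, x i ^ 2) else 0) ∧
    ∫ x : Fin 3 → ℝ, (if 0 < x 2 then
      MvPolynomial.eval x P * Real.exp (-(1 / 2) * ∑ i, x i ^ 2) else 0) = halfSpaceMoment P := by
  induction P using MvPolynomial.induction_on' with
  | monomial d c =>
    let f : Fin 3 → ℝ → ℝ := ![fun x => c * (x ^ d 0 * Real.exp (-(1 / 2) * x ^ 2)),
      fun x => x ^ d 1 * Real.exp (-(1 / 2) * x ^ 2),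
      (Ioi 0).indicator fun x => x ^ d 2 * Real.exp (-(1 / 2) * x ^ 2)]
    have hf : ∀ i, Integrable (f i) := by
      intro i
      fin_cases i
      · exact (integrable_pow_mul_gauss (d 0)).const_mul c
      · exact integrable_pow_mul_gauss (d 1)
      · exact (integrable_pow_mul_gauss (d 2)).indicator measurableSet_Ioi
    have he : (fun x : Fin 3 → ℝ => if 0 < x 2 then
        MvPolynomial.eval x (MvPolynomial.monomial d c) *
          Real.exp (-(1 / 2) * ∑ i, x i ^ 2) else 0) = fun x => ∏ i, f i (x i) := by
      funext x
      simp only [f, Fin.prod_univ_three, Matrix.cons_val, Fin.sum_univ_three, mul_add,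
        Real.exp_add, MvPolynomial.eval_monomial, Finsupp.prod_fintype _ _ (fun i => pow_zero _),
        indicator_apply, mem_Ioi]
      split_ifs
      · ring
      · ring
    rw [he, integral_fintype_prod_volume_eq_prod]
    refine ⟨Integrable.fintype_prod hf, ?_⟩
    rw [Fin.prod_univ_three, halfSpaceMoment, moment_monomial]
    simp only [f, Matrix.cons_val, integral_const_mul, integral_indicator measurableSet_Ioi]
    rw [gaussMoment, gaussMoment, halfGaussMoment]
    ring
  | add P Q hP hQ =>
    have he : (fun x : Fin 3 → ℝ => if 0 < x 2 then
        MvPolynomial.eval x (P + Q) * Real.exp (-(1 / 2) * ∑ i, x i ^ 2) else 0) = fun x =>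
        (if 0 < x 2 then MvPolynomial.eval x P * Real.exp (-(1 / 2) * ∑ i, x i ^ 2) else 0) +
        (if 0 < x 2 then MvPolynomial.eval x Q * Real.exp (-(1 / 2) * ∑ i, x i ^ 2) else 0) := by
      funext x
      split_ifs
      · rw [map_add]; ring
      · simp
    rw [he, map_add, ← hP.2, ← hQ.2]
    exact ⟨hP.1.add hQ.1, integral_add hP.1 hQ.1⟩

/-- Polar coordinates in the half space: the radial factor is `r^k` from homogeneity times the
density `r²`, whence the shift to `k + 2`. -/
theorem integral_hemisphere_mul {k : ℕ} {P : MvPolynomial (Fin 3) ℝ} (hP : P.IsHomogeneous k) :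
    (∫ u in {u : S2 | 0 < (u : E3) 2}, evalPoly P u ∂area) * halfGaussMoment (k + 2) =
      halfSpaceMoment P := by
  have hm : MeasurableSet {u : S2 | 0 < (u : E3) 2} :=
    measurableSet_lt measurable_const (by fun_prop)
  rw [← (integrable_and_integral_halfSpace P).2, ← integral_indicator hm]
  have h := integral_mul_norm_eq
    ({u : S2 | 0 < (u : E3) 2}.indicator fun u : S2 => evalPoly P u)
    fun r => r ^ k * Real.exp (-(1 / 2) * r ^ 2)
  have h2 : halfGaussMoment (k + 2) =
      ∫ r in Ioi (0 : ℝ), r ^ 2 * (r ^ k * Real.exp (-(1 / 2) * r ^ 2)) := by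
    rw [halfGaussMoment]
    congr 1
    funext r
    ring
  rw [h2, ← h, ← (PiLp.volume_preserving_toLp (Fin 3)).integral_comp
    (MeasurableEquiv.toLp 2 (Fin 3 → ℝ)).measurableEmbedding]
  refine integral_congr_ae ?_
  -- The origin, where `sphereProj` has a junk value, is a null set.
  have h0 : ∀ᵐ x : Fin 3 → ℝ, x ≠ 0 := by
    simp [ae_iff, measure_singleton]
  filter_upwards [h0] with x hx
  have hx0 : WithLp.toLp 2 x ≠ (0 : E3) := by simpa using hx
  have hn : 0 < ‖(WithLp.toLp 2 x : E3)‖ := norm_pos_iff.2 hx0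
  have hnorm : ‖(WithLp.toLp 2 x : E3)‖ ^ 2 = ∑ i, x i ^ 2 := by
    rw [EuclideanSpace.norm_sq_eq]; simp
  have hpos : (0 < ((sphereProj (WithLp.toLp 2 x) : S2) : E3) 2) ↔ 0 < x 2 := by
    rw [coe_sphereProj hx0]
    simp only [PiLp.smul_apply, smul_eq_mul]
    exact mul_pos_iff_of_pos_left (inv_pos.2 hn)
  rw [hnorm, indicator_apply]
  simp only [mem_ofPred_eq, hpos]
  split_ifs
  · rw [coe_sphereProj hx0, evalPoly_smul_of_isHomogeneous hP, evalPoly, inv_pow]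
    field_simp
  · simp

theorem evalPoly_pderiv_two_pole {k : ℕ} {P : MvPolynomial (Fin 3) ℝ} (hP : P.IsHomogeneous k) :
    evalPoly (MvPolynomial.pderiv 2 P) (EuclideanSpace.single 2 1) =
      k * evalPoly P (EuclideanSpace.single 2 1) := by
  have h := congrArg (fun Q => evalPoly Q (EuclideanSpace.single 2 1)) (euler_of_isHomogeneous hP)
  simpa [evalPoly, euler_apply, Fin.sum_univ_three] using h

/-- The climb is applied to `∂₂P`, harmonic of even degree `2m`, whose value at the pole is `(2m+1)
P(e₂)` by Euler. The radial moment contributes `(2m+2)‼` and the product of the `κ` contributes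
`(2m)‼`. -/
theorem hemisphere_odd {m : ℕ} {P : MvPolynomial (Fin 3) ℝ} (hP : P ∈ harmonicPoly (2 * m + 1)) :
    1 / (2 * Real.pi) * ∫ u in {u : S2 | 0 < (u : E3) 2}, evalPoly P u ∂area =
      (-1) ^ m * (1 / (2 * m + 1)) * (((2 * m + 1)‼ : ℝ) / ((2 * m + 2)‼ : ℝ)) *
        evalPoly P (EuclideanSpace.single 2 1) := by
  have h1 := integral_hemisphere_mul (mem_harmonicPoly.1 hP).1
  have h2 := halfSpaceMoment_of_harmonic hP
  have h3 := prod_mul_sliceMoment_zero (μ := fun a b => gaussMoment a * gaussMoment b)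
    (κ := fun n => (n : ℝ)) gaussMoment_rec
    (pderiv_mem_harmonicPoly hP 2)
  rw [prod_range_two_mul, gaussMoment_zero_sq, evalPoly_pderiv_two_pole (mem_harmonicPoly.1 hP).1,
    ← h2, ← h1, show 2 * m + 1 + 2 = 2 * (m + 1) + 1 by ring, halfGaussMoment_two_mul_add_one,
    show 2 * (m + 1) = 2 * m + 2 by ring] at h3
  have h4 : ((2 * m)‼ : ℝ) * ((2 * m + 1)‼ : ℝ) = (2 * m + 1) * (2 * m)! := by
    have := Nat.factorial_eq_mul_doubleFactorial (2 * m)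
    rw [Nat.factorial_succ] at this
    have h5 : ((2 * m + 1 : ℕ) : ℝ) * (2 * m)! = ((2 * m + 1)‼ : ℝ) * ((2 * m)‼ : ℝ) := by
      exact_mod_cast this
    push_cast at h5
    linear_combination -h5
  have e0 : ((2 * m)‼ : ℝ) ≠ 0 := by exact_mod_cast (Nat.doubleFactorial_pos _).ne'
  have e2 : ((2 * m + 2)‼ : ℝ) ≠ 0 := by exact_mod_cast (Nat.doubleFactorial_pos _).ne'
  have e3 : (2 * m + 1 : ℝ) ≠ 0 := by positivity
  have e4 := Real.pi_pos.ne'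
  push_cast at h3
  set I := ∫ u in {u : S2 | 0 < (u : E3) 2}, evalPoly P u ∂area
  set v := evalPoly P (EuclideanSpace.single 2 1)
  have h6 : ((2 * m)‼ : ℝ) * (I * ((2 * m + 2)‼ : ℝ) * (2 * m + 1)) =
      ((2 * m)‼ : ℝ) * ((-1) ^ m * ((2 * m + 1)‼ : ℝ) * (2 * Real.pi) * v) := by
    linear_combination h3 - (-1) ^ m * (2 * Real.pi) * v * h4
  have h7 := mul_left_cancel₀ e0 h6
  field_simp
  linear_combination h7

/-- Here `∂₂P` has odd degree, so its Gaussian integral over the plane vanishes by parity;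
positivity of the degree allows division by it. -/
theorem hemisphere_even {m : ℕ} (hm : 1 ≤ m) {P : MvPolynomial (Fin 3) ℝ}
    (hP : P ∈ harmonicPoly (2 * m)) :
    ∫ u in {u : S2 | 0 < (u : E3) 2}, evalPoly P u ∂area = 0 := by
  have h1 := integral_hemisphere_mul (mem_harmonicPoly.1 hP).1
  have h2 := halfSpaceMoment_of_harmonic hP
  rw [sliceMoment_eq_zero_of_odd (k := 2 * m - 1) _ ⟨m - 1, by omega⟩
    (mem_harmonicPoly.1 (pderiv_mem_harmonicPoly hP 2)).1, ← h1] at h2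
  · have h3 : ((2 * m : ℕ) : ℝ) ≠ 0 := by exact_mod_cast (by omega : 2 * m ≠ 0)
    exact (mul_eq_zero.1 ((mul_eq_zero.1 h2).resolve_left h3)).resolve_right
      (halfGaussMoment_pos _).ne'
  · intro a b hab
    rcases Nat.odd_add.1 hab with h
    by_cases ha : Odd a
    · rw [gaussMoment_odd a ha, zero_mul]
    · have hb : Odd b := by
        rw [← Nat.not_even_iff_odd]; exact fun hb => ha (h.2 hb)
      rw [gaussMoment_odd b hb, mul_zero]

theorem hemisphere_zero {P : MvPolynomial (Fin 3) ℝ} (hP : P ∈ harmonicPoly 0) :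
    1 / (2 * Real.pi) * ∫ u in {u : S2 | 0 < (u : E3) 2}, evalPoly P u ∂area =
      evalPoly P (EuclideanSpace.single 2 1) := by
  have h1 := integral_hemisphere_mul (mem_harmonicPoly.1 hP).1
  have h := (MvPolynomial.totalDegree_zero_iff_isHomogeneous _).2 (mem_harmonicPoly.1 hP).1
  rw [MvPolynomial.totalDegree_eq_zero_iff_eq_C] at h
  generalize MvPolynomial.coeff 0 P = c at h
  subst h
  rw [halfGaussMoment_add_two, halfSpaceMoment, MvPolynomial.C_apply, moment_monomial] at h1
  simp only [Finsupp.coe_zero, Pi.zero_apply, gaussMoment_zero_sq] at h1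
  have h2 := mul_right_cancel₀ (halfGaussMoment_pos 0).ne'
    (a := (∫ u in {u : S2 | 0 < (u : E3) 2}, evalPoly (MvPolynomial.monomial 0 c) u ∂area))
    (c := c * (2 * Real.pi)) (by push_cast at h1; linear_combination h1)
  rw [MvPolynomial.C_apply, h2]
  have := Real.pi_pos.ne'
  simp [evalPoly]
  field_simp

/-! ### Eigenvalues of the neck transforms -/

/-- The composition of a polynomial with a linear isometry. -/
def rotPoly (A : E3 ≃ₗᵢ[ℝ] E3) : MvPolynomial (Fin 3) ℝ →ₐ[ℝ] MvPolynomial (Fin 3) ℝ :=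
  MvPolynomial.aeval fun i => ∑ j, MvPolynomial.C (A (EuclideanSpace.single j 1) i) *
    MvPolynomial.X j

theorem isometry_apply_eq_sum (A : E3 ≃ₗᵢ[ℝ] E3) (x : E3) (i : Fin 3) :
    A x i = ∑ j, A (EuclideanSpace.single j 1) i * x j := by
  have h : x = ∑ j, x j • EuclideanSpace.single j (1 : ℝ) := by
    ext i
    fin_cases i <;> simp [Fin.sum_univ_three]
  conv_lhs => rw [h]
  simp [Fin.sum_univ_three, mul_comm]

theorem sum_isometry_mul (A : E3 ≃ₗᵢ[ℝ] E3) (i l : Fin 3) :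
    ∑ j, A (EuclideanSpace.single j 1) i * A (EuclideanSpace.single j 1) l =
      if i = l then 1 else 0 := by
  have h : ∀ i j, A (EuclideanSpace.single j 1) i = A.symm (EuclideanSpace.single i 1) j := by
    intro i j
    have h1 : inner ℝ (EuclideanSpace.single i (1 : ℝ)) (A (EuclideanSpace.single j 1)) =
        inner ℝ (A.symm (EuclideanSpace.single i 1)) (EuclideanSpace.single j (1 : ℝ)) := by
      rw [← A.symm.inner_map_map, A.symm_apply_apply]
    simpa [EuclideanSpace.inner_single_left, EuclideanSpace.inner_single_right] using h1
  have h2 := A.symm.inner_map_map (EuclideanSpace.single i (1 : ℝ)) (EuclideanSpace.single l 1)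
  simp only [PiLp.inner_apply (A.symm _), RCLike.inner_apply, conj_trivial, ← h] at h2
  simp only [mul_comm (A _ i)]
  rw [h2]
  simp [EuclideanSpace.inner_single_left, PiLp.single_apply]

theorem evalPoly_rotPoly (A : E3 ≃ₗᵢ[ℝ] E3) (P : MvPolynomial (Fin 3) ℝ) (x : E3) :
    evalPoly (rotPoly A P) x = evalPoly P (A x) := by
  induction P using MvPolynomial.induction_on with
  | C a => simp [evalPoly, rotPoly]
  | add P Q hP hQ =>
    simp only [evalPoly, map_add] at hP hQ ⊢
    rw [hP, hQ]
  | mul_X P i hP =>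
    simp only [evalPoly, map_mul] at hP ⊢
    rw [hP, MvPolynomial.eval_X, isometry_apply_eq_sum]
    simp [rotPoly]

theorem pderiv_rotPoly (A : E3 ≃ₗᵢ[ℝ] E3) (P : MvPolynomial (Fin 3) ℝ) (j : Fin 3) :
    MvPolynomial.pderiv j (rotPoly A P) = ∑ i, MvPolynomial.C (A (EuclideanSpace.single j 1) i) *
      rotPoly A (MvPolynomial.pderiv i P) := by
  induction P using MvPolynomial.induction_on with
  | C a => simp [rotPoly]
  | add P Q hP hQ => simp only [map_add, hP, hQ, mul_add, Finset.sum_add_distrib]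
  | mul_X P i hP =>
    have hX : MvPolynomial.pderiv j (rotPoly A (MvPolynomial.X i)) =
        MvPolynomial.C (A (EuclideanSpace.single j 1) i) := by
      simp only [rotPoly, MvPolynomial.aeval_X, map_sum, MvPolynomial.pderiv_C_mul,
        MvPolynomial.pderiv_X]
      simp [Pi.single_apply]
    rw [map_mul, Derivation.leibniz, hX, hP]
    simp only [Derivation.leibniz, MvPolynomial.pderiv_X, smul_eq_mul, map_add, map_mul,
      Fin.sum_univ_three]
    fin_cases i <;> simp <;> ring

theorem polyLaplacian_rotPoly (A : E3 ≃ₗᵢ[ℝ] E3) (P : MvPolynomial (Fin 3) ℝ) :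
    polyLaplacian (rotPoly A P) = rotPoly A (polyLaplacian P) := by
  simp only [polyLaplacian_apply, pderiv_rotPoly, map_sum, MvPolynomial.pderiv_C_mul,
    Finset.mul_sum]
  rw [Finset.sum_comm]
  refine Finset.sum_congr rfl fun i _ => ?_
  rw [Finset.sum_comm]
  simp only [← mul_assoc, ← Finset.sum_mul, ← map_mul, ← map_sum, sum_isometry_mul]
  simp

theorem rotPoly_mem_harmonicPoly (A : E3 ≃ₗᵢ[ℝ] E3) {k : ℕ} {P : MvPolynomial (Fin 3) ℝ}
    (hP : P ∈ harmonicPoly k) : rotPoly A P ∈ harmonicPoly k := by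
  rw [mem_harmonicPoly] at hP ⊢
  refine ⟨?_, by rw [polyLaplacian_rotPoly, hP.2, map_zero]⟩
  have h := hP.1.aeval (fun i => ∑ j, MvPolynomial.C (A (EuclideanSpace.single j 1) i) *
    MvPolynomial.X j) (n := 1) fun i => MvPolynomial.IsHomogeneous.sum _ _ _ fun j _ => by
      simpa using (MvPolynomial.isHomogeneous_C _ _).mul (MvPolynomial.isHomogeneous_X ℝ j)
  rwa [one_mul] at h

/-- The images of the first two axes are prescribed as well, so that the standard equator is carried
to `circleParam 0 y` with the same parameter. -/
theorem exists_adapted_isometry (y : S2) : ∃ A : E3 ≃ₗᵢ[ℝ] E3,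
    A (EuclideanSpace.single 0 1) = perpBasis y 0 ∧ A (EuclideanSpace.single 1 1) = perpBasis y 1 ∧
      A (EuclideanSpace.single 2 1) = y := by
  have h0 : ‖(perpBasis y 0 : E3)‖ = 1 := (perpBasis y).orthonormal.1 0
  have h1 : ‖(perpBasis y 1 : E3)‖ = 1 := (perpBasis y).orthonormal.1 1
  have h01 : inner ℝ (perpBasis y 0 : E3) (perpBasis y 1 : E3) = 0 :=
    (perpBasis y).orthonormal.2 (i := 0) (j := 1) (by decide)
  have h10 : inner ℝ (perpBasis y 1 : E3) (perpBasis y 0 : E3) = 0 :=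
    (perpBasis y).orthonormal.2 (i := 1) (j := 0) (by decide)
  have hy : ‖(y : E3)‖ = 1 := by simp
  have hp : ∀ i, inner ℝ (y : E3) (perpBasis y i : E3) = 0 := fun i =>
    Submodule.mem_orthogonal_singleton_iff_inner_right.1 (perpBasis y i).2
  have hp' : ∀ i, inner ℝ (perpBasis y i : E3) (y : E3) = 0 := fun i => by
    rw [real_inner_comm, hp]
  have ho : Orthonormal ℝ ![(perpBasis y 0 : E3), (perpBasis y 1 : E3), (y : E3)] := by
    constructor
    · intro i
      fin_cases i <;> simp [h0, h1, hy]
    · intro i j hij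
      fin_cases i <;> fin_cases j <;> simp [h01, h10, hp, hp'] at hij ⊢
  let b := OrthonormalBasis.mk ho
    (ho.linearIndependent.span_eq_top_of_card_eq_finrank (by simp)).ge
  refine ⟨b.repr.symm, ?_, ?_, ?_⟩ <;> rw [OrthonormalBasis.repr_symm_single] <;> simp [b]

theorem neckQ_polyRestrict_eq {y : S2} {A : E3 ≃ₗᵢ[ℝ] E3} (hA : A (EuclideanSpace.single 2 1) = y)
    (P : MvPolynomial (Fin 3) ℝ) : neckQ (polyRestrict P) y =
      1 / (2 * Real.pi) * ∫ u in {u : S2 | 0 < (u : E3) 2}, evalPoly (rotPoly A P) u ∂area := by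
  rw [neckQ, capTransform]
  congr 1
  have h := (measurePreserving_sphereIsom A).setIntegral_preimage_emb
    (sphereIsom A).measurableEmbedding (polyRestrict P) (cap 0 y)
  have hc : sphereIsom A ⁻¹' cap 0 y = {u : S2 | 0 < (u : E3) 2} := by
    ext u
    simp only [cap, mem_preimage, mem_ofPred_eq, coe_sphereIsom, ← hA, A.inner_map_map,
      Real.tanh_zero, gt_iff_lt]
    simp [EuclideanSpace.inner_single_right]
  rw [← h, hc]
  simp only [polyRestrict_apply, coe_sphereIsom, evalPoly_rotPoly]

theorem neckR_polyRestrict_eq {y : S2} {A : E3 ≃ₗᵢ[ℝ] E3}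
    (h0 : A (EuclideanSpace.single 0 1) = perpBasis y 0)
    (h1 : A (EuclideanSpace.single 1 1) = perpBasis y 1) (P : MvPolynomial (Fin 3) ℝ) :
    neckR (polyRestrict P) y = 1 / (2 * Real.pi) * ∫ θ in (0 : ℝ)..(2 * Real.pi),
      evalPoly (rotPoly A P)
        (Real.cos θ • EuclideanSpace.single 0 1 + Real.sin θ • EuclideanSpace.single 1 1) := by
  rw [neckR, circleTransform]
  simp only [polyRestrict_apply, circleParam, circleVec, Real.cosh_zero, Real.tanh_zero, div_one,
    zero_smul, add_zero, evalPoly_rotPoly, map_add, map_smul, h0, h1]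

/-- The eigenvalues of `neckQ`. -/
def eigenQ (k : ℕ) : ℝ :=
  if k = 0 then 1 else if Even k then 0 else
    (-1 : ℝ) ^ (k / 2) * (1 / k) * ((k‼ : ℝ) / ((k + 1)‼ : ℝ))

/-- The eigenvalues of `neckR`. -/
def eigenR (k : ℕ) : ℝ :=
  if Even k then (-1 : ℝ) ^ (k / 2) * (k ! / (k‼ : ℝ) ^ 2) else 0

theorem eigenQ_odd (m : ℕ) : eigenQ (2 * m + 1) =
    (-1 : ℝ) ^ m * (1 / (2 * m + 1 : ℝ)) * (((2 * m + 1)‼ : ℝ) / ((2 * m + 2)‼ : ℝ)) := by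
  rw [eigenQ, if_neg (by omega), if_neg (by simp), show (2 * m + 1) / 2 = m by omega]
  push_cast
  rfl

theorem eigenQ_even {k : ℕ} (hk : Even k) (h0 : k ≠ 0) : eigenQ k = 0 := by
  rw [eigenQ, if_neg h0, if_pos hk]

theorem eigenQ_zero : eigenQ 0 = 1 := if_pos rfl

theorem eigenR_even (m : ℕ) : eigenR (2 * m) = (-1 : ℝ) ^ m * ((2 * m)! / ((2 * m)‼ : ℝ) ^ 2) := by
  rw [eigenR, if_pos (by simp), show 2 * m / 2 = m by omega]

theorem eigenR_odd {k : ℕ} (hk : Odd k) : eigenR k = 0 :=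
  if_neg (Nat.not_even_iff_odd.2 hk)

theorem neckQ_polyRestrict {k : ℕ} {P : MvPolynomial (Fin 3) ℝ} (hP : P ∈ harmonicPoly k)
    (y : S2) : neckQ (polyRestrict P) y = eigenQ k * polyRestrict P y := by
  obtain ⟨A, -, -, hA⟩ := exists_adapted_isometry y
  have hP' := rotPoly_mem_harmonicPoly A hP
  rw [neckQ_polyRestrict_eq hA, polyRestrict_apply, ← hA, ← evalPoly_rotPoly]
  rcases Nat.even_or_odd' k with ⟨m, rfl | rfl⟩
  · rcases Nat.eq_zero_or_pos m with rfl | hm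
    · rw [mul_zero, eigenQ_zero, one_mul]
      exact hemisphere_zero hP'
    · rw [hemisphere_even hm hP', eigenQ_even (by simp) (by omega), mul_zero, zero_mul]
  · rw [hemisphere_odd hP', eigenQ_odd]

theorem neckR_polyRestrict {k : ℕ} {P : MvPolynomial (Fin 3) ℝ} (hP : P ∈ harmonicPoly k)
    (y : S2) : neckR (polyRestrict P) y = eigenR k * polyRestrict P y := by
  obtain ⟨A, h0, h1, hA⟩ := exists_adapted_isometry y
  have hP' := rotPoly_mem_harmonicPoly A hP
  rw [neckR_polyRestrict_eq h0 h1, polyRestrict_apply, ← hA, ← evalPoly_rotPoly]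
  rcases Nat.even_or_odd' k with ⟨m, rfl | rfl⟩
  · rw [circle_average_of_harmonic hP', eigenR_even]
  · rw [circle_average_of_odd ⟨m, rfl⟩ hP', eigenR_odd ⟨m, rfl⟩, zero_mul]

/-! ### Bounds for the eigenvalues -/

theorem eigenQ_odd_succ (m : ℕ) :
    eigenQ (2 * (m + 1) + 1) = -((2 * m + 1) / (2 * m + 4)) * eigenQ (2 * m + 1) := by
  rw [eigenQ_odd, eigenQ_odd, show 2 * (m + 1) + 1 = 2 * m + 1 + 2 by ring,
    show 2 * (m + 1) + 2 = 2 * m + 2 + 2 by ring, Nat.doubleFactorial_add_two,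
    Nat.doubleFactorial_add_two]
  have e2 : ((2 * m + 2)‼ : ℝ) ≠ 0 := by exact_mod_cast (Nat.doubleFactorial_pos _).ne'
  have e3 : (2 * m + 1 : ℝ) ≠ 0 := by positivity
  have e4 : (2 * m + 4 : ℝ) ≠ 0 := by positivity
  have e5 : (2 * m + 3 : ℝ) ≠ 0 := by positivity
  push_cast
  rw [show (2 * (m + 1) + 1 : ℝ) = 2 * m + 3 by ring, show (2 * m + 1 + 2 : ℝ) = 2 * m + 3 by ring,
    show (2 * m + 2 + 2 : ℝ) = 2 * m + 4 by ring]
  field_simp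
  ring

theorem eigenQ_one : eigenQ 1 = 1 / 2 := by
  have h := eigenQ_odd 0
  simpa [Nat.doubleFactorial] using h

/-- With `n = 2m+1`, consecutive odd eigenvalues have ratio `-n/(n+3)`. Then `c(n)² n³` is
nondecreasing because `(n+2)³ - n(n+3)² = 3n + 8 ≥ 0`, and it starts at `1/4`. -/
theorem le_eigenQ_sq_mul (m : ℕ) : 1 / 4 ≤ eigenQ (2 * m + 1) ^ 2 * (2 * m + 1 : ℝ) ^ 3 := by
  induction m with
  | zero => norm_num [eigenQ_one]
  | succ m ih =>
    refine ih.trans ?_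
    rw [eigenQ_odd_succ]
    push_cast
    have h : (2 * m + 1 : ℝ) ^ 3 ≤ ((2 * m + 1) / (2 * m + 4)) ^ 2 * (2 * (m + 1) + 1 : ℝ) ^ 3 := by
      rw [div_pow, div_mul_eq_mul_div, le_div_iff₀ (by positivity)]
      have hm : (0 : ℝ) ≤ m := by positivity
      nlinarith [mul_nonneg (sq_nonneg (2 * m + 1 : ℝ)) (by linarith : (0 : ℝ) ≤ 6 * m + 11)]
    calc eigenQ (2 * m + 1) ^ 2 * (2 * m + 1 : ℝ) ^ 3
        ≤ eigenQ (2 * m + 1) ^ 2 *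
          (((2 * m + 1) / (2 * m + 4)) ^ 2 * (2 * (m + 1) + 1 : ℝ) ^ 3) :=
        mul_le_mul_of_nonneg_left h (sq_nonneg _)
      _ = _ := by ring

/-- Since `c(n)² n³` increases, induction needs a larger weight: `c(n)² n(n+1)(n+2)` is
nonincreasing because `n(n+4) ≤ (n+1)(n+3)`, and it starts at `6/4`. -/
theorem eigenQ_sq_mul_le (m : ℕ) : eigenQ (2 * m + 1) ^ 2 * (2 * m + 1 : ℝ) ^ 3 ≤ 3 / 2 := by
  have h : eigenQ (2 * m + 1) ^ 2 * ((2 * m + 1) * (2 * m + 2) * (2 * m + 3) : ℝ) ≤ 3 / 2 := by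
    induction m with
    | zero => norm_num [eigenQ_one]
    | succ m ih =>
      refine le_trans ?_ ih
      rw [eigenQ_odd_succ]
      push_cast
      have h : ((2 * m + 1) / (2 * m + 4)) ^ 2 * ((2 * (m + 1) + 1) * (2 * (m + 1) + 2) *
          (2 * (m + 1) + 3) : ℝ) ≤ (2 * m + 1) * (2 * m + 2) * (2 * m + 3) := by
        rw [div_pow, div_mul_eq_mul_div, div_le_iff₀ (by positivity)]
        have hm : (0 : ℝ) ≤ (2 * m + 1) * (2 * m + 3) * (2 * m + 4) := by positivity
        nlinarith [hm]
      calc (-((2 * m + 1) / (2 * m + 4)) * eigenQ (2 * m + 1)) ^ 2 * ((2 * (m + 1) + 1) *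
            (2 * (m + 1) + 2) * (2 * (m + 1) + 3) : ℝ)
          = eigenQ (2 * m + 1) ^ 2 * (((2 * m + 1) / (2 * m + 4)) ^ 2 * ((2 * (m + 1) + 1) *
            (2 * (m + 1) + 2) * (2 * (m + 1) + 3) : ℝ)) := by ring
        _ ≤ _ := mul_le_mul_of_nonneg_left h (sq_nonneg _)
  refine le_trans (mul_le_mul_of_nonneg_left ?_ (sq_nonneg _)) h
  have hm : (0 : ℝ) ≤ m := by positivity
  nlinarith [mul_nonneg hm hm]

theorem abs_eigenQ_le (k : ℕ) : |eigenQ k| ≤ 2 := by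
  rcases Nat.even_or_odd' k with ⟨m, rfl | rfl⟩
  · rcases Nat.eq_zero_or_pos m with rfl | hm
    · norm_num [eigenQ_zero]
    · rw [eigenQ_even (by simp) (by omega)]; norm_num
  · refine abs_le_of_sq_le_sq ?_ (by norm_num)
    have h1 := eigenQ_sq_mul_le m
    have h2 : (1 : ℝ) ≤ (2 * m + 1 : ℝ) ^ 3 := one_le_pow₀ (by linarith [m.cast_nonneg (α := ℝ)])
    have h3 := mul_le_mul_of_nonneg_left h2 (sq_nonneg (eigenQ (2 * m + 1)))
    linarith

theorem eigenQ_ne_zero {k : ℕ} (hk : Odd k) : eigenQ k ≠ 0 := by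
  obtain ⟨m, rfl⟩ := hk
  intro h
  have h1 := le_eigenQ_sq_mul m
  rw [h] at h1
  norm_num at h1

/-- The true order is `k^(3/2)`; for smooth functions any polynomial bound suffices, and this form
is the one that `IsRapid.smul` accepts. -/
theorem abs_eigenQ_inv_le {k : ℕ} (hk : Odd k) : |(eigenQ k)⁻¹| ≤ 2 * (k + 1) ^ 2 := by
  have h0 := eigenQ_ne_zero hk
  obtain ⟨m, rfl⟩ := hk
  rw [abs_inv, inv_le_comm₀ (abs_pos.2 h0) (by positivity)]
  refine (le_abs_self _).trans (sq_le_sq.1 ?_)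
  have h1 := le_eigenQ_sq_mul m
  push_cast
  rw [inv_pow, inv_le_comm₀ (by positivity) (by positivity)]
  have h2 : (eigenQ (2 * m + 1) ^ 2)⁻¹ ≤ 4 * (2 * m + 1 : ℝ) ^ 3 := by
    rw [inv_le_iff_one_le_mul₀ (by positivity)]
    linarith
  refine h2.trans ?_
  have hm : (0 : ℝ) ≤ m := by positivity
  have h3 : (2 * m + 1 : ℝ) ^ 3 ≤ (2 * m + 1 + 1 : ℝ) ^ 4 := by
    calc (2 * m + 1 : ℝ) ^ 3 ≤ (2 * m + 1 + 1 : ℝ) ^ 3 := by gcongr; linarith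
      _ ≤ (2 * m + 1 + 1 : ℝ) ^ 4 := pow_le_pow_right₀ (by linarith) (by norm_num)
  calc 4 * (2 * m + 1 : ℝ) ^ 3 ≤ 4 * (2 * m + 1 + 1 : ℝ) ^ 4 := by linarith
    _ = _ := by ring

/-! ### Eigenvalues of the Funk transform -/

theorem eigenR_even_succ (m : ℕ) :
    eigenR (2 * (m + 1)) = -((2 * m + 1) / (2 * m + 2)) * eigenR (2 * m) := by
  rw [eigenR_even, eigenR_even, show 2 * (m + 1) = 2 * m + 1 + 1 by ring, Nat.factorial_succ,
    Nat.factorial_succ, Nat.doubleFactorial_add_two]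
  have e2 : ((2 * m)‼ : ℝ) ≠ 0 := by exact_mod_cast (Nat.doubleFactorial_pos _).ne'
  have e4 : (2 * m + 2 : ℝ) ≠ 0 := by positivity
  push_cast
  rw [show (2 * m + 1 + 1 : ℝ) = 2 * m + 2 by ring]
  field_simp
  ring

theorem eigenR_zero : eigenR 0 = 1 := by
  have h := eigenR_even 0
  simpa using h

theorem abs_eigenR_even (m : ℕ) : (1 : ℝ) / (2 * m + 1) ≤ |eigenR (2 * m)| ∧
    |eigenR (2 * m)| ≤ 1 := by
  induction m with
  | zero => simp [eigenR_zero]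
  | succ m ih =>
    rw [eigenR_even_succ, abs_mul, abs_neg, abs_of_nonneg (by positivity)]
    constructor
    · refine le_trans ?_ (mul_le_mul_of_nonneg_left ih.1 (by positivity))
      push_cast
      rw [div_mul_div_comm, div_le_div_iff₀ (by positivity) (by positivity)]
      nlinarith [m.cast_nonneg (α := ℝ)]
    · refine mul_le_one₀ ?_ (abs_nonneg _) ih.2
      rw [div_le_one (by positivity)]
      linarith

theorem abs_eigenR_le (k : ℕ) : |eigenR k| ≤ 2 := by
  rcases Nat.even_or_odd' k with ⟨m, rfl | rfl⟩
  · linarith [(abs_eigenR_even m).2]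
  · rw [eigenR_odd ⟨m, rfl⟩]; norm_num

theorem eigenR_ne_zero {k : ℕ} (hk : Even k) : eigenR k ≠ 0 := by
  obtain ⟨m, rfl⟩ := hk.exists_two_nsmul
  have h := (abs_eigenR_even m).1
  rw [smul_eq_mul, ← abs_pos]
  exact lt_of_lt_of_le (by positivity) h

theorem abs_eigenR_inv_le {k : ℕ} (hk : Even k) : |(eigenR k)⁻¹| ≤ 2 * (k + 1) ^ 2 := by
  have h0 := eigenR_ne_zero hk
  obtain ⟨m, rfl⟩ := hk.exists_two_nsmul
  rw [smul_eq_mul] at h0 ⊢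
  have h := (abs_eigenR_even m).1
  rw [abs_inv, inv_le_comm₀ (abs_pos.2 h0) (by positivity), ← one_div]
  refine le_trans ?_ h
  push_cast
  have hm : (0 : ℝ) ≤ m := by positivity
  gcongr
  nlinarith

/-! ### Uniform bounds for spherical harmonics -/

/-- Cauchy–Schwarz against the indicator of the cap, whose norm is at most `√(4π)`. The resulting
constant `1/√π` is below `1`. -/
theorem abs_neckQ_le (h : L2) (y : S2) : |neckQ h y| ≤ ‖h‖ := by
  have hm := measurableSet_cap 0 y
  have hfin : area (cap 0 y) ≠ ⊤ := measure_ne_top _ _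
  have h1 : ∫ u in cap 0 y, h u ∂area = inner ℝ (indicatorConstLp 2 hm hfin (1 : ℝ)) h := by
    rw [L2.inner_indicatorConstLp_one]
  have h2 : ‖indicatorConstLp 2 hm hfin (1 : ℝ)‖ ≤ 2 * Real.sqrt Real.pi := by
    rw [norm_indicatorConstLp (by simp) (by simp)]
    simp only [norm_one, ENNReal.toReal_ofNat, one_mul, ← Real.sqrt_eq_rpow]
    rw [show (2 : ℝ) = Real.sqrt 4 by
      rw [show (4 : ℝ) = 2 ^ 2 by norm_num]; exact (Real.sqrt_sq (by norm_num)).symm,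
      ← Real.sqrt_mul (by norm_num), ← area_real_univ]
    exact Real.sqrt_le_sqrt (measureReal_mono (subset_univ _))
  rw [neckQ, capTransform, h1, abs_mul, abs_of_nonneg (by positivity)]
  have h3 := (abs_real_inner_le_norm (indicatorConstLp 2 hm hfin (1 : ℝ)) h).trans
    (mul_le_mul_of_nonneg_right h2 (norm_nonneg h))
  refine (mul_le_mul_of_nonneg_left h3 (by positivity)).trans ?_
  have hpi := Real.pi_pos
  have hs : Real.sqrt Real.pi ≤ Real.pi := by
    rw [Real.sqrt_le_left hpi.le]
    nlinarith [Real.pi_gt_three]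
  calc 1 / (2 * Real.pi) * (2 * Real.sqrt Real.pi * ‖h‖)
      ≤ 1 / (2 * Real.pi) * (2 * Real.pi * ‖h‖) := by gcongr
    _ = ‖h‖ := by field_simp

theorem abs_eigenQ_mul_evalPoly_le {k : ℕ} {P : MvPolynomial (Fin 3) ℝ} (hP : P ∈ harmonicPoly k)
    (u : S2) : |eigenQ k * evalPoly P u| ≤ ‖polyL2 P‖ := by
  have h : neckQ (polyL2 P) u = eigenQ k * evalPoly P u := by
    rw [← polyRestrict_apply, ← neckQ_polyRestrict hP, neckQ_congr (coeFn_polyL2 P)]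
    simp only [← polyRestrict_apply]
  rw [← h]
  exact abs_neckQ_le _ _

/-- `neckQ` maps `L²` boundedly into bounded functions and scales `P` by a nonzero number, so a sup
bound for `P` results from dividing by the eigenvalue. -/
theorem abs_evalPoly_le_of_odd {k : ℕ} (hk : Odd k) {P : MvPolynomial (Fin 3) ℝ}
    (hP : P ∈ harmonicPoly k) (u : S2) : |evalPoly P u| ≤ 2 * (k + 1) ^ 2 * ‖polyL2 P‖ := by
  have h := mul_le_mul (abs_eigenQ_inv_le hk) (abs_eigenQ_mul_evalPoly_le hP u) (abs_nonneg _)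
    (by positivity)
  rwa [← abs_mul, inv_mul_cancel_left₀ (eigenQ_ne_zero hk)] at h

theorem norm_polyL2_angMom_le {k : ℕ} {P : MvPolynomial (Fin 3) ℝ} (hP : P ∈ harmonicPoly k)
    (i : Fin 3) : ‖polyL2 (angMom i P)‖ ≤ (k + 1) * ‖polyL2 P‖ := by
  have h := sum_inner_angMom P hP
  simp only [real_inner_self_eq_norm_sq] at h
  have h1 : ‖polyL2 (angMom i P)‖ ^ 2 ≤ ∑ i, ‖polyL2 (angMom i P)‖ ^ 2 :=
    Finset.single_le_sum (f := fun i => ‖polyL2 (angMom i P)‖ ^ 2) (fun i _ => sq_nonneg _)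
      (Finset.mem_univ i)
  refine le_of_sq_le_sq ?_ (by positivity)
  rw [h] at h1
  refine h1.trans ?_
  rw [mul_pow]
  gcongr
  nlinarith [k.cast_nonneg (α := ℝ)]

theorem abs_coord_le_one (u : S2) (i : Fin 3) : |(u : E3) i| ≤ 1 := by
  have h := EuclideanSpace.norm_eq (u : E3) ▸ (by simp : ‖(u : E3)‖ = 1)
  simpa using PiLp.norm_apply_le (u : E3) i

theorem norm_polyL2_X_mul_le (i : Fin 3) (P : MvPolynomial (Fin 3) ℝ) :
    ‖polyL2 (MvPolynomial.X i * P)‖ ≤ ‖polyL2 P‖ := by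
  refine Lp.norm_le_norm_of_ae_le ?_
  filter_upwards [coeFn_polyL2 P, coeFn_polyL2 (MvPolynomial.X i * P)] with u h1 h2
  rw [h1, h2]
  have : evalPoly (MvPolynomial.X i * P) u = (u : E3) i * evalPoly P u := by simp [evalPoly]
  rw [this, norm_mul]
  exact mul_le_of_le_one_left (norm_nonneg _) (abs_coord_le_one u i)

/-- The vector identity `r²∇ = (x × ∇) × x + x E`, splitting the gradient into tangential and radial
parts. It bounds partial derivatives in `L²` by rotational derivatives and the degree. -/
theorem normSqPoly_mul_pderiv (i : Fin 3) (P : MvPolynomial (Fin 3) ℝ) :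
    normSqPoly * MvPolynomial.pderiv i P = MvPolynomial.X (i + 2) * angMom (i + 1) P -
      MvPolynomial.X (i + 1) * angMom (i + 2) P + MvPolynomial.X i * euler P := by
  simp only [normSqPoly, angMom_apply, euler_apply, Fin.sum_univ_three]
  fin_cases i <;> simp <;> ring

theorem polyL2_normSqPoly_mul (P : MvPolynomial (Fin 3) ℝ) :
    polyL2 (normSqPoly * P) = polyL2 P := by
  rw [polyL2_apply, polyL2_apply]
  congr 1
  ext u
  rw [map_mul, ContinuousMap.mul_apply, polyRestrict_apply, evalPoly_normSqPoly, one_mul]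

theorem norm_polyL2_pderiv_le {k : ℕ} {P : MvPolynomial (Fin 3) ℝ} (hP : P ∈ harmonicPoly k)
    (i : Fin 3) : ‖polyL2 (MvPolynomial.pderiv i P)‖ ≤ 3 * (k + 1) * ‖polyL2 P‖ := by
  rw [← polyL2_normSqPoly_mul, normSqPoly_mul_pderiv, map_add, map_sub]
  have h1 := (norm_polyL2_X_mul_le (i + 2) (angMom (i + 1) P)).trans (norm_polyL2_angMom_le hP _)
  have h2 := (norm_polyL2_X_mul_le (i + 1) (angMom (i + 2) P)).trans (norm_polyL2_angMom_le hP _)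
  have h3 := norm_polyL2_X_mul_le i (euler P)
  rw [euler_of_isHomogeneous (mem_harmonicPoly.1 hP).1, map_smul, norm_smul, Real.norm_natCast,
    ← euler_of_isHomogeneous (mem_harmonicPoly.1 hP).1] at h3
  refine (norm_add_le _ _).trans ?_
  have h4 := norm_sub_le (polyL2 (MvPolynomial.X (i + 2) * angMom (i + 1) P))
    (polyL2 (MvPolynomial.X (i + 1) * angMom (i + 2) P))
  nlinarith [norm_nonneg (polyL2 P)]

/-- In positive even degree the eigenvalue of `neckQ` is zero and gives nothing. But the partial
derivatives are harmonic of odd degree `k - 1`, and Euler's identity recovers `kP` from them; `18 =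
3 · 2 · 3` collects the three summands and the two constants. -/
theorem abs_evalPoly_le {k : ℕ} {P : MvPolynomial (Fin 3) ℝ} (hP : P ∈ harmonicPoly k) (u : S2) :
    |evalPoly P u| ≤ 18 * (k + 1) ^ 2 * ‖polyL2 P‖ := by
  have hn := norm_nonneg (polyL2 P)
  rcases Nat.even_or_odd k with hk | hk
  · rcases Nat.eq_zero_or_pos k with rfl | h0
    · have h := abs_eigenQ_mul_evalPoly_le hP u
      rw [eigenQ_zero, one_mul] at h
      push_cast
      linarith
    · have hodd : Odd (k - 1) := Nat.Even.sub_odd h0 hk odd_one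
      have hkc : ((k - 1 : ℕ) : ℝ) + 1 = k := by exact_mod_cast Nat.sub_add_cancel h0
      have h1 : ∀ i, |(u : E3) i * evalPoly (MvPolynomial.pderiv i P) u| ≤
          2 * k ^ 2 * (3 * (k + 1) * ‖polyL2 P‖) := by
        intro i
        rw [abs_mul]
        refine (mul_le_of_le_one_left (abs_nonneg _) (abs_coord_le_one u i)).trans ?_
        have h2 := abs_evalPoly_le_of_odd hodd (pderiv_mem_harmonicPoly hP i) u
        rw [hkc] at h2
        exact h2.trans (mul_le_mul_of_nonneg_left (norm_polyL2_pderiv_le hP i) (by positivity))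
      have h2 : (k : ℝ) * evalPoly P u =
          ∑ i, (u : E3) i * evalPoly (MvPolynomial.pderiv i P) u := by
        have h := congrArg (fun Q => evalPoly Q u)
          (euler_of_isHomogeneous (mem_harmonicPoly.1 hP).1)
        simpa [evalPoly, euler_apply] using h.symm
      have h3 : (k : ℝ) * |evalPoly P u| ≤ 3 * (2 * k ^ 2 * (3 * (k + 1) * ‖polyL2 P‖)) := by
        rw [← abs_of_nonneg (k.cast_nonneg (α := ℝ)), ← abs_mul, h2,
          abs_of_nonneg (k.cast_nonneg (α := ℝ))]
        refine (Finset.abs_sum_le_sum_abs _ _).trans ((Finset.sum_le_sum fun i _ => h1 i).trans ?_)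
        simp
      have hk0 : (0 : ℝ) < k := by exact_mod_cast h0
      have h4 : |evalPoly P u| ≤ 18 * (k * (k + 1)) * ‖polyL2 P‖ := by
        refine le_of_mul_le_mul_left (h3.trans (le_of_eq ?_)) hk0
        ring
      refine h4.trans ?_
      gcongr
      nlinarith
  · refine (abs_evalPoly_le_of_odd hk hP u).trans ?_
    gcongr
    norm_num

/-! ### Rapidly convergent series of spherical harmonics -/

/-- A sequence of harmonic polynomials, one in each degree, with rapidly decreasing norms. -/
structure IsRapid (P : ℕ → MvPolynomial (Fin 3) ℝ) : Prop where
  mem : ∀ k, P k ∈ harmonicPoly k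
  decay : ∀ N : ℕ, ∃ C : ℝ, ∀ k : ℕ, (k + 1 : ℝ) ^ N * ‖polyL2 (P k)‖ ≤ C

theorem IsRapid.map_angMom {P : ℕ → MvPolynomial (Fin 3) ℝ} (hP : IsRapid P) (i : Fin 3) :
    IsRapid fun k => angMom i (P k) := by
  refine ⟨fun k => angMom_mem_harmonicPoly (hP.mem k) i, fun N => ?_⟩
  obtain ⟨C, hC⟩ := hP.decay (N + 1)
  refine ⟨C, fun k => le_trans ?_ (hC k)⟩
  rw [pow_succ, mul_assoc]
  exact mul_le_mul_of_nonneg_left (norm_polyL2_angMom_le (hP.mem k) i) (by positivity)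

theorem IsRapid.smul {P : ℕ → MvPolynomial (Fin 3) ℝ} (hP : IsRapid P) {τ : ℕ → ℝ}
    (hτ : ∀ k : ℕ, |τ k| ≤ 2 * (k + 1) ^ 2) : IsRapid fun k => τ k • P k := by
  refine ⟨fun k => Submodule.smul_mem _ _ (hP.mem k), fun N => ?_⟩
  obtain ⟨C, hC⟩ := hP.decay (N + 2)
  refine ⟨2 * C, fun k => le_trans ?_ (mul_le_mul_of_nonneg_left (hC k) (by norm_num))⟩
  rw [map_smul, norm_smul, Real.norm_eq_abs]
  calc (k + 1 : ℝ) ^ N * (|τ k| * ‖polyL2 (P k)‖)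
      ≤ (k + 1 : ℝ) ^ N * ((2 * (k + 1) ^ 2) * ‖polyL2 (P k)‖) := by gcongr; exact hτ k
    _ = _ := by ring

theorem IsRapid.exists_summable_bound {P : ℕ → MvPolynomial (Fin 3) ℝ} (hP : IsRapid P) :
    ∃ v : ℕ → ℝ, Summable v ∧ ∀ k, ∀ u : S2, |evalPoly (P k) u| ≤ v k := by
  -- Two of the four powers pay for the sup bound; the other two leave the summable `(k+1)⁻²`.
  obtain ⟨C, hC⟩ := hP.decay 4
  refine ⟨fun k => 18 * C * (1 / ((k + 1 : ℕ) : ℝ) ^ 2), ?_, fun k u => ?_⟩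
  · exact ((summable_nat_add_iff 1).2 (Real.summable_one_div_nat_pow.2 one_lt_two)).mul_left _
  · refine (abs_evalPoly_le (hP.mem k) u).trans ?_
    push_cast
    rw [mul_one_div, le_div_iff₀ (by positivity)]
    have := hC k
    nlinarith

/-- The sum of a series of polynomials on the sphere. -/
def series (P : ℕ → MvPolynomial (Fin 3) ℝ) (u : S2) : ℝ := ∑' k, evalPoly (P k) u

theorem IsRapid.hasSum {P : ℕ → MvPolynomial (Fin 3) ℝ} (hP : IsRapid P) (u : S2) :
    HasSum (fun k => evalPoly (P k) u) (series P u) := by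
  obtain ⟨v, hv, hb⟩ := hP.exists_summable_bound
  exact (Summable.of_norm_bounded hv fun k => hb k u).hasSum

/-- The gradient at `x`, as a linear form, of the degree-zero homogeneous extension of a function
whose derivatives along the rotation fields are `g`. -/
def radialGrad (x : E3) (g : Fin 3 → ℝ) : E3 →L[ℝ] ℝ :=
  ∑ i : Fin 3, ((‖x‖ ^ 2)⁻¹ * (x (i + 2) * g (i + 1) - x (i + 1) * g (i + 2))) •
    (EuclideanSpace.proj i : E3 →L[ℝ] ℝ)

theorem eventually_coe_sphereProj {x : E3} (hx : x ≠ 0) :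
    (fun z : E3 => (sphereProj z : E3)) =ᶠ[nhds x] fun z => ‖z‖⁻¹ • z := by
  filter_upwards [isOpen_compl_singleton.mem_nhds hx] with z hz
  exact coe_sphereProj hz

/-- A degree-zero extension has no radial derivative, so its gradient is `r⁻²(x × ∇) × x`. Only
rotational derivatives enter, and these map harmonics of degree `k` to harmonics of degree `k`. -/
theorem hasFDerivAt_evalPoly_sphereProj (P : MvPolynomial (Fin 3) ℝ) {x : E3} (hx : x ≠ 0) :
    HasFDerivAt (fun x => evalPoly P (sphereProj x))
      (radialGrad x fun j => evalPoly (angMom j P) (sphereProj x)) x := by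
  have hn : 0 < ‖x‖ := norm_pos_iff.2 hx
  have h1 : HasFDerivAt (fun z : E3 => ‖z‖⁻¹) (-(‖x‖ ^ 3)⁻¹ • innerSL ℝ x) x := by
    have h2 : HasFDerivAt (fun z : E3 => ‖z‖ ^ 2) (2 • innerSL ℝ x) x :=
      (hasStrictFDerivAt_norm_sq x).hasFDerivAt
    have h3 := (hasDerivAt_inv (Real.sqrt_pos.2 (by positivity : 0 < ‖x‖ ^ 2)).ne').comp_hasFDerivAt
      x (h2.sqrt (by positivity))
    simp only [Function.comp_def, Real.sqrt_sq (norm_nonneg _)] at h3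
    refine h3.congr_fderiv ?_
    ext v
    simp
    field_simp
  have h5 : HasFDerivAt (fun z : E3 => ‖z‖⁻¹ • z) _ x := h1.fun_smul (hasFDerivAt_id x)
  have h4 := (HasFDerivAt.comp (f := fun z : E3 => ‖z‖⁻¹ • z) x
    (hasFDerivAt_evalPoly P (‖x‖⁻¹ • x)) h5).congr_of_eventuallyEq
    (f₁ := fun x => evalPoly P (sphereProj x))
    ((eventually_coe_sphereProj hx).fun_comp (evalPoly P))
  refine h4.congr_fderiv ?_
  have hx2 : ‖x‖ ^ 2 = x 0 ^ 2 + x 1 ^ 2 + x 2 ^ 2 := by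
    rw [EuclideanSpace.norm_sq_eq]; simp [Fin.sum_univ_three]
  rw [coe_sphereProj hx]
  ext v
  have hL : ∀ j, evalPoly (angMom j P) (‖x‖⁻¹ • x) =
      ‖x‖⁻¹ * (x (j + 1) * evalPoly (MvPolynomial.pderiv (j + 2) P) (‖x‖⁻¹ • x) -
        x (j + 2) * evalPoly (MvPolynomial.pderiv (j + 1) P) (‖x‖⁻¹ • x)) := by
    intro j
    rw [angMom_apply]
    simp only [evalPoly, map_sub, map_mul, MvPolynomial.eval_X, PiLp.smul_apply, smul_eq_mul]
    ring
  simp only [hL]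
  generalize hg : (fun i => evalPoly (MvPolynomial.pderiv i P) (‖x‖⁻¹ • x)) = g
  have hg' : ∀ i, evalPoly (MvPolynomial.pderiv i P) (‖x‖⁻¹ • x) = g i := fun i => congrFun hg i
  simp only [hg']
  simp [radialGrad, Fin.sum_univ_three, PiLp.inner_apply]
  field_simp
  rw [hx2]
  ring

theorem norm_radialGrad_le {x : E3} {r : ℝ} (hr : 0 < r) (hx : r ≤ ‖x‖) {g : Fin 3 → ℝ} {c : ℝ}
    (hg : ∀ j, |g j| ≤ c) : ‖radialGrad x g‖ ≤ 6 * r⁻¹ * c := by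
  have hn : 0 < ‖x‖ := hr.trans_le hx
  have hc : 0 ≤ c := (abs_nonneg _).trans (hg 0)
  have hproj : ∀ i, ‖(EuclideanSpace.proj i : E3 →L[ℝ] ℝ)‖ ≤ 1 := fun i =>
    ContinuousLinearMap.opNorm_le_bound _ zero_le_one fun z => by
      simpa using PiLp.norm_apply_le z i
  have hterm : ∀ i : Fin 3, ‖((‖x‖ ^ 2)⁻¹ * (x (i + 2) * g (i + 1) - x (i + 1) * g (i + 2))) •
      (EuclideanSpace.proj i : E3 →L[ℝ] ℝ)‖ ≤ 2 * r⁻¹ * c := by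
    intro i
    rw [norm_smul]
    refine (mul_le_of_le_one_right (norm_nonneg _) (hproj i)).trans ?_
    rw [norm_mul, norm_inv, norm_pow, norm_norm]
    have h1 : ‖x (i + 2) * g (i + 1) - x (i + 1) * g (i + 2)‖ ≤ 2 * ‖x‖ * c := by
      refine (norm_sub_le _ _).trans ?_
      rw [norm_mul, norm_mul]
      have h2 := mul_le_mul (PiLp.norm_apply_le x (i + 2)) (hg (i + 1)) (abs_nonneg _) hn.le
      have h3 := mul_le_mul (PiLp.norm_apply_le x (i + 1)) (hg (i + 2)) (abs_nonneg _) hn.le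
      simp only [← Real.norm_eq_abs] at h2 h3
      linarith
    calc (‖x‖ ^ 2)⁻¹ * ‖x (i + 2) * g (i + 1) - x (i + 1) * g (i + 2)‖
        ≤ (‖x‖ ^ 2)⁻¹ * (2 * ‖x‖ * c) := by gcongr
      _ = 2 * ‖x‖⁻¹ * c := by field_simp
      _ ≤ 2 * r⁻¹ * c := by gcongr
  refine (norm_sum_le _ _).trans ((Finset.sum_le_sum fun i _ => hterm i).trans ?_)
  simp
  linarith

theorem hasSum_radialGrad (x : E3) {g : ℕ → Fin 3 → ℝ} {G : Fin 3 → ℝ}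
    (hg : ∀ j, HasSum (fun k => g k j) (G j)) :
    HasSum (fun k => radialGrad x (g k)) (radialGrad x G) := by
  have h : ∀ i : Fin 3, HasSum
      (fun k => (‖x‖ ^ 2)⁻¹ * (x (i + 2) * g k (i + 1) - x (i + 1) * g k (i + 2)))
      ((‖x‖ ^ 2)⁻¹ * (x (i + 2) * G (i + 1) - x (i + 1) * G (i + 2))) := fun i =>
    (((hg (i + 1)).mul_left (x (i + 2))).sub ((hg (i + 2)).mul_left (x (i + 1)))).mul_left _
  exact hasSum_sum fun i _ => (h i).smul_const (EuclideanSpace.proj i : E3 →L[ℝ] ℝ)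

/-- Termwise differentiation on the ball of radius `‖x‖ / 2` about `x`: it stays away from the
origin, so the factor `‖z‖⁻¹` in the gradients is uniformly bounded there. -/
theorem IsRapid.hasFDerivAt_series {P : ℕ → MvPolynomial (Fin 3) ℝ} (hP : IsRapid P) {x : E3}
    (hx : x ≠ 0) : HasFDerivAt (fun x => series P (sphereProj x))
      (radialGrad x fun j => series (fun k => angMom j (P k)) (sphereProj x)) x := by
  have hn : 0 < ‖x‖ := norm_pos_iff.2 hx
  choose v hv hb using fun j => (hP.map_angMom j).exists_summable_bound
  have hv' : Summable fun k => 6 * (‖x‖ / 2)⁻¹ * ∑ j, v j k :=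
    (summable_sum fun j _ => hv j).mul_left _
  have hle : ∀ k (u : S2) j, |evalPoly (angMom j (P k)) u| ≤ ∑ j, v j k := fun k u j =>
    (hb j k u).trans (Finset.single_le_sum (f := fun j => v j k)
      (fun i _ => (abs_nonneg _).trans (hb i k u)) (Finset.mem_univ j))
  have hball : ∀ z ∈ Metric.ball x (‖x‖ / 2), ‖x‖ / 2 ≤ ‖z‖ := by
    intro z hz
    rw [Metric.mem_ball, dist_eq_norm'] at hz
    have := norm_sub_norm_le x z
    linarith
  have hne : ∀ z ∈ Metric.ball x (‖x‖ / 2), z ≠ 0 := fun z hz =>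
    norm_pos_iff.1 (lt_of_lt_of_le (by positivity) (hball z hz))
  have key : HasFDerivAt (fun z => ∑' k, evalPoly (P k) (sphereProj z))
      (∑' k, radialGrad x fun j => evalPoly (angMom j (P k)) (sphereProj x)) x :=
    hasFDerivAt_tsum_of_isPreconnected (f := fun k z => evalPoly (P k) (sphereProj z))
      (f' := fun k z => radialGrad z fun j => evalPoly (angMom j (P k)) (sphereProj z))
      hv' Metric.isOpen_ball (convex_ball x (‖x‖ / 2)).isPreconnected
      (fun k z hz => hasFDerivAt_evalPoly_sphereProj (P k) (hne z hz))
      (fun k z hz => norm_radialGrad_le (half_pos hn) (hball z hz) (hle k (sphereProj z)))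
      (Metric.mem_ball_self (half_pos hn)) (hP.hasSum _).summable
      (Metric.mem_ball_self (half_pos hn))
  exact key.congr_fderiv (hasSum_radialGrad x fun j => (hP.map_angMom j).hasSum _).tsum_eq

/-- The derivative is built from smooth coefficients and the series of `angMom j (P k)`, again
rapid. Hence the induction on `n` quantifies over all rapid sequences. -/
theorem IsRapid.contDiffOn_series (n : ℕ) : ∀ {P : ℕ → MvPolynomial (Fin 3) ℝ}, IsRapid P →
    ContDiffOn ℝ n (fun x => series P (sphereProj x)) {0}ᶜ := by
  induction n with
  | zero =>
    intro P hP
    rw [Nat.cast_zero, contDiffOn_zero]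
    exact fun x hx => (hP.hasFDerivAt_series hx).continuousAt.continuousWithinAt
  | succ n ih =>
    intro P hP
    rw [Nat.cast_succ, contDiffOn_succ_iff_fderiv_of_isOpen isOpen_compl_singleton]
    refine ⟨fun x hx => (hP.hasFDerivAt_series hx).differentiableAt.differentiableWithinAt,
      by simp, ?_⟩
    have h : ContDiffOn ℝ n (fun x : E3 => radialGrad x fun j =>
        series (fun k => angMom j (P k)) (sphereProj x)) {0}ᶜ := by
      refine ContDiffOn.sum fun i _ => ContDiffOn.fun_smul (ContDiffOn.mul ?_ ?_) contDiffOn_const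
      · exact ((contDiff_norm_sq ℝ).contDiffOn).inv fun x hx => by
          have := norm_pos_iff.2 (hx : x ≠ 0)
          positivity
      · refine ContDiffOn.sub (ContDiffOn.mul ?_ (ih (hP.map_angMom _)))
          (ContDiffOn.mul ?_ (ih (hP.map_angMom _)))
        · exact (EuclideanSpace.proj (i + 2) : E3 →L[ℝ] ℝ).contDiff.contDiffOn
        · exact (EuclideanSpace.proj (i + 1) : E3 →L[ℝ] ℝ).contDiff.contDiffOn
    exact h.congr fun x hx => (hP.hasFDerivAt_series hx).fderiv

/-! ### Smooth functions on the sphere -/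

theorem mem_smoothFun_of_contDiffOn {F : E3 → ℝ} (hF : ContDiffOn ℝ ∞ F {0}ᶜ) :
    (fun u : S2 => F u) ∈ smoothFun :=
  (contMDiffOn_iff_contDiffOn.2 hF).comp_contMDiff (contMDiff_coe_sphere (n := 2))
    fun u => coe_ne_zero u

theorem contDiffOn_of_mem_smoothFun {h : S2 → ℝ} (hh : h ∈ smoothFun) :
    ContDiffOn ℝ ∞ (fun x => h (sphereProj x)) {0}ᶜ := by
  let U : TopologicalSpace.Opens E3 := ⟨{0}ᶜ, isOpen_compl_singleton⟩
  have h1 : ContMDiff 𝓘(ℝ, E3) 𝓘(ℝ, E3) ∞ fun x : U => ‖(x : E3)‖⁻¹ • (x : E3) := by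
    intro x
    have hx : (x : E3) ≠ 0 := x.2
    refine (contMDiffAt_subtype_iff (U := U) (f := fun x : E3 => ‖x‖⁻¹ • x)).2 ?_
    exact contMDiffAt_iff_contDiffAt.2
      (((contDiffAt_norm ℝ hx).inv (norm_ne_zero_iff.2 hx)).smul contDiffAt_id)
  have h2 : ContMDiff 𝓘(ℝ, E3) (𝓡 2) ∞ fun x : U => sphereProj x := by
    refine (h1.codRestrict_sphere (n := 2) fun x => ?_).congr fun x => ?_
    · have hx : (x : E3) ≠ 0 := x.2
      simp [norm_smul, norm_ne_zero_iff.2 hx]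
    · exact Subtype.ext (coe_sphereProj x.2)
  have h3 : ContMDiff 𝓘(ℝ, E3) 𝓘(ℝ, ℝ) ∞ fun x : U => h (sphereProj x) :=
    ContMDiff.comp (I' := 𝓡 2) hh h2
  intro x hx
  have h4 := (contMDiffAt_subtype_iff (U := U) (f := fun x : E3 => h (sphereProj x))
    (x := ⟨x, hx⟩)).1 (h3 ⟨x, hx⟩)
  exact (contMDiffAt_iff_contDiffAt.1 h4).contDiffWithinAt

theorem IsRapid.series_mem_smoothFun {P : ℕ → MvPolynomial (Fin 3) ℝ} (hP : IsRapid P) :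
    series P ∈ smoothFun := by
  have h := mem_smoothFun_of_contDiffOn
    (contDiffOn_infty.2 fun n => IsRapid.contDiffOn_series n hP)
  simpa only [sphereProj_coe] using h

theorem continuous_of_mem_smoothFun {h : S2 → ℝ} (hh : h ∈ smoothFun) : Continuous h :=
  ContMDiff.continuous hh

/-! ### Expansion of smooth functions -/

/-- The class in `L²` of a continuous function. -/
def contL2 (h : C(S2, ℝ)) : L2 := ContinuousMap.toLp (E := ℝ) 2 area ℝ h

theorem inner_polyL2_contL2 (P : MvPolynomial (Fin 3) ℝ) (h : C(S2, ℝ)) :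
    inner ℝ (polyL2 P) (contL2 h) = ∫ u : S2, h u * evalPoly P u ∂area := by
  rw [inner_polyL2_left]
  refine integral_congr_ae ?_
  filter_upwards [ContinuousMap.coeFn_toLp (p := 2) area (𝕜 := ℝ) h] with u hu
  rw [contL2, hu]

theorem contL2_injective : Function.Injective contL2 :=
  ContinuousMap.toLp_injective area

/-- The derivative of a function on the sphere along a rotation field. -/
def rotDeriv (i : Fin 3) (h : S2 → ℝ) (u : S2) : ℝ :=
  fderiv ℝ (fun x => h (sphereProj x)) u (rotField i u)

theorem rotDeriv_mem_smoothFun (i : Fin 3) {h : S2 → ℝ} (hh : h ∈ smoothFun) :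
    rotDeriv i h ∈ smoothFun := by
  have hF := contDiffOn_of_mem_smoothFun hh
  have hr : ContDiff ℝ ∞ (rotField i) := by
    refine ContDiff.sub (ContDiff.fun_smul ?_ contDiff_const) (ContDiff.fun_smul ?_ contDiff_const)
    · exact (EuclideanSpace.proj (i + 1) : E3 →L[ℝ] ℝ).contDiff
    · exact (EuclideanSpace.proj (i + 2) : E3 →L[ℝ] ℝ).contDiff
  exact mem_smoothFun_of_contDiffOn
    ((hF.fderiv_of_isOpen isOpen_compl_singleton (by simp)).clm_apply hr.contDiffOn)

theorem integral_rotDeriv_mul (i : Fin 3) {h : S2 → ℝ} (hh : h ∈ smoothFun)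
    (P : MvPolynomial (Fin 3) ℝ) :
    ∫ u, rotDeriv i h u * evalPoly P u ∂area = -∫ u, h u * evalPoly (angMom i P) u ∂area := by
  have h1 := integral_fderiv_rotField_mul ((contDiffOn_of_mem_smoothFun hh).of_le (by simp)) i P
  simpa only [rotDeriv, sphereProj_coe] using h1

theorem smoothFun_add {f g : S2 → ℝ} (hf : f ∈ smoothFun) (hg : g ∈ smoothFun) :
    (fun u => f u + g u) ∈ smoothFun := ContMDiff.add hf hg

theorem smoothFun_sub {f g : S2 → ℝ} (hf : f ∈ smoothFun) (hg : g ∈ smoothFun) :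
    (fun u => f u - g u) ∈ smoothFun := ContMDiff.sub hf hg

/-- The operator `1 - Δ` on functions on the sphere. -/
def oneSubLaplacian (h : S2 → ℝ) (u : S2) : ℝ :=
  h u - (rotDeriv 0 (rotDeriv 0 h) u + rotDeriv 1 (rotDeriv 1 h) u + rotDeriv 2 (rotDeriv 2 h) u)

theorem oneSubLaplacian_mem_smoothFun {h : S2 → ℝ} (hh : h ∈ smoothFun) :
    oneSubLaplacian h ∈ smoothFun :=
  smoothFun_sub hh (smoothFun_add (smoothFun_add
    (rotDeriv_mem_smoothFun 0 (rotDeriv_mem_smoothFun 0 hh))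
    (rotDeriv_mem_smoothFun 1 (rotDeriv_mem_smoothFun 1 hh)))
    (rotDeriv_mem_smoothFun 2 (rotDeriv_mem_smoothFun 2 hh)))

theorem integrable_of_continuous {f : S2 → ℝ} (hf : Continuous f) : Integrable f area :=
  hf.integrable_of_hasCompactSupport (HasCompactSupport.of_compactSpace _)

theorem continuous_evalPoly_coe (P : MvPolynomial (Fin 3) ℝ) :
    Continuous fun u : S2 => evalPoly P u :=
  (continuous_evalPoly P).comp continuous_subtype_val

/-- Integrating by parts twice moves `1 - Δ` onto `P`, where it is the scalar `1 + k(k+1)`. -/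
theorem integral_oneSubLaplacian_mul {h : S2 → ℝ} (hh : h ∈ smoothFun) {k : ℕ}
    {P : MvPolynomial (Fin 3) ℝ} (hP : P ∈ harmonicPoly k) :
    ∫ u, oneSubLaplacian h u * evalPoly P u ∂area =
      (1 + k * (k + 1) : ℝ) * ∫ u, h u * evalPoly P u ∂area := by
  have hi : ∀ {f : S2 → ℝ}, f ∈ smoothFun → ∀ Q : MvPolynomial (Fin 3) ℝ,
      Integrable (fun u : S2 => f u * evalPoly Q u) area := fun hf Q =>
    integrable_of_continuous ((continuous_of_mem_smoothFun hf).mul (continuous_evalPoly_coe Q))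
  have hd : ∀ i, ∫ u, rotDeriv i (rotDeriv i h) u * evalPoly P u ∂area =
      ∫ u, h u * evalPoly (angMom i (angMom i P)) u ∂area := fun i => by
    rw [integral_rotDeriv_mul i (rotDeriv_mem_smoothFun i hh), integral_rotDeriv_mul i hh, neg_neg]
  have h2 := fun i => rotDeriv_mem_smoothFun i (rotDeriv_mem_smoothFun i hh)
  have ha : ∀ {f g : S2 → ℝ}, Integrable f area → Integrable g area →
      Integrable (fun u => f u + g u) area := fun hf hg => hf.add hg
  have hpt : ∀ u : S2, oneSubLaplacian h u * evalPoly P u = h u * evalPoly P u -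
      (rotDeriv 0 (rotDeriv 0 h) u * evalPoly P u + rotDeriv 1 (rotDeriv 1 h) u * evalPoly P u +
        rotDeriv 2 (rotDeriv 2 h) u * evalPoly P u) := fun u => by
    rw [oneSubLaplacian, sub_mul, add_mul, add_mul]
  simp only [hpt]
  rw [integral_sub (hi hh P) (ha (ha (hi (h2 0) P) (hi (h2 1) P)) (hi (h2 2) P)),
    integral_add (ha (hi (h2 0) P) (hi (h2 1) P)) (hi (h2 2) P),
    integral_add (hi (h2 0) P) (hi (h2 1) P), hd, hd, hd,
    ← integral_add (hi hh _) (hi hh _),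
    ← integral_add (ha (hi hh _) (hi hh _)) (hi hh _)]
  have h3 := fun u : S2 => congrArg (fun Q => evalPoly Q u) (sum_angMom_sq_of_harmonic hP)
  simp only [evalPoly, Fin.sum_univ_three, map_add, MvPolynomial.smul_eval] at h3
  have h4 : ∀ u : S2, h u * evalPoly (angMom 0 (angMom 0 P)) u +
      h u * evalPoly (angMom 1 (angMom 1 P)) u + h u * evalPoly (angMom 2 (angMom 2 P)) u =
      -(k * (k + 1) : ℝ) * (h u * evalPoly P u) := by
    intro u
    simp only [evalPoly]
    linear_combination h u * h3 u
  simp only [h4, integral_const_mul]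
  ring

theorem starProjection_oneSubLaplacian {h g : C(S2, ℝ)} (hh : (h : S2 → ℝ) ∈ smoothFun)
    (hg : ∀ u, g u = oneSubLaplacian h u) (k : ℕ) :
    (harmonics k).starProjection (contL2 g) =
      (1 + k * (k + 1) : ℝ) • (harmonics k).starProjection (contL2 h) := by
  refine Submodule.eq_starProjection_of_mem_of_inner_eq_zero
    (Submodule.smul_mem _ _ (Submodule.starProjection_apply_mem _ _)) fun v hv => ?_
  obtain ⟨P, hP, rfl⟩ := mem_harmonics.1 hv
  have h1 := Submodule.starProjection_inner_eq_zero (K := harmonics k) (contL2 h) _ hv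
  rw [inner_sub_left, sub_eq_zero, real_inner_comm, inner_polyL2_contL2] at h1
  rw [inner_sub_left, inner_smul_left, ← h1, real_inner_comm, inner_polyL2_contL2]
  simp only [hg, integral_oneSubLaplacian_mul hh hP]
  simp

/-- Replacing `h` by `(1 - Δ)h` multiplies the component of degree `k` by `1 + k(k+1) ≥ k + 1`,
which buys one more power of `k + 1` per step. -/
theorem exists_bound_starProjection (N : ℕ) : ∀ h : C(S2, ℝ), (h : S2 → ℝ) ∈ smoothFun →
    ∃ C : ℝ, ∀ k : ℕ, (k + 1 : ℝ) ^ N * ‖(harmonics k).starProjection (contL2 h)‖ ≤ C := by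
  induction N with
  | zero =>
    intro h _
    exact ⟨‖contL2 h‖, fun k => by
      simpa using Submodule.norm_starProjection_apply_le (harmonics k) (contL2 h)⟩
  | succ N ih =>
    intro h hh
    have hs := oneSubLaplacian_mem_smoothFun hh
    obtain ⟨C, hC⟩ := ih ⟨oneSubLaplacian h, continuous_of_mem_smoothFun hs⟩ hs
    refine ⟨C, fun k => le_trans ?_ (hC k)⟩
    rw [starProjection_oneSubLaplacian (h := h)
      (g := ⟨oneSubLaplacian h, continuous_of_mem_smoothFun hs⟩) hh (fun u => rfl), norm_smul, pow_succ, mul_assoc]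
    have hk : (0 : ℝ) ≤ k := k.cast_nonneg
    gcongr
    rw [Real.norm_of_nonneg (by positivity)]
    nlinarith

theorem IsRapid.hasSum_polyL2 {P : ℕ → MvPolynomial (Fin 3) ℝ} (hP : IsRapid P) {h : C(S2, ℝ)}
    (hh : ∀ u, h u = series P u) : HasSum (fun k => polyL2 (P k)) (contL2 h) := by
  obtain ⟨v, hv, hb⟩ := hP.exists_summable_bound
  have hs : Summable fun k => polyRestrict (P k) :=
    Summable.of_norm_bounded hv fun k => (ContinuousMap.norm_le _
      ((abs_nonneg _).trans (hb k (sphereProj 0)))).2 fun u => by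
        rw [polyRestrict_apply]; exact hb k u
  have h1 : ∑' k, polyRestrict (P k) = h := by
    ext u
    rw [hh, ← ContinuousMap.tsum_apply hs]
    simp only [polyRestrict_apply, series]
  rw [← h1]
  exact hs.hasSum.mapL (ContinuousMap.toLp (E := ℝ) 2 area ℝ)

/-- The projections of `h` form a rapid sequence, whose pointwise sum is continuous and has the same
`L²` class as `h`; continuous functions with equal classes coincide. -/
theorem exists_isRapid_of_mem_smoothFun {h : S2 → ℝ} (hh : h ∈ smoothFun) :
    ∃ P, IsRapid P ∧ h = series P := by
  let hc : C(S2, ℝ) := ⟨h, continuous_of_mem_smoothFun hh⟩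
  choose P hP hPe using fun k => mem_harmonics.1
    (Submodule.starProjection_apply_mem (harmonics k) (contL2 hc))
  have hr : IsRapid P := ⟨hP, fun N => by
    obtain ⟨C, hC⟩ := exists_bound_starProjection N hc hh
    exact ⟨C, fun k => by rw [hPe]; exact hC k⟩⟩
  refine ⟨P, hr, ?_⟩
  let g : C(S2, ℝ) := ⟨series P, continuous_of_mem_smoothFun hr.series_mem_smoothFun⟩
  have h1 := hr.hasSum_polyL2 (h := g) fun u => rfl
  simp only [hPe] at h1
  have h2 := contL2_injective ((hasSum_starProjection (contL2 hc)).unique h1)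
  exact congrArg (fun f : C(S2, ℝ) => (f : S2 → ℝ)) h2

theorem polyL2_eq_zero_iff {P : MvPolynomial (Fin 3) ℝ} :
    polyL2 P = 0 ↔ ∀ u : S2, evalPoly P u = 0 := by
  rw [polyL2_apply, map_eq_zero_iff _ (ContinuousMap.toLp_injective area), ContinuousMap.ext_iff]
  simp only [polyRestrict_apply, ContinuousMap.zero_apply]

theorem IsRapid.evalPoly_eq_zero {P : ℕ → MvPolynomial (Fin 3) ℝ} (hP : IsRapid P)
    (h : series P = 0) (k : ℕ) (u : S2) : evalPoly (P k) u = 0 := by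
  have h1 := hP.hasSum_polyL2 (h := 0) fun u => by rw [h]; rfl
  have h2 := starProjection_of_hasSum (fun k => polyL2_mem_harmonics (hP.mem k)) h1 k
  rw [contL2, map_zero, map_zero] at h2
  exact polyL2_eq_zero_iff.1 h2.symm u

theorem evalPoly_smul_poly (c : ℝ) (P : MvPolynomial (Fin 3) ℝ) (x : E3) :
    evalPoly (c • P) x = c * evalPoly P x := by simp [evalPoly]

/-! ### Multipliers on smooth functions -/

/-- Smooth functions whose spherical harmonics expansion only involves degrees in `A`. -/
def smoothSpec (A : Set ℕ) : Set (S2 → ℝ) :=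
  {h | ∃ P, IsRapid P ∧ h = series P ∧ ∀ k ∉ A, ∀ u : S2, evalPoly (P k) u = 0}

/-- `T` acts on series of spherical harmonics as the multiplier `τ`. -/
def IsMultiplier (T : (S2 → ℝ) → S2 → ℝ) (τ : ℕ → ℝ) : Prop :=
  ∀ P, IsRapid P → ∀ u, T (series P) u = series (fun k => τ k • P k) u

theorem abs_ite_le {τ : ℕ → ℝ} {B : Set ℕ} [DecidablePred (· ∈ B)]
    (hτ : ∀ k ∈ B, |τ k| ≤ 2 * (k + 1) ^ 2) (k : ℕ) :
    |if k ∈ B then τ k else 0| ≤ 2 * (k + 1) ^ 2 := by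
  split_ifs with h
  · exact hτ k h
  · rw [abs_zero]; positivity

/-- Injectivity is uniqueness of the components in `L²`. For surjectivity the preimage has
multiplier `τ⁻¹` on `B` and `0` elsewhere, whose polynomial growth keeps the sequence rapid. -/
theorem IsMultiplier.bijOn {T : (S2 → ℝ) → S2 → ℝ} {τ : ℕ → ℝ} (hT : IsMultiplier T τ)
    (hτ : ∀ k : ℕ, |τ k| ≤ 2 * (k + 1) ^ 2) {B : Set ℕ} (h0 : ∀ k ∈ B, τ k ≠ 0)
    (hinv : ∀ k ∈ B, |(τ k)⁻¹| ≤ 2 * ((k : ℝ) + 1) ^ 2) :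
    BijOn T (smoothSpec B) (smoothSpec B) := by
  classical
  refine ⟨?_, ?_, ?_⟩
  · rintro _ ⟨P, hP, rfl, hB⟩
    refine ⟨fun k => τ k • P k, hP.smul hτ, funext fun u => hT P hP u, fun k hk u => ?_⟩
    rw [evalPoly_smul_poly, hB k hk, mul_zero]
  · rintro _ ⟨P, hP, rfl, hPB⟩ _ ⟨R, hR, rfl, hRB⟩ hPR
    have key : ∀ k (u : S2), evalPoly (τ k • P k) u = evalPoly (τ k • R k) u := by
      have e1 := (hP.smul hτ).hasSum_polyL2
        (h := ⟨_, continuous_of_mem_smoothFun (hP.smul hτ).series_mem_smoothFun⟩) fun u => rfl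
      have e2 := (hR.smul hτ).hasSum_polyL2
        (h := ⟨_, continuous_of_mem_smoothFun (hP.smul hτ).series_mem_smoothFun⟩) fun u => by
          change series (fun k => τ k • P k) u = _
          rw [← hT P hP, ← hT R hR, hPR]
      intro k u
      have e3 := starProjection_of_hasSum
        (fun k => polyL2_mem_harmonics ((hP.smul hτ).mem k)) e1 k
      rw [starProjection_of_hasSum (fun k => polyL2_mem_harmonics ((hR.smul hτ).mem k)) e2 k] at e3
      have e4 := ContinuousMap.toLp_injective area e3
      rw [← polyRestrict_apply, ← polyRestrict_apply]
      exact (DFunLike.congr_fun e4 u).symm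
    funext u
    refine tsum_congr fun k => ?_
    by_cases hk : k ∈ B
    · have h1 := key k u
      rw [evalPoly_smul_poly, evalPoly_smul_poly] at h1
      exact mul_left_cancel₀ (h0 k hk) h1
    · rw [hPB k hk, hRB k hk]
  · rintro _ ⟨P, hP, rfl, hPB⟩
    have hs := hP.smul (τ := fun k => if k ∈ B then (τ k)⁻¹ else 0) (abs_ite_le hinv)
    refine ⟨_, ⟨_, hs, rfl, fun k hk u => ?_⟩, ?_⟩
    · simp [hk, evalPoly]
    · funext u
      rw [hT _ hs]
      refine tsum_congr fun k => ?_
      rw [evalPoly_smul_poly, evalPoly_smul_poly]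
      by_cases hk : k ∈ B
      · rw [if_pos hk, mul_inv_cancel_left₀ (h0 k hk)]
      · rw [hPB k hk, mul_zero, mul_zero]

theorem IsMultiplier.ker {T : (S2 → ℝ) → S2 → ℝ} {τ : ℕ → ℝ} (hT : IsMultiplier T τ)
    (hτ : ∀ k : ℕ, |τ k| ≤ 2 * (k + 1) ^ 2) :
    {h ∈ smoothFun | T h = 0} = smoothSpec {k | τ k = 0} := by
  ext h
  constructor
  · rintro ⟨hh, h0⟩
    obtain ⟨P, hP, rfl⟩ := exists_isRapid_of_mem_smoothFun hh
    refine ⟨P, hP, rfl, fun k hk u => ?_⟩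
    have h1 := (hP.smul hτ).evalPoly_eq_zero (funext fun u => by rw [← hT P hP, h0]) k u
    rw [evalPoly_smul_poly] at h1
    exact (mul_eq_zero.1 h1).resolve_left hk
  · rintro ⟨P, hP, rfl, hPB⟩
    refine ⟨hP.series_mem_smoothFun, funext fun u => ?_⟩
    rw [hT P hP, series]
    have h1 : ∀ k, evalPoly (τ k • P k) u = 0 := fun k => by
      rw [evalPoly_smul_poly]
      by_cases hk : τ k = 0
      · rw [hk, zero_mul]
      · rw [hPB k hk, mul_zero]
    simp only [h1, tsum_zero, Pi.zero_apply]

/-- The map `p` allows one statement to serve both caps (`p` the identity) and great circles (`p` a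
parametrization). -/
theorem IsRapid.hasSum_integral {P : ℕ → MvPolynomial (Fin 3) ℝ} (hP : IsRapid P)
    {α : Type*} [MeasurableSpace α] (μ : Measure α) [IsFiniteMeasure μ] {p : α → S2}
    (hp : Measurable p) :
    HasSum (fun k => ∫ a, evalPoly (P k) (p a) ∂μ) (∫ a, series P (p a) ∂μ) := by
  obtain ⟨v, hv, hb⟩ := hP.exists_summable_bound
  refine hasSum_integral_of_dominated_convergence (fun k _ => v k) (fun k => ?_)
    (fun k => ae_of_all _ fun a => hb k (p a)) (ae_of_all _ fun _ => hv) (integrable_const _)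
    (ae_of_all _ fun a => hP.hasSum (p a))
  exact ((continuous_evalPoly_coe (P k)).measurable.comp hp).aestronglyMeasurable

theorem isMultiplier_neckQ : IsMultiplier neckQ eigenQ := by
  intro P hP y
  have h := (hP.hasSum_integral (area.restrict (cap 0 y)) measurable_id).mul_left
    (1 / (2 * Real.pi))
  refine h.tsum_eq.symm.trans (tsum_congr fun k => ?_)
  have h1 := neckQ_polyRestrict (hP.mem k) y
  simp only [neckQ, capTransform, polyRestrict_apply] at h1
  rw [evalPoly_smul_poly, ← h1]
  rfl

theorem continuous_circleParam (y : S2) : Continuous (circleParam 0 y) := by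
  refine Continuous.subtype_mk ?_ _
  unfold circleVec
  fun_prop

theorem isMultiplier_neckR : IsMultiplier neckR eigenR := by
  intro P hP y
  have h := (hP.hasSum_integral (volume.restrict (Ioc 0 (2 * Real.pi)))
    (continuous_circleParam y).measurable).mul_left (1 / (2 * Real.pi))
  simp only [← intervalIntegral.integral_of_le Real.two_pi_pos.le] at h
  refine h.tsum_eq.symm.trans (tsum_congr fun k => ?_)
  have h1 := neckR_polyRestrict (hP.mem k) y
  simp only [neckR, circleTransform, polyRestrict_apply] at h1
  rw [evalPoly_smul_poly, ← h1]

/-! ### Spectral description of the parity classes of smooth functions -/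

theorem evalPoly_neg_of_isHomogeneous {P : MvPolynomial (Fin 3) ℝ} {k : ℕ}
    (hP : P.IsHomogeneous k) (x : E3) : evalPoly P (-x) = (-1) ^ k * evalPoly P x := by
  rw [← evalPoly_smul_of_isHomogeneous hP, neg_one_smul]

/-- For `c = 1` and `c = -1` the kernel consists of the odd, resp. even functions, so the
description of kernels of multipliers also describes the parity classes. -/
theorem isMultiplier_comp_neg_add (c : ℝ) :
    IsMultiplier (fun h u => h u + c * h (-u)) fun k => 1 + c * (-1) ^ k := by
  intro P hP u
  have h1 := (hP.hasSum u).add ((hP.hasSum (-u)).mul_left c)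
  refine h1.tsum_eq.symm.trans (tsum_congr fun k => ?_)
  rw [evalPoly_smul_poly, show ((-u : S2) : E3) = -(u : E3) from rfl,
    evalPoly_neg_of_isHomogeneous (mem_harmonicPoly.1 (hP.mem k)).1]
  ring

theorem smoothOdd_eq : smoothOdd = smoothSpec {k | Odd k} := by
  have h := (isMultiplier_comp_neg_add 1).ker fun k => by
    have hk : (0 : ℝ) ≤ k := k.cast_nonneg
    rcases neg_one_pow_eq_or ℝ k with e | e <;> rw [e, abs_le] <;> constructor <;> nlinarith
  have hs : {k : ℕ | 1 + (1 : ℝ) * (-1) ^ k = 0} = {k | Odd k} := by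
    ext k
    rcases Nat.even_or_odd k with hk | hk
    · simp [hk.neg_one_pow, Nat.not_odd_iff_even.2 hk]
    · simp [hk.neg_one_pow, hk]
  rw [hs] at h
  rw [← h]
  ext f
  simp only [smoothOdd, mem_ofPred_eq, funext_iff, Pi.zero_apply, one_mul]
  exact and_congr_right fun _ => forall_congr' fun u =>
    ⟨fun e => by rw [e]; ring, fun e => by linarith⟩

theorem integral_evalPoly_of_pos {k : ℕ} (hk : k ≠ 0) {P : MvPolynomial (Fin 3) ℝ}
    (hP : P ∈ harmonicPoly k) : ∫ u : S2, evalPoly P u ∂area = 0 := by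
  have h1 : (1 : MvPolynomial (Fin 3) ℝ) ∈ harmonicPoly 0 :=
    mem_harmonicPoly_of_lt_two two_pos (MvPolynomial.isHomogeneous_one _ _)
  have h := inner_eq_zero_of_mem_harmonics hk.symm (polyL2_mem_harmonics h1)
    (polyL2_mem_harmonics hP)
  rw [inner_polyL2_polyL2] at h
  simpa [evalPoly] using h

/-- Harmonics of positive degree are orthogonal to constants, so the integral sees only the
component of degree `0`, which is itself a constant. -/
theorem smoothEvenZeroMean_eq : smoothEvenZeroMean = smoothSpec {k | Even k ∧ k ≠ 0} := by
  have hbound : ∀ k : ℕ, |1 + (-1 : ℝ) * (-1) ^ k| ≤ 2 * (k + 1) ^ 2 := fun k => by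
    have hk : (0 : ℝ) ≤ k := k.cast_nonneg
    rcases neg_one_pow_eq_or ℝ k with e | e <;> rw [e, abs_le] <;> constructor <;> nlinarith
  have hker := (isMultiplier_comp_neg_add (-1)).ker hbound
  have hs : {k : ℕ | 1 + (-1 : ℝ) * (-1) ^ k = 0} = {k | Even k} := by
    ext k
    rcases Nat.even_or_odd k with hk | hk
    · simp [hk.neg_one_pow, hk]
    · simp [hk.neg_one_pow, Nat.not_even_iff_odd.2 hk]
  rw [hs] at hker
  have hiff : ∀ f : S2 → ℝ, (f ∈ smoothFun ∧ ∀ u, f (-u) = f u) ↔ f ∈ smoothSpec {k | Even k} := by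
    intro f
    rw [← hker]
    simp only [mem_ofPred_eq, funext_iff, Pi.zero_apply]
    exact and_congr_right fun _ => forall_congr' fun u =>
      ⟨fun e => by rw [e]; ring, fun e => by linarith⟩
  have hint : ∀ P, IsRapid P → ∫ u, series P u ∂area = ∫ u : S2, evalPoly (P 0) u ∂area := by
    intro P hP
    refine (hP.hasSum_integral area measurable_id).unique (hasSum_single 0 fun k hk => ?_)
    exact integral_evalPoly_of_pos hk (hP.mem k)
  have hconst : ∀ P ∈ harmonicPoly 0, ∃ c : ℝ, ∀ x, evalPoly P x = c := by
    intro P hP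
    have h := (MvPolynomial.totalDegree_zero_iff_isHomogeneous _).2 (mem_harmonicPoly.1 hP).1
    rw [MvPolynomial.totalDegree_eq_zero_iff_eq_C] at h
    exact ⟨MvPolynomial.coeff 0 P, fun x => by rw [h]; simp [evalPoly]⟩
  ext f
  constructor
  · rintro ⟨hf, he, h0⟩
    obtain ⟨P, hP, rfl, hPe⟩ := (hiff f).1 ⟨hf, he⟩
    refine ⟨P, hP, rfl, fun k hk u => ?_⟩
    by_cases hk0 : k = 0
    · subst hk0
      obtain ⟨c, hc⟩ := hconst _ (hP.mem 0)
      rw [hint P hP] at h0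
      simp only [hc, integral_const, area_real_univ, smul_eq_mul] at h0 ⊢
      exact (mul_eq_zero.1 h0).resolve_left (by positivity)
    · exact hPe k (fun h => hk ⟨h, hk0⟩) u
  · rintro ⟨P, hP, rfl, hPe⟩
    obtain ⟨h1, h2⟩ := (hiff (series P)).2 ⟨P, hP, rfl, fun k hk u => hPe k (fun h => hk h.1) u⟩
    refine ⟨h1, h2, ?_⟩
    rw [hint P hP]
    simp only [hPe 0 (by simp), integral_zero]

theorem bijOn_neckQ : BijOn neckQ smoothOdd smoothOdd := by
  rw [smoothOdd_eq]
  exact isMultiplier_neckQ.bijOn (fun k => (abs_eigenQ_le k).trans (by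
    nlinarith [k.cast_nonneg (α := ℝ)])) (fun k hk => eigenQ_ne_zero hk)
    fun k hk => abs_eigenQ_inv_le hk

theorem bijOn_neckR : BijOn neckR smoothEvenZeroMean smoothEvenZeroMean := by
  rw [smoothEvenZeroMean_eq]
  exact isMultiplier_neckR.bijOn (fun k => (abs_eigenR_le k).trans (by
    nlinarith [k.cast_nonneg (α := ℝ)])) (fun k hk => eigenR_ne_zero hk.1)
    fun k hk => abs_eigenR_inv_le hk.1

theorem ker_neckQ : {h ∈ smoothFun | neckQ h = 0} = smoothEvenZeroMean := by
  rw [isMultiplier_neckQ.ker (fun k => (abs_eigenQ_le k).trans (by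
    nlinarith [k.cast_nonneg (α := ℝ)])), smoothEvenZeroMean_eq]
  congr 1
  ext k
  refine ⟨fun h => ⟨?_, ?_⟩, fun h => eigenQ_even h.1 h.2⟩
  · rw [← Nat.not_odd_iff_even]
    exact fun hk => eigenQ_ne_zero hk h
  · rintro rfl
    exact one_ne_zero (eigenQ_zero.symm.trans h)

theorem ker_neckR : {h ∈ smoothFun | neckR h = 0} = smoothOdd := by
  rw [isMultiplier_neckR.ker (fun k => (abs_eigenR_le k).trans (by
    nlinarith [k.cast_nonneg (α := ℝ)])), smoothOdd_eq]
  congr 1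
  ext k
  refine ⟨fun h => ?_, fun h => eigenR_odd h⟩
  change Odd k
  rw [← Nat.not_even_iff_odd]
  exact fun hk => eigenR_ne_zero hk h

/-! ### The neck transform on Sobolev spaces -/

theorem norm_neckQL2_le (h : L2) : ‖neckQL2 h‖ ≤ area.real univ ^ (1 / 2 : ℝ) * ‖h‖ := by
  have h1 := Lp.norm_le_of_ae_bound (f := neckQL2 h) (norm_nonneg h) (by
    filter_upwards [MemLp.coeFn_toLp (neckQ_memLp h)] with y hy
    change ‖(neckQ_memLp h).toLp (neckQ h) y‖ ≤ _
    rw [hy]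
    exact abs_neckQ_le h y)
  refine h1.trans (le_of_eq ?_)
  rw [measureUnivNNReal, Measure.real]
  norm_num
  left
  rfl

theorem neckQL2_polyL2 {k : ℕ} {P : MvPolynomial (Fin 3) ℝ} (hP : P ∈ harmonicPoly k) :
    neckQL2 (polyL2 P) = eigenQ k • polyL2 P := by
  refine Lp.ext ?_
  filter_upwards [MemLp.coeFn_toLp (neckQ_memLp (polyL2 P)), Lp.coeFn_smul (eigenQ k) (polyL2 P),
    coeFn_polyL2 P] with y h1 h2 h3
  rw [h2, Pi.smul_apply, h3]
  refine h1.trans ?_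
  rw [neckQ_congr (coeFn_polyL2 P)]
  rw [← show ⇑(polyRestrict P) = fun u : S2 => evalPoly P u from
    funext fun u => polyRestrict_apply P u, neckQ_polyRestrict hP y, polyRestrict_apply, smul_eq_mul]

/-- `neckQL2` is bounded, so it may be applied termwise to the expansion of `h`; the components of
the result are then unique. -/
theorem starProjection_neckQL2 (h : L2) (k : ℕ) :
    (harmonics k).starProjection (neckQL2 h) = eigenQ k • (harmonics k).starProjection h := by
  have h1 := (hasSum_starProjection h).mapL (neckQL2.mkContinuous _ norm_neckQL2_le)
  refine starProjection_of_hasSum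
    (w := fun k => eigenQ k • (harmonics k).starProjection h)
    (fun k => Submodule.smul_mem _ _ (Submodule.starProjection_apply_mem _ _)) ?_ k
  have h2 : ∀ j, eigenQ j • (harmonics j).starProjection h =
      neckQL2.mkContinuous _ norm_neckQL2_le ((harmonics j).starProjection h) := fun j => by
    obtain ⟨P, hP, hPe⟩ := mem_harmonics.1
      (Submodule.starProjection_apply_mem (harmonics j) h)
    rw [LinearMap.mkContinuous_apply, ← hPe, neckQL2_polyL2 hP]
  simp only [h2]
  exact h1

/-! ### The antipodal map and odd classes in `L²` -/

theorem measurePreserving_neg : MeasurePreserving (fun u : S2 => -u) area area := by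
  have h := measurePreserving_sphereIsom (LinearIsometryEquiv.neg ℝ)
  have e : (fun u : S2 => -u) = sphereIsom (LinearIsometryEquiv.neg ℝ) :=
    funext fun u => (sphereIsom_neg u).symm
  rw [e]
  exact h

/-- Composition with the antipodal map, on `L²`. -/
def antipodal (h : L2) : L2 := Lp.compMeasurePreserving _ measurePreserving_neg h

theorem coeFn_antipodal (h : L2) : antipodal h =ᵐ[area] fun u => h (-u) :=
  Lp.coeFn_compMeasurePreserving h measurePreserving_neg

theorem inner_polyL2_antipodal {k : ℕ} {P : MvPolynomial (Fin 3) ℝ} (hP : P ∈ harmonicPoly k)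
    (h : L2) : inner ℝ (polyL2 P) (antipodal h) = (-1) ^ k * inner ℝ (polyL2 P) h := by
  rw [inner_polyL2_left, inner_polyL2_left, ← integral_const_mul,
    ← integral_comp_neg fun u : S2 => (-1) ^ k * (h u * evalPoly P u)]
  refine integral_congr_ae ?_
  filter_upwards [coeFn_antipodal h] with u hu
  rw [hu, show ((-u : S2) : E3) = -(u : E3) from rfl,
    evalPoly_neg_of_isHomogeneous (mem_harmonicPoly.1 hP).1]
  have h1 : (-1 : ℝ) ^ k * (-1) ^ k = 1 := by rw [← mul_pow]; norm_num
  linear_combination (-(h (-u) * evalPoly P u)) * h1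

theorem starProjection_antipodal (h : L2) (k : ℕ) : (harmonics k).starProjection (antipodal h) =
    (-1 : ℝ) ^ k • (harmonics k).starProjection h := by
  refine Submodule.eq_starProjection_of_mem_of_inner_eq_zero (K := harmonics k)
    (Submodule.smul_mem _ _ (Submodule.starProjection_apply_mem _ _)) fun v hv => ?_
  obtain ⟨P, hP, rfl⟩ := mem_harmonics.1 hv
  have h1 := Submodule.starProjection_inner_eq_zero (K := harmonics k) h _ hv
  rw [inner_sub_left, sub_eq_zero, real_inner_comm] at h1
  rw [inner_sub_left, inner_smul_left, ← h1, real_inner_comm, inner_polyL2_antipodal hP]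
  simp

theorem mem_oddL2_iff_antipodal {h : L2} : h ∈ oddL2 ↔ antipodal h = -h := by
  constructor
  · rintro ⟨f, hf, hhf⟩
    refine Lp.ext ?_
    filter_upwards [coeFn_antipodal h, Lp.coeFn_neg h, hhf,
      measurePreserving_neg.quasiMeasurePreserving.ae_eq_comp hhf] with u h1 h2 h3 h4
    rw [h1, h2, Pi.neg_apply, h3, ← hf u]
    exact h4
  · intro e
    -- A representative that is odd at every point, obtained by antisymmetrizing an arbitrary one.
    refine ⟨fun u => (h u - h (-u)) / 2, fun u => by simp only [neg_neg]; ring, ?_⟩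
    filter_upwards [coeFn_antipodal h, Lp.coeFn_neg h] with u h1 h2
    rw [← h1, e, h2, Pi.neg_apply]
    ring

/-- The antipodal map acts as `(-1)^k` in degree `k`, so being reversed by it forces `2hₖ = 0` for
even `k` and nothing for odd `k`. -/
theorem mem_oddL2_iff {h : L2} :
    h ∈ oddL2 ↔ ∀ k, Even k → (harmonics k).starProjection h = 0 := by
  rw [mem_oddL2_iff_antipodal]
  constructor
  · intro e k hk
    have h1 := starProjection_antipodal h k
    rw [e, map_neg, hk.neg_one_pow, one_smul, neg_eq_iff_add_eq_zero, ← two_smul ℝ] at h1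
    exact (smul_eq_zero.1 h1).resolve_left two_ne_zero
  · intro e
    refine ext_starProjection fun k => ?_
    rw [starProjection_antipodal, map_neg]
    rcases Nat.even_or_odd k with hk | hk
    · rw [e k hk, smul_zero, neg_zero]
    · rw [hk.neg_one_pow, neg_one_smul]

theorem neckQL2_mem_oddL2 {h : L2} (hh : h ∈ oddL2) : neckQL2 h ∈ oddL2 :=
  mem_oddL2_iff.2 fun k hk => by
    rw [starProjection_neckQL2, mem_oddL2_iff.1 hh k hk, smul_zero]

/-! ### Sobolev estimates and the isomorphism -/

theorem sobolev_weight_bounds (s : ℝ) {k : ℕ} (hk : Odd k) :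
    1 / 4 * max 1 (k : ℝ) ^ (2 * s) ≤ max 1 (k : ℝ) ^ (2 * (s + 3 / 2)) * eigenQ k ^ 2 ∧
      max 1 (k : ℝ) ^ (2 * (s + 3 / 2)) * eigenQ k ^ 2 ≤ 4 * max 1 (k : ℝ) ^ (2 * s) := by
  have hk1 : (1 : ℝ) ≤ k := by exact_mod_cast hk.pos
  obtain ⟨m, rfl⟩ := hk
  have h1 := le_eigenQ_sq_mul m
  have h2 := eigenQ_sq_mul_le m
  have hpos : (0 : ℝ) < (2 * m + 1 : ℕ) := by positivity
  have hw := Real.rpow_nonneg hpos.le (2 * s)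
  -- The shift by `3/2` contributes exactly `k³`, independently of `s`, so the bounds on `k³ c(k)²`
  -- apply. The upper bound `3/2` is relaxed to `4`, which makes the constants for the norms `1/2`
  -- and `2`.
  rw [max_eq_right hk1, show 2 * (s + 3 / 2) = 2 * s + (3 : ℕ) by push_cast; ring,
    Real.rpow_add hpos, Real.rpow_natCast]
  push_cast at hw ⊢
  constructor <;> nlinarith

theorem sobolevEnergy_neckQL2 (s : ℝ) (h : L2) : sobolevEnergy s (neckQL2 h) =
    ∑' k : ℕ, ENNReal.ofReal (max 1 (k : ℝ) ^ (2 * s) * eigenQ k ^ 2) *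
      ‖(harmonics k).starProjection h‖ₑ ^ 2 := by
  refine tsum_congr fun k => ?_
  rw [starProjection_neckQL2, enorm_smul, mul_pow, ← mul_assoc, Real.enorm_eq_ofReal_abs,
    ← ENNReal.ofReal_pow (abs_nonneg _), sq_abs, ENNReal.ofReal_mul (by positivity)]

theorem sobolevEnergy_le_neckQL2 (s : ℝ) {h : L2} (hh : h ∈ oddL2) :
    ENNReal.ofReal (1 / 4) * sobolevEnergy s h ≤ sobolevEnergy (s + 3 / 2) (neckQL2 h) := by
  rw [sobolevEnergy_neckQL2, sobolevEnergy, ← ENNReal.tsum_mul_left]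
  refine ENNReal.tsum_le_tsum fun k => ?_
  rcases Nat.even_or_odd k with hk | hk
  · simp [mem_oddL2_iff.1 hh k hk]
  · rw [← mul_assoc, ← ENNReal.ofReal_mul (by norm_num)]
    exact mul_le_mul_left (ENNReal.ofReal_le_ofReal (sobolev_weight_bounds s hk).1) _

theorem sobolevEnergy_neckQL2_le (s : ℝ) {h : L2} (hh : h ∈ oddL2) :
    sobolevEnergy (s + 3 / 2) (neckQL2 h) ≤ ENNReal.ofReal 4 * sobolevEnergy s h := by
  rw [sobolevEnergy_neckQL2, sobolevEnergy, ← ENNReal.tsum_mul_left]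
  refine ENNReal.tsum_le_tsum fun k => ?_
  rcases Nat.even_or_odd k with hk | hk
  · simp [mem_oddL2_iff.1 hh k hk]
  · rw [← mul_assoc, ← ENNReal.ofReal_mul (by norm_num)]
    exact mul_le_mul_left (ENNReal.ofReal_le_ofReal (sobolev_weight_bounds s hk).2) _

theorem ofReal_sq_mul_rpow_half {a : ℝ} (ha : 0 ≤ a) (E : ENNReal) :
    (ENNReal.ofReal (a ^ 2) * E) ^ (1 / 2 : ℝ) = ENNReal.ofReal a * E ^ (1 / 2 : ℝ) := by
  rw [ENNReal.mul_rpow_of_nonneg _ _ (by norm_num), ENNReal.ofReal_pow ha, ← ENNReal.rpow_natCast,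
    ← ENNReal.rpow_mul]
  norm_num

theorem sobolevNorm_neckQL2_bounds (s : ℝ) {h : L2} (hh : h ∈ oddL2) :
    ENNReal.ofReal (1 / 2) * sobolevNorm s h ≤ sobolevNorm (s + 3 / 2) (neckQL2 h) ∧
      sobolevNorm (s + 3 / 2) (neckQL2 h) ≤ ENNReal.ofReal 2 * sobolevNorm s h := by
  unfold sobolevNorm
  rw [← ofReal_sq_mul_rpow_half (by norm_num), ← ofReal_sq_mul_rpow_half (by norm_num)]
  refine ⟨ENNReal.rpow_le_rpow ?_ (by norm_num), ENNReal.rpow_le_rpow ?_ (by norm_num)⟩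
  · convert sobolevEnergy_le_neckQL2 s hh using 3
    norm_num
  · convert sobolevEnergy_neckQL2_le s hh using 3
    norm_num

theorem mem_sobolevOdd {s : ℝ} {h : L2} :
    h ∈ sobolevOdd s ↔ sobolevNorm s h < ⊤ ∧ h ∈ oddL2 := Iff.rfl

theorem neckQL2_injOn : InjOn neckQL2 (oddL2 : Set L2) := by
  intro f hf g hg e
  refine ext_starProjection fun k => ?_
  rcases Nat.even_or_odd k with hk | hk
  · rw [mem_oddL2_iff.1 hf k hk, mem_oddL2_iff.1 hg k hk]
  · have h1 := congrArg (harmonics k).starProjection e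
    rw [starProjection_neckQL2, starProjection_neckQL2] at h1
    exact smul_right_injective _ (eigenQ_ne_zero hk) h1

/-- The components must be `c(k)⁻¹ gₖ` in odd degrees. Since `c(k)⁻² ≤ 4k³`, finiteness of the
energy of order `3/2` is what makes them square summable. -/
theorem exists_neckQL2_eq {g : L2} (hg : g ∈ oddL2) (hs : sobolevEnergy (0 + 3 / 2) g < ⊤) :
    ∃ h ∈ oddL2, neckQL2 h = g := by
  classical
  have hsum : Summable fun k : ℕ =>
      max 1 (k : ℝ) ^ (2 * (0 + 3 / 2) : ℝ) * ‖(harmonics k).starProjection g‖ ^ 2 := by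
    have h1 := ENNReal.summable_toReal hs.ne
    refine h1.congr fun k => ?_
    rw [ENNReal.toReal_mul, ENNReal.toReal_ofReal (by positivity), ENNReal.toReal_pow,
      toReal_enorm]
  have hw : ∀ k, (if Odd k then (eigenQ k)⁻¹ • (harmonics k).starProjection g else 0) ∈
      harmonics k := fun k => by
    split_ifs
    · exact Submodule.smul_mem _ _ (Submodule.starProjection_apply_mem _ _)
    · exact Submodule.zero_mem _
  obtain ⟨h, -, hh⟩ := exists_hasSum_of_summable_sq hw (by
    refine (hsum.mul_left 4).of_nonneg_of_le (fun k => sq_nonneg _) fun k => ?_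
    split_ifs with hk
    · have h1 := (sobolev_weight_bounds 0 hk).1
      have h2 : 0 < eigenQ k ^ 2 := sq_pos_of_ne_zero (eigenQ_ne_zero hk)
      rw [mul_zero, Real.rpow_zero] at h1
      rw [norm_smul, mul_pow, Real.norm_eq_abs, sq_abs, inv_pow, ← mul_assoc]
      gcongr
      rw [inv_le_iff_one_le_mul₀ h2]
      linarith
    · rw [norm_zero, zero_pow two_ne_zero]
      positivity)
  refine ⟨h, mem_oddL2_iff.2 fun k hk => by rw [hh, if_neg (Nat.not_odd_iff_even.2 hk)],
    ext_starProjection fun k => ?_⟩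
  rw [starProjection_neckQL2, hh]
  split_ifs with hk
  · rw [smul_inv_smul₀ (eigenQ_ne_zero hk)]
  · rw [smul_zero, mem_oddL2_iff.1 hg k (Nat.not_odd_iff_even.1 hk)]

theorem sobolevEnergy_mono (h : L2) : Monotone fun s => sobolevEnergy s h := fun s t hst =>
  ENNReal.tsum_le_tsum fun k => by
    gcongr
    exact le_max_left _ _

/-- For `s ≥ 0` the target lies in `H^(3/2)`, so an odd preimage exists in `L²`; the lower Sobolev
estimate then places it in `H^s`. -/
theorem bijOn_neckQL2 {s : ℝ} (hs : 0 ≤ s) :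
    BijOn neckQL2 (sobolevOdd s) (sobolevOdd (s + 3 / 2)) := by
  refine ⟨fun h hh => ?_, neckQL2_injOn.mono fun h hh => hh.2, fun g hg => ?_⟩
  · exact mem_sobolevOdd.2 ⟨(sobolevNorm_neckQL2_bounds s hh.2).2.trans_lt
      (ENNReal.mul_lt_top ENNReal.ofReal_lt_top hh.1), neckQL2_mem_oddL2 hh.2⟩
  · obtain ⟨h, hh, rfl⟩ := exists_neckQL2_eq hg.2
      ((sobolevEnergy_mono g (by linarith)).trans_lt ((sobolevNorm_lt_top_iff _ _).1 hg.1))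
    refine ⟨h, mem_sobolevOdd.2 ⟨?_, hh⟩, rfl⟩
    have h1 := (sobolevNorm_neckQL2_bounds s hh).1.trans_lt hg.1
    by_contra h2
    rw [not_lt_top_iff.1 h2, ENNReal.mul_top (by norm_num)] at h1
    exact lt_irrefl _ h1
end NeckTransform

end

/-! ### The theorem -/

theorem mainTheorem9 :
    -- bijectivity on odd, resp. even mean-zero, smooth functions, and the kernels
    Set.BijOn NeckTransform.neckQ NeckTransform.smoothOdd NeckTransform.smoothOdd ∧
    Set.BijOn NeckTransform.neckR
      NeckTransform.smoothEvenZeroMean NeckTransform.smoothEvenZeroMean ∧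
    {h ∈ NeckTransform.smoothFun | NeckTransform.neckQ h = 0} =
      NeckTransform.smoothEvenZeroMean ∧
    {h ∈ NeckTransform.smoothFun | NeckTransform.neckR h = 0} = NeckTransform.smoothOdd ∧
    -- eigenvalues on spherical harmonics
    (∀ P ∈ NeckTransform.harmonicPoly 0,
      NeckTransform.neckQ (NeckTransform.polyRestrict P) = NeckTransform.polyRestrict P) ∧
    (∀ m : ℕ, 1 ≤ m → ∀ P ∈ NeckTransform.harmonicPoly (2 * m),
      NeckTransform.neckQ (NeckTransform.polyRestrict P) = 0) ∧
    (∀ m : ℕ, ∀ P ∈ NeckTransform.harmonicPoly (2 * m + 1), ∀ y : NeckTransform.S2,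
      NeckTransform.neckQ (NeckTransform.polyRestrict P) y =
        (-1 : ℝ) ^ m * (1 / (2 * m + 1 : ℝ)) * (((2 * m + 1)‼ : ℝ) / ((2 * m + 2)‼ : ℝ)) *
          NeckTransform.polyRestrict P y) ∧
    -- two-sided Sobolev estimate, with a constant independent of the order
    (∃ c : ℝ, 1 < c ∧ ∀ s : ℝ, ∀ h ∈ NeckTransform.oddL2,
      ENNReal.ofReal (1 / c) * NeckTransform.sobolevNorm s h ≤
          NeckTransform.sobolevNorm (s + 3 / 2) (NeckTransform.neckQL2 h) ∧
        NeckTransform.sobolevNorm (s + 3 / 2) (NeckTransform.neckQL2 h) ≤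
          ENNReal.ofReal c * NeckTransform.sobolevNorm s h) ∧
    -- the isomorphism of odd Sobolev spaces
    (∀ s : ℝ, 0 ≤ s → Set.BijOn NeckTransform.neckQL2
      (NeckTransform.sobolevOdd s) (NeckTransform.sobolevOdd (s + 3 / 2))) := by
  refine ⟨NeckTransform.bijOn_neckQ, NeckTransform.bijOn_neckR, NeckTransform.ker_neckQ,
    NeckTransform.ker_neckR, fun P hP => funext fun y => ?_, fun m hm P hP => funext fun y => ?_,
    fun m P hP y => ?_, ⟨2, one_lt_two, fun s h hh => NeckTransform.sobolevNorm_neckQL2_bounds s hh⟩,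
    fun s hs => NeckTransform.bijOn_neckQL2 hs⟩
  · rw [NeckTransform.neckQ_polyRestrict hP, NeckTransform.eigenQ_zero, one_mul]
  · rw [NeckTransform.neckQ_polyRestrict hP, NeckTransform.eigenQ_even (even_two_mul m) (by omega),
      zero_mul, Pi.zero_apply]
  · rw [NeckTransform.neckQ_polyRestrict hP, NeckTransform.eigenQ_odd]
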